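/- Let $S$ be a smooth closed (compact, without boundary) connected oriented surface of genus $g\ge 2$. Let $\wedge$ denote the intersection form on $H_1(S,\mathbb R)$, and for a continuous map $f:S\to S$ let $f_{*,1}$ be the induced endomorphism of $H_1(S,\mathbb R)$. An isotopy from the identity to a homeomorphism $k$ is a continuous path $I=(k_t)_{t\in[0,1]}$ of homeomorphisms of $S$ with $k_0=\mathrm{Id}$, $k_1=k$; write $I(z)$ for the path $t\mapsto k_t(z)$. If $k$ is isotopic to the identity and preserves the Borel probability measure $\mu$, its rotation vector $\mathrm{rot}_k(\mu)\in H_1(S,\mathbb R)$ is the class such that $$\int_S\Big(\int_{I(z)}\eta\Big)\,d\mu(z)=\langle[\eta],\mathrm{rot}_k(\mu)\rangle$$ for every closed $1$-form $\eta$ of class $C^1$ on $S$ and every isotopy $I$ from the identity to $k$ (since $g\ge 2$ it exists and does not depend on $I$). Let $f$ be an orientation-preserving $C^1$ diffeomorphism of $S$ that preserves a Borel probability measure $\mu$, and suppose that $f^q$ is isotopic to the identity for some integer $q\ge 1$. Then $\mathrm{rot}_{f^q}(\mu)$ is well defined and, for every $\rho\in H_1(S,\mathbb R)$, $$f_{*,1}(\rho)\wedge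 \mathrm{rot}_{f^q}(\mu)=\rho\wedge \mathrm{rot}_{f^q}(\mu).$$ Moreover, for every $C^1$ diffeomorphism $h$ of $S$ that is isotopic to the identity and preserves $\mu$, the map $(h\circ f)^q$ is isotopic to the identity, $\mathrm{rot}_h(\mu)$ and $\mathrm{rot}_{(h\circ f)^q}(\mu)$ are well defined, and $$\mathrm{rot}_{(h\circ f)^q}(\mu)\wedge \mathrm{rot}_{f^q}(\mu)=q\,\mathrm{rot}_h(\mu)\wedge \mathrm{rot}_{f^q}(\mu).$$ -/

import Mathlib

open scoped Manifold ContDiff Topology unitInterval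
open CategoryTheory

universe u

noncomputable section

/-- The model space of a surface. -/
abbrev Plane : Type := EuclideanSpace ℝ (Fin 2)

/-! ### Singular homology with real coefficients -/

section Homology

variable (S : Type u) [TopologicalSpace S]

/-- The real line, as a coefficient module in the universe of the space. -/
abbrev realCoeff : ModuleCat.{u} ℝ := ModuleCat.of ℝ (ULift.{u} ℝ)

/-- The singular chain complex of `S` with real coefficients. -/
abbrev singularChains : ChainComplex (ModuleCat.{u} ℝ) ℕ :=
  ((AlgebraicTopology.singularChainComplexFunctor (ModuleCat.{u} ℝ)).obj realCoeff.{u}).obj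
    (TopCat.of S)

/-- The first singular homology group `H₁(S, ℝ)`. -/
abbrev H1 : ModuleCat.{u} ℝ :=
  ((AlgebraicTopology.singularHomologyFunctor (ModuleCat.{u} ℝ) 1).obj realCoeff.{u}).obj
    (TopCat.of S)

/-- The closed connected orientable surface `S` has genus `g`: its first Betti number is `2g`. -/
def HasGenus (g : ℕ) : Prop := Module.finrank ℝ (H1 S) = 2 * g

variable {S}

/-- The endomorphism `f_{*,1}` of `H₁(S, ℝ)` induced by a continuous map `f`. -/
def homologyMap (f : C(S, S)) : H1 S →ₗ[ℝ] H1 S :=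
  (((AlgebraicTopology.singularHomologyFunctor (ModuleCat.{u} ℝ) 1).obj realCoeff.{u}).map
    (TopCat.ofHom f)).hom

/-- A singular `1`-simplex, seen as a path parametrized by `[0, 1]`, from its vertex `0` to its
vertex `1`. -/
def simplexPath (c : (TopCat.toSSet.obj (TopCat.of S)).obj (.op (SimplexCategory.mk 1))) :
    C(I, S) :=
  (TopCat.toSSetObjEquiv (TopCat.of S) _ c).comp
    (stdSimplexHomeomorphUnitInterval.symm : C(I, stdSimplex ℝ (Fin 2)))

/-- The linear extension to real singular `1`-chains of a function `φ` on paths. -/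
def chainEval (φ : C(I, S) → ℝ) : (singularChains S).X 1 →ₗ[ℝ] ULift.{u} ℝ :=
  ((SSet.isColimitChainComplexXCofan (TopCat.toSSet.obj (TopCat.of S)) realCoeff.{u} 1).desc
    (Limits.Cofan.mk realCoeff.{u} fun c =>
      ModuleCat.ofHom (φ (simplexPath c) • LinearMap.id))).hom

/-- Every homology class is the class of a cycle. -/
theorem exists_cycle (ρ : H1 S) :
    ∃ z : (singularChains S).cycles 1, ((singularChains S).homologyπ 1).hom z = ρ :=
  (ModuleCat.epi_iff_surjective ((singularChains S).homologyπ 1)).1 inferInstance ρ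

/-- A `1`-chain that is a cycle and represents the class `ρ`. -/
def representative (ρ : H1 S) : (singularChains S).X 1 :=
  ((singularChains S).iCycles 1).hom (Classical.choose (exists_cycle ρ))

end Homology

/-! ### Isotopies -/

/-- An isotopy `(f_t)`, `t ∈ [0, 1]`, from the identity of `S` to `f`: a continuous path of
homeomorphisms. -/
structure IsotopyFromId {S : Type u} [TopologicalSpace S] (f : S → S) where
  /-- The map `(t, z) ↦ f_t z`. -/
  toMap : C(I × S, S)
  isHomeomorph : ∀ t, IsHomeomorph fun z => toMap (t, z)
  map_zero : ∀ z, toMap (0, z) = z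
  map_one : ∀ z, toMap (1, z) = f z

/-- The trajectory `t ↦ f_t z` of the point `z`. -/
def IsotopyFromId.trajectory {S : Type u} [TopologicalSpace S] {f : S → S}
    (J : IsotopyFromId f) (z : S) : C(I, S) :=
  ⟨fun t => J.toMap (t, z), by fun_prop⟩

/-- `f` is isotopic to the identity. -/
def IsotopicToId {S : Type u} [TopologicalSpace S] (f : S → S) : Prop :=
  Nonempty (IsotopyFromId f)

/-! ### Closed one-forms and orientations on a surface -/

section Surface

variable {S : Type u} [TopologicalSpace S] [ChartedSpace Plane S]

variable (S) in
/-- The atlas of the surface is an oriented atlas: all transition maps have positive Jacobian.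
A smooth surface together with such an atlas is an oriented surface. -/
class OrientedAtlas : Prop where
  det_pos : ∀ e ∈ atlas Plane S, ∀ e' ∈ atlas Plane S, ∀ x ∈ (e.symm.trans e').source,
    0 < (fderiv ℝ (e.symm.trans e') x).det

/-- The differentiable map `f` preserves the orientation given by the (oriented) atlas. -/
def OrientationPreserving (f : S → S) : Prop :=
  ∀ x, 0 < (fderiv ℝ (chartAt Plane (f x) ∘ f ∘ (chartAt Plane x).symm) (chartAt Plane x x)).det

variable (S) in
/-- One-forms on `S` (no regularity required). -/
abbrev OneForm : Type u := (x : S) → TangentSpace (𝓡 2) x →L[ℝ] ℝ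

/-- Near the point `p`, the function `g` is of class `C²` and `dg = η`. -/
def IsPrimitiveNear (η : OneForm S) (g : S → ℝ) (p : S) : Prop :=
  ∀ᶠ y in 𝓝 p, ContMDiffAt (𝓡 2) 𝓘(ℝ, ℝ) 2 g y ∧
    ∀ v : TangentSpace (𝓡 2) y, mfderiv (𝓡 2) 𝓘(ℝ, ℝ) g y v = η y v

/-- `η` is a closed one-form of class `C¹`. By the Poincaré lemma these are the one-forms that
are locally differentials of functions of class `C²`. -/
def IsClosedForm (η : OneForm S) : Prop :=
  ∀ p, ∃ g : S → ℝ, IsPrimitiveNear η g p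

/-- `F` is a primitive of `η` along the continuous path `γ`: locally, the increments of `F` are
the increments along `γ` of a local primitive of `η`. -/
def IsPrimitiveAlong (η : OneForm S) (γ : C(I, S)) (F : I → ℝ) : Prop :=
  ∀ t, ∃ g : S → ℝ, IsPrimitiveNear η g (γ t) ∧ ∀ᶠ s in 𝓝 t, F s - F t = g (γ s) - g (γ t)

/-- The integral `∫_γ η` of a closed one-form along a continuous path: the total increment of a
primitive along the path, which exists and is unique up to a constant. -/
def pathIntegral (η : OneForm S) (γ : C(I, S)) : ℝ :=
  let F := Classical.epsilon (IsPrimitiveAlong η γ)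
  F 1 - F 0

/-- The pairing `⟨[η], ρ⟩` of the class of a closed one-form with a homology class: the integral
of `η` over a cycle that represents `ρ`. -/
def formPairing (η : OneForm S) (ρ : H1 S) : ℝ :=
  (chainEval (pathIntegral η) (representative ρ)).down

/-- The coefficient of `η ∧ β` in the chart of the atlas centered at `p`, at the point of
coordinates `y`, with respect to `dy₀ ∧ dy₁`. -/
def wedgeCoeff (η β : OneForm S) (p : S) (y : Plane) : ℝ :=
  let x := (chartAt Plane p).symm y
  let e (i : Fin 2) : TangentSpace (𝓡 2) x :=
    mfderiv (𝓡 2) (𝓡 2) (chartAt Plane p).symm y (EuclideanSpace.single i (1 : ℝ) : Plane)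
  η x (e 0) * β x (e 1) - η x (e 1) * β x (e 0)

variable [IsManifold (𝓡 2) ∞ S] [CompactSpace S] [T2Space S]

variable (S) in
/-- A smooth partition of unity subordinate to the domains of the charts. -/
def chartPartition : SmoothPartitionOfUnity S (𝓡 2) S Set.univ :=
  Classical.choose (SmoothPartitionOfUnity.exists_isSubordinate_chartAt_source (𝓡 2) S)

/-- The integral `∫_S η ∧ β` of the exterior product of two continuous one-forms over the oriented
closed surface `S`. -/
def integralWedge (η β : OneForm S) : ℝ :=
  ∑ᶠ p : S, ∫ y in (chartAt Plane p).target,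
    chartPartition S p ((chartAt Plane p).symm y) * wedgeCoeff η β p y

/-- The closed form `β` is a Poincaré dual of the homology class `ρ`:
`⟨[η], ρ⟩ = ∫_S η ∧ β` for every closed one-form `η`. -/
def IsPoincareDual (ρ : H1 S) (β : OneForm S) : Prop :=
  IsClosedForm β ∧ ∀ η : OneForm S, IsClosedForm η → formPairing η ρ = integralWedge η β

/-- A Poincaré dual of `ρ`; its cohomology class is determined by `ρ`. -/
def poincareDual (ρ : H1 S) : OneForm S := Classical.epsilon (IsPoincareDual ρ)

/-- The intersection form `ρ ∧ ρ'` on `H₁(S, ℝ)`. -/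
def intersectionForm (ρ ρ' : H1 S) : ℝ := integralWedge (poincareDual ρ) (poincareDual ρ')

end Surface

/-! ### Rotation vectors of invariant measures -/

section Rotation

variable {S : Type u} [TopologicalSpace S] [ChartedSpace Plane S] [MeasurableSpace S]

/-- `f` is isotopic to the identity and `r` is the rotation vector of the measure `μ` for every
isotopy `J` from the identity to `f`:
`∫_S (∫_{J(z)} η) dμ(z) = ⟨[η], r⟩` for every closed one-form `η`. -/
def IsRotationVector (f : S → S) (μ : MeasureTheory.Measure S) (r : H1 S) : Prop :=
  IsotopicToId f ∧ ∀ J : IsotopyFromId f, ∀ η : OneForm S, IsClosedForm η →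
    ∫ z, pathIntegral η (J.trajectory z) ∂μ = formPairing η r

/-- The rotation vector `rot_f(μ)`. -/
def rotationVector (f : S → S) (μ : MeasureTheory.Measure S) : H1 S :=
  Classical.epsilon (IsRotationVector f μ)

end Rotation

end

/-! Write r = rot_{f^q}(μ) and s = rot_h(μ). Three facts carry the theorem.

Rotation vectors exist and do not depend on the isotopy. Two homotopies from the identity to the
same map differ by a loop of maps based at the identity, so it suffices that the trajectories of
such a loop have zero periods (`pathIntegral_eq_zero_of_loop`). Suppose that a trajectory has a
nonzero η-period. If ∫ η ∧ β = 0, then η ∧ β is exact, and its pull-back to the torus swept by the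
trajectories issued from a loop α integrates to zero; this is the relation (∫_traj η)(∫_α β) = (∫_α
η)(∫_traj β) of `pathIntegral_mul_eq_of_loop`. A closed β with ∫ η ∧ β = 0 and ∫_traj β = 0
therefore has no periods. These are two linear conditions, so b₁ ≤ 2, whereas b₁ = 2g ≥ 4.
Invariance of μ makes the mean of the path integrals vanish on exact forms, so it is the evaluation
on a homology class (`exists_rotation_class`).

The class r is fixed by f. Since f commutes with f^q and preserves μ, conjugating a homotopy from
the identity to f^q by f gives another one with the same mean rotation
(`IsRotationVector.homologyMap_symm`). Since f preserves the orientation, the dual of f_*ρ is the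
pull-back by f⁻¹ of the dual β of ρ, up to an exact form (`exists_isPoincareDual_homologyMap`).
Hence f_*ρ ∧ r = ⟨β, (f⁻¹)_* r⟩ = ⟨β, r⟩ = ρ ∧ r.

The map (h ∘ f)^q is reached by an isotopy from the identity to f^q followed by t ↦ (h_t ∘ f)^q. The
second part has mean rotation Σ_{j<q} f_*^j s (`integral_iterateHomotopy`), so rot_{(h∘f)^q}(μ) = r
+ Σ_{j<q} f_*^j s. Intersecting with r kills r ∧ r by antisymmetry, and each of the q other terms
equals s ∧ r by the invariance just obtained.

The foundation is a comparison of singular homology with closed forms of class C¹: integrals along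
continuous paths are cocycles, every linear form on H₁ comes from a closed form
(`pairing_surjective`), and forms without periods are exact. Poincaré duality
(`exists_isPoincareDual`) follows from two statements about forms: a two-form of zero integral is
exact, and a closed form wedge-orthogonal to all closed forms is exact. -/

set_option linter.unusedSectionVars false

noncomputable section

/-! ### Gluing local functions with locally constant differences -/

/-- A function that is locally constant on a preconnected set is constant on it. -/
theorem IsPreconnected.eq_of_eventually_eq {X : Type*} [TopologicalSpace X] {s : Set X}
    (hs : IsPreconnected s) {α : Type*} {w : X → α} (h : ∀ x ∈ s, ∀ᶠ y in 𝓝[s] x, w y = w x) {x y : X}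
    (hx : x ∈ s) (hy : y ∈ s) : w y = w x := by
  refine hs.induction₂ (fun x y => w y = w x) h (fun x y z _ _ _ h₁ h₂ => h₂.trans h₁)
    (fun x y _ _ h => h.symm) hx hy

/-- `X` behaves like a simply connected space for real functions: local functions whose
differences are locally constant glue to a global function, up to local constants. -/
def GluesLocalFunctions (X : Type*) [TopologicalSpace X] : Prop :=
  ∀ f : X → X → ℝ, (∀ x, ∀ᶠ y in 𝓝 x, ∀ᶠ z in 𝓝 y, f x z - f x y = f y z - f y y) →
    ∃ F : X → ℝ, ∀ x, ∀ᶠ y in 𝓝 x, F y - F x = f x y - f x x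

theorem GluesLocalFunctions.of_homeomorph {X Y : Type*} [TopologicalSpace X] [TopologicalSpace Y]
    (h : GluesLocalFunctions X) (e : X ≃ₜ Y) : GluesLocalFunctions Y := by
  intro f hf
  obtain ⟨F, hF⟩ := h (fun x y => f (e x) (e y)) (fun x => by
    have h1 := e.continuous.continuousAt.eventually (hf (e x))
    filter_upwards [h1] with y hy
    exact e.continuous.continuousAt.eventually hy)
  refine ⟨F ∘ e.symm, fun y => ?_⟩
  have := e.symm.continuous.continuousAt.eventually (hF (e.symm y))
  simpa using this

/-- At the scale of a Lebesgue number the local functions define increments `d` that are additive on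
small triangles. Summing them along a finely subdivided segment from a base point gives the global
function; convexity supplies the segments and the connectedness of intersections of balls. -/
theorem Convex.gluesLocalFunctions {E : Type*} [NormedAddCommGroup E] [NormedSpace ℝ E]
    {K : Set E} (hK : Convex ℝ K) (hKc : IsCompact K) : GluesLocalFunctions K := by
  intro f hf
  have : CompactSpace K := isCompact_iff_compactSpace.1 hKc
  rcases K.eq_empty_or_nonempty with rfl | ⟨x₀, hx₀⟩
  · exact ⟨0, fun x => x.2.elim⟩
  have hball : ∀ x y : K, ∀ r : ℝ, IsPreconnected (Metric.ball x r ∩ Metric.ball y r) := by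
    intro x y r
    have hc : Convex ℝ (K ∩ (Metric.ball (x : E) r ∩ Metric.ball (y : E) r)) :=
      hK.inter ((convex_ball _ _).inter (convex_ball _ _))
    rw [← Topology.IsInducing.subtypeVal.isPreconnected_image]
    convert hc.isPreconnected using 1
    ext z
    constructor
    · rintro ⟨w, hw, rfl⟩
      exact ⟨w.2, hw⟩
    · rintro ⟨hz, hw⟩
      exact ⟨⟨z, hz⟩, hw, rfl⟩
  choose ε hε hfε using fun x => Metric.eventually_nhds_iff_ball.1 (hf x)
  obtain ⟨δ, hδ, hcov⟩ := lebesgue_number_lemma_of_metric (isCompact_univ (X := K))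
    (c := fun x : K => Metric.ball x (ε x)) (fun _ => Metric.isOpen_ball)
    (fun x _ => Set.mem_iUnion.2 ⟨x, Metric.mem_ball_self (hε x)⟩)
  choose c hc using fun x : K => hcov x (Set.mem_univ x)
  set d : K → K → ℝ := fun x y => f (c x) y - f (c x) x with hd
  -- Both `f (c x)` and `f (c y)` have near `w` the increments of `f w`, so their difference is
  -- locally constant on the connected intersection of the two balls.
  have key : ∀ x y z : K, dist x y < δ → dist x z < δ → dist y z < δ →
      d x y + d y z = d x z := by
    intro x y z hxy hxz hyz
    have := (hball x y δ).eq_of_eventually_eq (w := fun w => f (c x) w - f (c y) w) (by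
      rintro w ⟨hw1, hw2⟩
      refine Filter.Eventually.filter_mono nhdsWithin_le_nhds ?_
      filter_upwards [hfε _ w (hc x hw1), hfε _ w (hc y hw2)] with v h1 h2
      linarith) (x := y) (y := z) ⟨by simpa [dist_comm] using hxy, by simpa using hδ⟩
        ⟨by simpa [dist_comm] using hxz, by simpa [dist_comm] using hyz⟩
    simp only [hd]
    linarith
  have hdself : ∀ x, d x x = 0 := fun x => by simp [hd]
  obtain ⟨R, hR⟩ := hKc.isBounded.exists_norm_le
  -- The steps of a segment from x₀ have length at most 2R/n, which has to be less than δ/2; the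
  -- added 1 keeps n positive when R = 0.
  obtain ⟨n, hn⟩ := exists_nat_gt (4 * (R + 1) / δ)
  have hR0 : 0 ≤ R := (norm_nonneg _).trans (hR x₀ hx₀)
  have hn0 : (0 : ℝ) < n := lt_of_le_of_lt (by positivity) hn
  set p : K → ℕ → K := fun x k => if h : k ≤ n then
    ⟨AffineMap.lineMap x₀ (x : E) ((k : ℝ) / n), hK.lineMap_mem hx₀ x.2
      ⟨by positivity, div_le_one_of_le₀ (by exact_mod_cast h) hn0.le⟩⟩ else x with hp
  have hpv : ∀ x k, k ≤ n → (p x k : E) = x₀ + ((k : ℝ) / n) • ((x : E) - x₀) := by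
    intro x k hk
    simp [hp, hk, AffineMap.lineMap_apply, add_comm]
  have hp0 : ∀ x, p x 0 = ⟨x₀, hx₀⟩ := fun x => Subtype.ext (by simp [hpv x 0 (Nat.zero_le _)])
  have hpn : ∀ x, p x n = x := fun x => Subtype.ext (by rw [hpv x n le_rfl, div_self hn0.ne']; simp)
  have hstep : ∀ x k, k < n → dist (p x k) (p x (k + 1)) < δ / 2 := by
    intro x k hk
    rw [Subtype.dist_eq, hpv x k hk.le, hpv x (k + 1) hk, dist_eq_norm]
    have : x₀ + ((k : ℝ) / n) • ((x : E) - x₀) - (x₀ + (((k + 1 : ℕ) : ℝ) / n) • ((x : E) - x₀))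
        = (-(1 / n : ℝ)) • ((x : E) - x₀) := by
      rw [add_sub_add_left_eq_sub, ← sub_smul]
      congr 1
      push_cast
      ring
    rw [this, norm_smul, norm_neg, Real.norm_of_nonneg (by positivity), one_div, inv_mul_eq_div,
      div_lt_iff₀ hn0]
    have h1 : ‖(x : E) - x₀‖ ≤ 2 * R := (norm_sub_le _ _).trans (by linarith [hR x x.2, hR x₀ hx₀])
    rw [div_lt_iff₀ hδ] at hn
    nlinarith
  have hpp : ∀ x y k, k ≤ n → dist (p x k) (p y k) ≤ dist x y := by
    intro x y k hk
    rw [Subtype.dist_eq, hpv x k hk, hpv y k hk, dist_eq_norm, add_sub_add_left_eq_sub, ← smul_sub,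
      norm_smul, Real.norm_of_nonneg (by positivity), Subtype.dist_eq, dist_eq_norm]
    have : (k : ℝ) / n ≤ 1 := div_le_one_of_le₀ (by exact_mod_cast hk) hn0.le
    calc _ ≤ 1 * ‖(x : E) - x₀ - (y - x₀)‖ := by gcongr
      _ = _ := by simp
  refine ⟨fun x => ∑ k ∈ Finset.range n, d (p x k) (p x (k + 1)), fun x => ?_⟩
  have hloc : ∀ y, dist x y < δ / 2 →
      (∑ k ∈ Finset.range n, d (p y k) (p y (k + 1)))
        - ∑ k ∈ Finset.range n, d (p x k) (p x (k + 1)) = d x y := by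
    intro y hy
    rw [← Finset.sum_sub_distrib]
    -- Two small triangles fill the quadrilateral between consecutive points of the two segments.
    -- The resulting sum telescopes: the segments agree at k = 0 and end at x and y for k = n.
    have : ∀ k ∈ Finset.range n, d (p y k) (p y (k + 1)) - d (p x k) (p x (k + 1))
        = d (p x (k + 1)) (p y (k + 1)) - d (p x k) (p y k) := by
      intro k hk
      have hk' := Finset.mem_range.1 hk
      have h1 := hstep x k hk'
      have h2 := hstep y k hk'
      have h3 := hpp x y k hk'.le
      have h4 := hpp x y (k + 1) hk'
      have h5 := dist_triangle (p x k) (p y k) (p y (k + 1))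
      have e1 := key (p x k) (p y k) (p y (k + 1)) (by linarith) (by linarith) (by linarith)
      have e2 := key (p x k) (p x (k + 1)) (p y (k + 1)) (by linarith) (by linarith) (by linarith)
      linarith
    rw [Finset.sum_congr rfl this, Finset.sum_range_sub (fun k => d (p x k) (p y k)), hpn, hpn, hp0,
      hp0, hdself, sub_zero]
  have h1 : ∀ᶠ y in 𝓝 x, dist x y < δ / 2 := by
    filter_upwards [Metric.ball_mem_nhds x (half_pos hδ)] with y hy
    rwa [dist_comm]
  filter_upwards [h1, hfε (c x) x (hc x (Metric.mem_ball_self hδ))] with y hy1 hy2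
  rw [hloc y hy1, ← hy2]

theorem gluesLocalFunctions_unitInterval : GluesLocalFunctions I :=
  (convex_Icc (0 : ℝ) 1).gluesLocalFunctions isCompact_Icc

theorem gluesLocalFunctions_square : GluesLocalFunctions (I × I) :=
  (((convex_Icc (0 : ℝ) 1).prod (convex_Icc (0 : ℝ) 1)).gluesLocalFunctions
    (isCompact_Icc.prod isCompact_Icc)).of_homeomorph (Homeomorph.Set.prod _ _)

end

noncomputable section

/-! ### Local primitives and path integrals -/

section Primitives

variable {S : Type u} [TopologicalSpace S] [ChartedSpace Plane S]

theorem locallyPathConnectedSpace_of_surface : LocallyPathConnectedSpace S :=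
  ChartedSpace.locallyPathConnectedSpace Plane S

/-- Around a point, there are arbitrarily small chart balls. -/
theorem exists_chart_ball {p : S} {W : Set S} (hW : W ∈ 𝓝 p) :
    ∃ r > 0, Metric.ball (chartAt Plane p p) r ⊆ (chartAt Plane p).target ∧
      ∀ y ∈ Metric.ball (chartAt Plane p p) r, (chartAt Plane p).symm y ∈ W := by
  have h1 : (chartAt Plane p).target ∈ 𝓝 (chartAt Plane p p) :=
    (chartAt Plane p).open_target.mem_nhds (mem_chart_target _ p)
  have h2 : (chartAt Plane p).symm ⁻¹' W ∈ 𝓝 (chartAt Plane p p) := by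
    apply ((chartAt Plane p).continuousAt_symm (mem_chart_target _ p)).preimage_mem_nhds
    rwa [(chartAt Plane p).left_inv (mem_chart_source _ p)]
  obtain ⟨r, hr, h⟩ := Metric.mem_nhds_iff.1 (Filter.inter_mem h1 h2)
  exact ⟨r, hr, fun y hy => (h hy).1, fun y hy => (h hy).2⟩

/-- A property of the points of a chart ball holds near the center. -/
theorem eventually_of_chart_ball {p : S} {r : ℝ} (hr : 0 < r) {P : S → Prop}
    (h : ∀ y ∈ Metric.ball (chartAt Plane p p) r, P ((chartAt Plane p).symm y)) :
    ∀ᶠ z in 𝓝 p, P z := by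
  have h1 : (chartAt Plane p) ⁻¹' Metric.ball (chartAt Plane p p) r ∈ 𝓝 p :=
    ((chartAt Plane p).continuousAt (mem_chart_source _ p)).preimage_mem_nhds
      (Metric.ball_mem_nhds _ hr)
  filter_upwards [h1, (chartAt Plane p).open_source.mem_nhds (mem_chart_source _ p)] with z hz hz'
  rw [← (chartAt Plane p).left_inv hz']
  exact h _ hz

/-- Nearby points are joined by small paths. -/
theorem exists_small_path {p : S} {W : Set S} (hW : W ∈ 𝓝 p) :
    ∀ᶠ z in 𝓝 p, ∃ τ : Path p z, ∀ s, τ s ∈ W := by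
  have := locallyPathConnectedSpace_of_surface (S := S)
  obtain ⟨U, ⟨hU, hUc⟩, hUW⟩ := (path_connected_basis p).mem_iff.1 hW
  filter_upwards [hU] with z hz
  obtain ⟨τ, hτ⟩ := hUc.joinedIn p (mem_of_mem_nhds hU) z hz
  exact ⟨τ, fun s => hUW (hτ s)⟩

variable {η β : OneForm S} {g k : S → ℝ} {p : S}

theorem IsPrimitiveNear.eventually (h : IsPrimitiveNear η g p) :
    ∀ᶠ y in 𝓝 p, IsPrimitiveNear η g y :=
  eventually_eventually_nhds.2 h

theorem IsPrimitiveNear.continuousAt (h : IsPrimitiveNear η g p) : ContinuousAt g p :=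
  h.self_of_nhds.1.continuousAt

theorem IsPrimitiveNear.add (hg : IsPrimitiveNear η g p) (hk : IsPrimitiveNear β k p) :
    IsPrimitiveNear (η + β) (fun z => g z + k z) p := by
  filter_upwards [hg, hk] with y h1 h2
  refine ⟨h1.1.add h2.1, fun v => ?_⟩
  have e := mfderiv_add (h1.1.mdifferentiableAt (by norm_num)) (h2.1.mdifferentiableAt (by norm_num))
  have := DFunLike.congr_fun e v
  refine this.trans ?_
  exact congrArg₂ (fun a b : ℝ => a + b) (h1.2 v) (h2.2 v)

theorem IsPrimitiveNear.const_smul (hg : IsPrimitiveNear η g p) (c : ℝ) :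
    IsPrimitiveNear (c • η) (fun z => c * g z) p := by
  filter_upwards [hg] with y h1
  refine ⟨contMDiffAt_const.mul h1.1, fun v => ?_⟩
  have e := const_smul_mfderiv (h1.1.mdifferentiableAt (by norm_num)) c
  have := DFunLike.congr_fun e v
  refine this.trans ?_
  exact congrArg (fun a : ℝ => c * a) (h1.2 v)

theorem IsPrimitiveNear.add_const (hg : IsPrimitiveNear η g p) (c : ℝ) :
    IsPrimitiveNear η (fun z => g z + c) p := by
  filter_upwards [hg] with y h1
  refine ⟨h1.1.add contMDiffAt_const, fun v => ?_⟩
  have e := mfderiv_add (h1.1.mdifferentiableAt (by norm_num))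
    (show MDifferentiableAt (𝓡 2) 𝓘(ℝ, ℝ) (fun _ : S => c) y from mdifferentiableAt_const)
  have := DFunLike.congr_fun e v
  refine this.trans ?_
  rw [mfderiv_const]
  exact (add_zero _).trans (h1.2 v)

theorem IsPrimitiveNear.congr (hg : IsPrimitiveNear η g p) (h : k =ᶠ[𝓝 p] g) :
    IsPrimitiveNear η k p := by
  filter_upwards [hg, eventually_eventually_nhds.2 h] with y h1 h2
  refine ⟨h1.1.congr_of_eventuallyEq h2, fun v => ?_⟩
  rw [Filter.EventuallyEq.mfderiv_eq h2]
  exact h1.2 v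

theorem IsClosedForm.add (hη : IsClosedForm η) (hβ : IsClosedForm β) : IsClosedForm (η + β) :=
  fun p => by
    obtain ⟨g, hg⟩ := hη p
    obtain ⟨k, hk⟩ := hβ p
    exact ⟨_, hg.add hk⟩

theorem IsClosedForm.const_smul (hη : IsClosedForm η) (c : ℝ) : IsClosedForm (c • η) :=
  fun p => by
    obtain ⟨g, hg⟩ := hη p
    exact ⟨_, hg.const_smul c⟩

theorem isPrimitiveNear_zero (c : ℝ) : IsPrimitiveNear (0 : OneForm S) (fun _ => c) p :=
  Filter.Eventually.of_forall fun y => ⟨contMDiffAt_const, fun v => by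
    rw [mfderiv_const]
    rfl⟩

variable (S) in
/-- The space of closed one-forms. -/
def closedForms : Submodule ℝ (OneForm S) where
  carrier := {η | IsClosedForm η}
  add_mem' h h' := h.add h'
  zero_mem' _ := ⟨fun _ => 0, isPrimitiveNear_zero 0⟩
  smul_mem' c _ h := h.const_smul c

/-- `F` is a primitive of `η` along the map `Φ`. -/
def IsPrimitiveAlongMap {X : Type*} [TopologicalSpace X] (η : OneForm S) (Φ : X → S)
    (F : X → ℝ) : Prop :=
  ∀ t, ∃ g : S → ℝ, IsPrimitiveNear η g (Φ t) ∧ ∀ᶠ s in 𝓝 t, F s - F t = g (Φ s) - g (Φ t)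

variable {X Y : Type*} [TopologicalSpace X] [TopologicalSpace Y]

theorem IsPrimitiveAlongMap.comp {Φ : X → S} {F : X → ℝ} (h : IsPrimitiveAlongMap η Φ F)
    {τ : Y → X} (hτ : Continuous τ) : IsPrimitiveAlongMap η (Φ ∘ τ) (F ∘ τ) := by
  intro t
  obtain ⟨g, hg, hF⟩ := h (τ t)
  exact ⟨g, hg, hτ.continuousAt.eventually hF⟩

variable [IsManifold (𝓡 2) ∞ S]

theorem mdifferentiableAt_chart_symm {p : S} {y : Plane} (hy : y ∈ (chartAt Plane p).target) :
    MDifferentiableAt (𝓡 2) (𝓡 2) (chartAt Plane p).symm y :=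
  ((show ContMDiffOn (𝓡 2) (𝓡 2) ∞ (chartAt Plane p).symm _ from contMDiffOn_chart_symm).contMDiffAt
    ((chartAt Plane p).open_target.mem_nhds hy)).mdifferentiableAt (by simp)

theorem mdifferentiableAt_chart {p z : S} (hz : z ∈ (chartAt Plane p).source) :
    MDifferentiableAt (𝓡 2) (𝓡 2) (chartAt Plane p) z :=
  ((show ContMDiffOn (𝓡 2) (𝓡 2) ∞ (chartAt Plane p) _ from contMDiffOn_chart).contMDiffAt
    ((chartAt Plane p).open_source.mem_nhds hz)).mdifferentiableAt (by simp)

/-- The differential of a function on the surface, as a linear form on the model space. -/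
def differentialAt (g : S → ℝ) (x : S) : Plane →L[ℝ] ℝ := mfderiv (𝓡 2) 𝓘(ℝ, ℝ) g x

/-- The differential of the inverse of a chart, as an endomorphism of the model space. -/
def chartDeriv (p : S) (y : Plane) : Plane →L[ℝ] Plane :=
  mfderiv (𝓡 2) (𝓡 2) (chartAt Plane p).symm y

/-- The differential of a function read in a chart. -/
theorem hasFDerivAt_comp_chart_symm {p : S} {y : Plane} (hy : y ∈ (chartAt Plane p).target)
    (hg : MDifferentiableAt (𝓡 2) 𝓘(ℝ, ℝ) g ((chartAt Plane p).symm y)) :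
    HasFDerivAt (fun y => g ((chartAt Plane p).symm y))
      ((differentialAt g ((chartAt Plane p).symm y)).comp (chartDeriv p y)) y :=
  (hg.hasMFDerivAt.comp y (mdifferentiableAt_chart_symm hy).hasMFDerivAt).hasFDerivAt

/-- A function with zero differential near a point is locally constant there. -/
theorem eventually_eq_of_mfderiv_eq_zero
    (h : ∀ᶠ y in 𝓝 p, MDifferentiableAt (𝓡 2) 𝓘(ℝ, ℝ) g y ∧ mfderiv (𝓡 2) 𝓘(ℝ, ℝ) g y = 0) :
    ∀ᶠ y in 𝓝 p, g y = g p := by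
  obtain ⟨r, hr, ht, hW⟩ := exists_chart_ball h
  refine eventually_of_chart_ball hr fun y hy => ?_
  have h0 : ∀ w ∈ Metric.ball (chartAt Plane p p) r,
      HasFDerivAt (fun y => g ((chartAt Plane p).symm y)) (0 : Plane →L[ℝ] ℝ) w := by
    intro w hw
    have := hasFDerivAt_comp_chart_symm (ht hw) (hW w hw).1
    rwa [show differentialAt g ((chartAt Plane p).symm w) = 0 from (hW w hw).2,
      ContinuousLinearMap.zero_comp] at this
  have := (convex_ball (chartAt Plane p p) r).is_const_of_fderivWithin_eq_zero (𝕜 := ℝ)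
    (f := fun y => g ((chartAt Plane p).symm y))
    (fun w hw => (h0 w hw).differentiableAt.differentiableWithinAt)
    (fun w hw => ((h0 w hw).hasFDerivWithinAt).fderivWithin
      (Metric.isOpen_ball.uniqueDiffWithinAt hw)) hy (Metric.mem_ball_self hr)
  simpa [(chartAt Plane p).left_inv (mem_chart_source _ p)] using this

/-- Two local primitives differ by a local constant. -/
theorem IsPrimitiveNear.sub_eq_sub (hg : IsPrimitiveNear η g p) (hk : IsPrimitiveNear η k p) :
    ∀ᶠ y in 𝓝 p, g y - g p = k y - k p := by
  have h : ∀ᶠ y in 𝓝 p, g y + (-1) * k y = g p + (-1) * k p := by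
    apply eventually_eq_of_mfderiv_eq_zero (g := fun y => g y + (-1) * k y)
    filter_upwards [hg.add (hk.const_smul (-1))] with y hy
    refine ⟨hy.1.mdifferentiableAt (by norm_num), ContinuousLinearMap.ext fun v => ?_⟩
    refine (hy.2 v).trans ?_
    change η y v + (-1) * η y v = 0
    ring
  filter_upwards [h] with y hy
  linarith

/-- Local primitives of the same form differ by local constants, so the difference of two primitives
along a map is locally constant on a connected space. -/
theorem IsPrimitiveAlongMap.sub_eq_sub [PreconnectedSpace X] {Φ : X → S} (hΦ : Continuous Φ)
    {F F' : X → ℝ} (h : IsPrimitiveAlongMap η Φ F) (h' : IsPrimitiveAlongMap η Φ F') (s t : X) :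
    F s - F t = F' s - F' t := by
  have := isPreconnected_univ.eq_of_eventually_eq (w := fun x => F x - F' x) (by
    intro x _
    rw [nhdsWithin_univ]
    obtain ⟨g, hg, hF⟩ := h x
    obtain ⟨k, hk, hF'⟩ := h' x
    filter_upwards [hF, hF', hΦ.continuousAt.eventually (hg.sub_eq_sub hk)] with y h1 h2 h3
    linarith) (Set.mem_univ t) (Set.mem_univ s)
  linarith

/-- The local primitives of the form, pulled back to the source, are exactly a family of local
functions with locally constant differences. -/
theorem GluesLocalFunctions.exists_primitive (hX : GluesLocalFunctions X) (hη : IsClosedForm η)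
    {Φ : X → S} (hΦ : Continuous Φ) : ∃ F, IsPrimitiveAlongMap η Φ F := by
  choose g hg using hη
  obtain ⟨F, hF⟩ := hX (fun x y => g (Φ x) (Φ y)) (fun x => by
    filter_upwards [hΦ.continuousAt.eventually (hg (Φ x)).eventually] with y hy
    exact hΦ.continuousAt.eventually (hy.sub_eq_sub (hg (Φ y))))
  exact ⟨F, fun x => ⟨g (Φ x), hg _, hF x⟩⟩

/-- Makes the choice in `pathIntegral` harmless: any primitive along the path has the same total
increment. -/
theorem pathIntegral_eq {γ : C(I, S)} {F : I → ℝ} (h : IsPrimitiveAlongMap η γ F) :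
    pathIntegral η γ = F 1 - F 0 := by
  have : IsPrimitiveAlongMap η γ (Classical.epsilon (IsPrimitiveAlong η γ)) :=
    Classical.epsilon_spec (p := IsPrimitiveAlong η γ) ⟨F, h⟩
  exact this.sub_eq_sub γ.continuous h 1 0

/-- On a space that glues local functions, path integrals are increments of one function. -/
theorem GluesLocalFunctions.exists_potential (hX : GluesLocalFunctions X) (hη : IsClosedForm η)
    (Φ : C(X, S)) : ∃ F : X → ℝ, IsPrimitiveAlongMap η Φ F ∧
      ∀ τ : C(I, X), pathIntegral η (Φ.comp τ) = F (τ 1) - F (τ 0) := by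
  obtain ⟨F, hF⟩ := hX.exists_primitive hη Φ.continuous
  exact ⟨F, hF, fun τ =>
    pathIntegral_eq (γ := Φ.comp τ) (F := F ∘ τ) (hF.comp τ.continuous)⟩

theorem exists_primitive_path (hη : IsClosedForm η) (γ : C(I, S)) :
    ∃ F, IsPrimitiveAlongMap η γ F :=
  gluesLocalFunctions_unitInterval.exists_primitive hη γ.continuous

theorem pathIntegral_of_isPrimitiveNear {γ : C(I, S)} (h : ∀ t, IsPrimitiveNear η g (γ t)) :
    pathIntegral η γ = g (γ 1) - g (γ 0) :=
  pathIntegral_eq (F := fun t => g (γ t)) fun t => ⟨g, h t, Filter.Eventually.of_forall fun _ => rfl⟩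

theorem pathIntegral_add (hη : IsClosedForm η) (hβ : IsClosedForm β) (γ : C(I, S)) :
    pathIntegral (η + β) γ = pathIntegral η γ + pathIntegral β γ := by
  obtain ⟨F, hF⟩ := exists_primitive_path hη γ
  obtain ⟨G, hG⟩ := exists_primitive_path hβ γ
  rw [pathIntegral_eq hF, pathIntegral_eq hG, pathIntegral_eq (F := fun t => F t + G t)]
  · ring
  intro t
  obtain ⟨g, hg, h1⟩ := hF t
  obtain ⟨k, hk, h2⟩ := hG t
  refine ⟨_, hg.add hk, ?_⟩
  filter_upwards [h1, h2] with s h1 h2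
  linarith

theorem pathIntegral_const_smul (hη : IsClosedForm η) (c : ℝ) (γ : C(I, S)) :
    pathIntegral (c • η) γ = c * pathIntegral η γ := by
  obtain ⟨F, hF⟩ := exists_primitive_path hη γ
  rw [pathIntegral_eq hF, pathIntegral_eq (F := fun t => c * F t)]
  · ring
  intro t
  obtain ⟨g, hg, h1⟩ := hF t
  refine ⟨_, hg.const_smul c, ?_⟩
  filter_upwards [h1] with s h1
  rw [← mul_sub, ← mul_sub, h1]

/-- One potential along the concatenated path computes all three integrals, the two pieces being its
restrictions t ↦ t/2 and t ↦ (t+1)/2. -/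
theorem pathIntegral_trans (hη : IsClosedForm η) {x y z : S} (γ : Path x y) (γ' : Path y z) :
    pathIntegral η (γ.trans γ') = pathIntegral η γ + pathIntegral η γ' := by
  obtain ⟨F, -, hF⟩ := gluesLocalFunctions_unitInterval.exists_potential hη
    (γ.trans γ').toContinuousMap
  have e0 := hF (ContinuousMap.id I)
  have e1 := hF ⟨fun t => ⟨(t : ℝ) / 2, by constructor <;> linarith [t.2.1, t.2.2]⟩, by fun_prop⟩
  have e2 := hF ⟨fun t => ⟨((t : ℝ) + 1) / 2, by constructor <;> linarith [t.2.1, t.2.2]⟩,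
    by fun_prop⟩
  rw [show (γ.trans γ').toContinuousMap.comp _ = γ.toContinuousMap from by
    ext t
    have h : (t : ℝ) / 2 ≤ 1 / 2 := by linarith [t.2.2]
    simp only [ContinuousMap.comp_apply, ContinuousMap.coe_mk, Path.coe_toContinuousMap,
      Path.trans_apply, h, ↓reduceDIte]
    congr 1
    exact Subtype.ext (by simp [mul_div_cancel₀])] at e1
  rw [show (γ.trans γ').toContinuousMap.comp _ = γ'.toContinuousMap from by
    ext t
    simp only [ContinuousMap.comp_apply, ContinuousMap.coe_mk, Path.coe_toContinuousMap,
      Path.trans_apply]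
    split_ifs with h
    · have h0 : t = 0 := Subtype.ext (by
        have := t.2.1
        change (t : ℝ) = 0
        linarith)
      subst h0
      simp
    · congr 1
      exact Subtype.ext (by simp; ring)] at e2
  rw [ContinuousMap.comp_id] at e0
  change pathIntegral η (γ.trans γ').toContinuousMap = pathIntegral η γ.toContinuousMap +
    pathIntegral η γ'.toContinuousMap
  rw [e0, e1, e2]
  have h1 : (⟨((1 : I) : ℝ) / 2, by constructor <;> norm_num⟩ : I) =
    ⟨(((0 : I) : ℝ) + 1) / 2, by constructor <;> norm_num⟩ := Subtype.ext (by norm_num)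
  have h2 : (⟨((0 : I) : ℝ) / 2, by constructor <;> norm_num⟩ : I) = 0 := Subtype.ext (by norm_num)
  have h3 : (⟨(((1 : I) : ℝ) + 1) / 2, by constructor <;> norm_num⟩ : I) = 1 :=
    Subtype.ext (by norm_num)
  simp only [ContinuousMap.coe_mk, ContinuousMap.id_apply, h1, h2, h3]
  ring

theorem pathIntegral_symm (hη : IsClosedForm η) {x y : S} (γ : Path x y) :
    pathIntegral η γ.symm = - pathIntegral η γ := by
  obtain ⟨F, -, hF⟩ := gluesLocalFunctions_unitInterval.exists_potential hη γ.toContinuousMap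
  have e0 := hF (ContinuousMap.id I)
  have e1 := hF ⟨unitInterval.symm, unitInterval.continuous_symm⟩
  rw [ContinuousMap.comp_id] at e0
  change pathIntegral η (γ.toContinuousMap.comp
    ⟨unitInterval.symm, unitInterval.continuous_symm⟩) = - pathIntegral η γ.toContinuousMap
  rw [e1, e0]
  simp

/-- A closed form with vanishing integrals over loops is exact. -/
theorem exists_primitive_of_loops [ConnectedSpace S] (hη : IsClosedForm η)
    (h : ∀ x : S, ∀ γ : Path x x, pathIntegral η γ = 0) :
    ∃ G : S → ℝ, ∀ p, IsPrimitiveNear η G p := by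
  have := locallyPathConnectedSpace_of_surface (S := S)
  have : PathConnectedSpace S := pathConnectedSpace_iff_connectedSpace.2 inferInstance
  obtain ⟨x₀⟩ := (inferInstance : Nonempty S)
  let P : ∀ x : S, Path x₀ x := fun x => PathConnectedSpace.somePath x₀ x
  refine ⟨fun x => pathIntegral η (P x), fun p => ?_⟩
  obtain ⟨g, hg⟩ := hη p
  refine (hg.add_const (pathIntegral η (P p) - g p)).congr ?_
  filter_upwards [exists_small_path hg.eventually] with z hz
  obtain ⟨τ, hτ⟩ := hz
  -- The loop that goes to `p`, then along a short path to `z`, then back along the path chosen for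
  -- `z`; its zero integral compares the two chosen paths.
  have e1 := h _ (((P p).trans τ).trans (P z).symm)
  rw [pathIntegral_trans hη, pathIntegral_trans hη, pathIntegral_symm hη] at e1
  have e2 := pathIntegral_of_isPrimitiveNear (γ := τ.toContinuousMap) hτ
  change pathIntegral η τ = g (τ 1) - g (τ 0) at e2
  rw [τ.source, τ.target] at e2
  linarith

/-- The integral of a closed form along the curves of a continuous family depends continuously on
the curve. -/
theorem continuous_pathIntegral (hη : IsClosedForm η) {Z : Type*} [TopologicalSpace Z]
    [ChartedSpace Plane Z] (H : C(I × Z, S)) (γ : Z → C(I, S)) (hγ : ∀ z t, γ z t = H (t, z)) :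
    Continuous fun z => pathIntegral η (γ z) := by
  rw [continuous_iff_continuousAt]
  intro z₀
  obtain ⟨g₀, hg₀⟩ := hη (H (0, z₀))
  obtain ⟨g₁, hg₁⟩ := hη (H (1, z₀))
  have c₀ : Continuous fun z => H (0, z) := by fun_prop
  have c₁ : Continuous fun z => H (1, z) := by fun_prop
  -- A short path from z₀ to z sweeps a square bounded by the two curves and by two short sides. A
  -- potential on the square reduces the difference of the integrals to the short sides, where fixed
  -- local primitives are available.
  have key : ∀ᶠ z in 𝓝 z₀, pathIntegral η (γ z) = pathIntegral η (γ z₀) +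
      (g₁ (H (1, z)) - g₁ (H (1, z₀))) - (g₀ (H (0, z)) - g₀ (H (0, z₀))) := by
    filter_upwards [exists_small_path ((c₀.continuousAt.eventually hg₀.eventually).and
      (c₁.continuousAt.eventually hg₁.eventually))] with z hz
    obtain ⟨τ, hτ⟩ := hz
    obtain ⟨F, -, hF⟩ := gluesLocalFunctions_square.exists_potential hη
      (⟨fun x => H (x.1, τ x.2), by fun_prop⟩ : C(I × I, S))
    have e1 := hF ⟨fun t => (t, 0), by fun_prop⟩
    have e2 := hF ⟨fun t => (t, 1), by fun_prop⟩
    have e3 := hF ⟨fun t => (0, t), by fun_prop⟩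
    have e4 := hF ⟨fun t => (1, t), by fun_prop⟩
    rw [pathIntegral_of_isPrimitiveNear (g := g₀) (fun t => (hτ t).1)] at e3
    rw [pathIntegral_of_isPrimitiveNear (g := g₁) (fun t => (hτ t).2)] at e4
    rw [show ContinuousMap.comp _ _ = γ z₀ from by ext t; simp [hγ]] at e1
    rw [show ContinuousMap.comp _ _ = γ z from by ext t; simp [hγ]] at e2
    simp only [ContinuousMap.comp_apply, ContinuousMap.coe_mk, τ.source, τ.target] at e1 e2 e3 e4
    linarith
  refine ContinuousAt.congr ?_ (key.mono fun z hz => hz.symm)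
  have d₀ : ContinuousAt (fun z => g₀ (H (0, z))) z₀ :=
    ContinuousAt.comp (f := fun z => H (0, z)) hg₀.continuousAt c₀.continuousAt
  have d₁ : ContinuousAt (fun z => g₁ (H (1, z))) z₀ :=
    ContinuousAt.comp (f := fun z => H (1, z)) hg₁.continuousAt c₁.continuousAt
  exact ((continuousAt_const.add (d₁.sub continuousAt_const)).sub (d₀.sub continuousAt_const))

end Primitives

end

noncomputable section

/-! ### Singular cocycles of degree one given by functions on paths -/

section Cocycles

open scoped Simplicial

variable {S : Type u} [TopologicalSpace S]

/-- The singular simplicial set of a space. -/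
abbrev singularSet (S : Type u) [TopologicalSpace S] : SSet.{u} := TopCat.toSSet.obj (TopCat.of S)

/-- The `i`-th edge of the standard triangle, opposite to the vertex `i`. -/
def triangleEdge (i : Fin 3) : C(I, stdSimplex ℝ (Fin 3)) :=
  (⟨stdSimplex.map (SimplexCategory.δ i : SimplexCategory.mk 1 ⟶ SimplexCategory.mk 2),
    stdSimplex.continuous_map _⟩ : C(stdSimplex ℝ (Fin 2), stdSimplex ℝ (Fin 3))).comp
    (stdSimplexHomeomorphUnitInterval.symm : C(I, stdSimplex ℝ (Fin 2)))

theorem stdSimplexHomeomorphUnitInterval_symm_zero :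
    stdSimplexHomeomorphUnitInterval.symm 0 = stdSimplex.vertex 0 :=
  stdSimplexHomeomorphUnitInterval.symm_apply_eq.2 rfl

theorem stdSimplexHomeomorphUnitInterval_symm_one :
    stdSimplexHomeomorphUnitInterval.symm 1 = stdSimplex.vertex 1 :=
  stdSimplexHomeomorphUnitInterval.symm_apply_eq.2 rfl

theorem simplexPath_face (x : (singularSet S) _⦋2⦌) (i : Fin 3) :
    simplexPath ((singularSet S).δ i x) =
      (TopCat.toSSetObjEquiv (TopCat.of S) _ x).comp (triangleEdge i) := rfl

theorem simplexPath_surjective (γ : C(I, S)) :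
    ∃ c : (singularSet S) _⦋1⦌, simplexPath c = γ := by
  refine ⟨(TopCat.toSSetObjEquiv (TopCat.of S) _).symm
    (γ.comp (stdSimplexHomeomorphUnitInterval : C(stdSimplex ℝ (Fin 2), I))), ?_⟩
  ext t
  simp only [simplexPath, Equiv.apply_symm_apply]
  exact congrArg γ (stdSimplexHomeomorphUnitInterval.apply_symm_apply t)

theorem simplexPath_map (f : C(S, S)) (c : (singularSet S) _⦋1⦌) :
    simplexPath ((TopCat.toSSet.map (TopCat.ofHom f)).app _ c) = f.comp (simplexPath c) := rfl

/-- The generator of the singular chains given by a simplex. -/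
def simplexChain {n : ℕ} (c : (singularSet S) _⦋n⦌) : (singularChains S).X n :=
  ((singularSet S).ιChainComplex (R := realCoeff.{u}) c).hom (ULift.up 1)

/-- The chains are a coproduct of copies of the coefficient module indexed by the simplices, and
each copy is spanned by the image of 1. -/
theorem chain_ext {n : ℕ} {M : Type u} [AddCommGroup M] [Module ℝ M]
    {f g : (singularChains S).X n →ₗ[ℝ] M}
    (h : ∀ c : (singularSet S) _⦋n⦌, f (simplexChain c) = g (simplexChain c)) : f = g := by
  have : (ModuleCat.ofHom f : (singularChains S).X n ⟶ ModuleCat.of ℝ M) = ModuleCat.ofHom g := by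
    refine SSet.chainComplex_hom_ext (X := singularSet S) (R := realCoeff.{u}) fun c => ?_
    refine ModuleCat.hom_ext (LinearMap.ext fun a => ?_)
    obtain ⟨a⟩ := a
    have ha : (ULift.up a : ULift.{u} ℝ) = a • ULift.up 1 := by
      exact congrArg ULift.up (mul_one a).symm
    change f (((singularSet S).ιChainComplex (R := realCoeff.{u}) c).hom (ULift.up a)) =
      g (((singularSet S).ιChainComplex (R := realCoeff.{u}) c).hom (ULift.up a))
    rw [ha, LinearMap.map_smul]
    exact (f.map_smul a (simplexChain c)).trans
      ((congrArg (a • ·) (h c)).trans (g.map_smul a (simplexChain c)).symm)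
  exact congrArg ModuleCat.Hom.hom this

theorem chainEval_simplexChain (φ : C(I, S) → ℝ) (c : (singularSet S) _⦋1⦌) :
    chainEval φ (simplexChain c) = ULift.up (φ (simplexPath c)) := by
  have := congrArg (fun h => h.hom (ULift.up 1))
    (((singularSet S).isColimitChainComplexXCofan realCoeff.{u} 1).fac
      (Limits.Cofan.mk realCoeff.{u} fun c =>
        ModuleCat.ofHom (φ (simplexPath c) • LinearMap.id)) ⟨c⟩)
  refine Eq.trans this ?_
  change φ (simplexPath c) • (ULift.up (1 : ℝ)) = _
  exact congrArg ULift.up (mul_one _)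

theorem d_simplexChain {n : ℕ} (x : (singularSet S) _⦋n + 1⦌) :
    ((singularChains S).d (n + 1) n).hom (simplexChain x) =
      ∑ i : Fin (n + 2), (-1 : ℤ) ^ i.val • simplexChain ((singularSet S).δ i x) := by
  have := congrArg (fun h => h.hom (ULift.up 1)) ((singularSet S).ιChainComplex_d realCoeff.{u} x)
  refine Eq.trans this ?_
  simp only [ModuleCat.hom_sum, LinearMap.sum_apply, ModuleCat.hom_zsmul, LinearMap.smul_apply]
  rfl

/-- The map induced on singular chains. -/
def chainMap (f : C(S, S)) : singularChains S ⟶ singularChains S :=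
  ((AlgebraicTopology.singularChainComplexFunctor (ModuleCat.{u} ℝ)).obj
      realCoeff.{u}).map (TopCat.ofHom f)

theorem chainMap_simplexChain (f : C(S, S)) {n : ℕ} (c : (singularSet S) _⦋n⦌) :
    ((chainMap f).f n).hom (simplexChain c) =
      simplexChain ((TopCat.toSSet.map (TopCat.ofHom f)).app _ c) :=
  congrArg (fun h => h.hom (ULift.up 1))
    (SSet.ι_chainComplexMap_f (singularSet S) (singularSet S)
      (TopCat.toSSet.map (TopCat.ofHom f)) realCoeff.{u} c)

/-- A function on paths that vanishes on the boundaries of triangles. -/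
def IsPathCocycle (φ : C(I, S) → ℝ) : Prop :=
  ∀ x : C(stdSimplex ℝ (Fin 3), S),
    φ (x.comp (triangleEdge 0)) - φ (x.comp (triangleEdge 1)) + φ (x.comp (triangleEdge 2)) = 0

theorem IsPathCocycle.chainEval_d {φ : C(I, S) → ℝ} (h : IsPathCocycle φ)
    (w : (singularChains S).X 2) : chainEval φ (((singularChains S).d 2 1).hom w) = 0 := by
  have : (chainEval φ).comp ((singularChains S).d 2 1).hom = 0 := by
    refine chain_ext fun x => ?_
    rw [LinearMap.comp_apply, d_simplexChain, map_sum, Fin.sum_univ_three]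
    simp only [map_zsmul, chainEval_simplexChain, simplexPath_face]
    apply ULift.down_injective
    have := h (TopCat.toSSetObjEquiv (TopCat.of S) _ x)
    simp only [LinearMap.zero_apply, ULift.zero_down, ULift.add_down, ULift.smul_down]
    rw [← this]
    simp
    ring
  exact LinearMap.congr_fun this w

/-- The evaluation of chains, as a morphism of modules. -/
def chainEvalHom (φ : C(I, S) → ℝ) : (singularChains S).X 1 ⟶ realCoeff.{u} :=
  ModuleCat.ofHom (chainEval φ)

theorem IsPathCocycle.d_chainEvalHom {φ : C(I, S) → ℝ} (h : IsPathCocycle φ) :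
    (singularChains S).d 2 1 ≫ chainEvalHom φ = 0 :=
  ModuleCat.hom_ext (LinearMap.ext h.chainEval_d)

/-- The linear form on `H₁(S, ℝ)` given by a path cocycle. -/
def IsPathCocycle.eval {φ : C(I, S) → ℝ} (h : IsPathCocycle φ) : H1 S →ₗ[ℝ] ℝ :=
  ULift.moduleEquiv.toLinearMap.comp
    ((singularChains S).homologyι 1 ≫ (singularChains S).descOpcycles
      (chainEvalHom φ) 2 (by simp) h.d_chainEvalHom).hom

theorem IsPathCocycle.eval_apply {φ : C(I, S) → ℝ} (h : IsPathCocycle φ)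
    (z : (singularChains S).cycles 1) :
    h.eval (((singularChains S).homologyπ 1).hom z) =
      (chainEval φ (((singularChains S).iCycles 1).hom z)).down := by
  have : (singularChains S).homologyπ 1 ≫ (singularChains S).homologyι 1 ≫
      (singularChains S).descOpcycles
      (chainEvalHom φ) 2 (by simp) h.d_chainEvalHom = (singularChains S).iCycles 1 ≫
      chainEvalHom φ := by
    rw [← Category.assoc, HomologicalComplex.homology_π_ι, Category.assoc,
      HomologicalComplex.p_descOpcycles]
  exact congrArg (fun h => (h.hom z).down) this

/-- Removes the dependence on the chosen representative cycle and turns the evaluation into a linear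
form on homology. -/
theorem IsPathCocycle.eval_eq {φ : C(I, S) → ℝ} (h : IsPathCocycle φ) (ρ : H1 S) :
    (chainEval φ (representative ρ)).down = h.eval ρ := by
  conv_rhs => rw [← Classical.choose_spec (exists_cycle ρ)]
  rw [h.eval_apply]
  rfl

theorem chainEval_add (φ ψ : C(I, S) → ℝ) :
    chainEval (fun γ => φ γ + ψ γ) = chainEval φ + chainEval ψ := by
  refine chain_ext fun c => ?_
  rw [LinearMap.add_apply, chainEval_simplexChain, chainEval_simplexChain, chainEval_simplexChain]
  rfl

theorem chainEval_const_mul (a : ℝ) (φ : C(I, S) → ℝ) :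
    chainEval (fun γ => a * φ γ) = a • chainEval φ := by
  refine chain_ext fun c => ?_
  rw [LinearMap.smul_apply, chainEval_simplexChain, chainEval_simplexChain]
  rfl

/-- The linear extension to singular `0`-chains of a function on points. -/
def pointEval (w : S → ℝ) : (singularChains S).X 0 →ₗ[ℝ] ULift.{u} ℝ :=
  ((SSet.isColimitChainComplexXCofan (singularSet S) realCoeff.{u} 0).desc
    (Limits.Cofan.mk realCoeff.{u} fun c =>
      ModuleCat.ofHom (w (TopCat.toSSetObjEquiv (TopCat.of S) _ c (stdSimplex.vertex (0 : Fin 1))) •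
        LinearMap.id))).hom

theorem pointEval_simplexChain (w : S → ℝ) (c : (singularSet S) _⦋0⦌) :
    pointEval w (simplexChain c) =
      ULift.up (w (TopCat.toSSetObjEquiv (TopCat.of S) _ c (stdSimplex.vertex (0 : Fin 1)))) := by
  have := congrArg (fun h => h.hom (ULift.up 1))
    (((singularSet S).isColimitChainComplexXCofan realCoeff.{u} 0).fac
      (Limits.Cofan.mk realCoeff.{u} fun c =>
      ModuleCat.ofHom (w (TopCat.toSSetObjEquiv (TopCat.of S) _ c (stdSimplex.vertex (0 : Fin 1))) •
        LinearMap.id)) ⟨c⟩)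
  refine Eq.trans this ?_
  change w _ • (ULift.up (1 : ℝ)) = _
  exact congrArg ULift.up (mul_one _)

theorem vertex_face_zero (c : (singularSet S) _⦋1⦌) :
    TopCat.toSSetObjEquiv (TopCat.of S) _ ((singularSet S).δ 0 c) (stdSimplex.vertex (0 : Fin 1)) =
      simplexPath c 1 := by
  change TopCat.toSSetObjEquiv (TopCat.of S) _ c (stdSimplex.map _ (stdSimplex.vertex (0 : Fin 1)))
    = TopCat.toSSetObjEquiv (TopCat.of S) _ c (stdSimplexHomeomorphUnitInterval.symm 1)
  rw [stdSimplexHomeomorphUnitInterval_symm_one, stdSimplex.map_vertex]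
  rfl

theorem vertex_face_one (c : (singularSet S) _⦋1⦌) :
    TopCat.toSSetObjEquiv (TopCat.of S) _ ((singularSet S).δ 1 c) (stdSimplex.vertex (0 : Fin 1)) =
      simplexPath c 0 := by
  change TopCat.toSSetObjEquiv (TopCat.of S) _ c (stdSimplex.map _ (stdSimplex.vertex (0 : Fin 1)))
    = TopCat.toSSetObjEquiv (TopCat.of S) _ c (stdSimplexHomeomorphUnitInterval.symm 0)
  rw [stdSimplexHomeomorphUnitInterval_symm_zero, stdSimplex.map_vertex]
  rfl

/-- Increments of a function on points are the coboundary of that function, hence invisible on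
cycles. -/
theorem chainEval_increment (w : S → ℝ) :
    chainEval (fun γ : C(I, S) => w (γ 1) - w (γ 0)) =
      (pointEval w).comp ((singularChains S).d 1 0).hom := by
  refine chain_ext fun c => ?_
  rw [LinearMap.comp_apply, d_simplexChain, map_sum, Fin.sum_univ_two, chainEval_simplexChain]
  simp only [map_zsmul, pointEval_simplexChain]
  apply ULift.down_injective
  have h0 := vertex_face_zero c
  have h1 := vertex_face_one c
  rw [← h0, ← h1]
  simp [sub_eq_add_neg]

theorem chainEval_increment_cycle (w : S → ℝ) (z : (singularChains S).cycles 1) :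
    chainEval (fun γ : C(I, S) => w (γ 1) - w (γ 0)) (((singularChains S).iCycles 1).hom z) = 0 := by
  rw [chainEval_increment, LinearMap.comp_apply]
  have : ((singularChains S).d 1 0).hom (((singularChains S).iCycles 1).hom z) = 0 :=
    congrArg (fun h => h.hom z) ((singularChains S).iCycles_d 1 0)
  rw [this, map_zero]

theorem chainEval_map (f : C(S, S)) (φ : C(I, S) → ℝ) :
    (chainEval φ).comp ((chainMap f).f 1).hom = chainEval (fun γ => φ (f.comp γ)) := by
  refine chain_ext fun c => ?_
  rw [LinearMap.comp_apply, chainMap_simplexChain, chainEval_simplexChain, chainEval_simplexChain,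
    simplexPath_map]

theorem IsPathCocycle.comp {φ : C(I, S) → ℝ} (h : IsPathCocycle φ) (f : C(S, S)) :
    IsPathCocycle fun γ => φ (f.comp γ) := fun x => h (f.comp x)

/-- Naturality of the evaluation of cocycles on homology classes. -/
theorem IsPathCocycle.eval_homologyMap {φ : C(I, S) → ℝ} (h : IsPathCocycle φ) (f : C(S, S))
    (ρ : H1 S) : h.eval (homologyMap f ρ) = (h.comp f).eval ρ := by
  obtain ⟨z, rfl⟩ := exists_cycle ρ
  have e1 : homologyMap f (((singularChains S).homologyπ 1).hom z) =
      ((singularChains S).homologyπ 1).hom ((HomologicalComplex.cyclesMap (chainMap f) 1).hom z) :=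
    congrArg (fun h => h.hom z) (HomologicalComplex.homologyπ_naturality (chainMap f) 1)
  have e2 : ((singularChains S).iCycles 1).hom
      ((HomologicalComplex.cyclesMap (chainMap f) 1).hom z) =
      ((chainMap f).f 1).hom (((singularChains S).iCycles 1).hom z) :=
    congrArg (fun h => h.hom z) (HomologicalComplex.cyclesMap_i (chainMap f) 1)
  rw [e1, h.eval_apply, (h.comp f).eval_apply, e2, ← chainEval_map]
  rfl

/-- Cocycles that differ by the increment of a function on points have the same evaluation. -/
theorem IsPathCocycle.eval_congr {φ ψ : C(I, S) → ℝ} (h : IsPathCocycle φ) (h' : IsPathCocycle ψ)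
    (w : S → ℝ) (hw : ∀ γ, φ γ = ψ γ + (w (γ 1) - w (γ 0))) (ρ : H1 S) : h.eval ρ = h'.eval ρ := by
  obtain ⟨z, rfl⟩ := exists_cycle ρ
  rw [h.eval_apply, h'.eval_apply, show φ = fun γ => ψ γ + (w (γ 1) - w (γ 0)) from funext hw,
    chainEval_add ψ (fun γ : C(I, S) => w (γ 1) - w (γ 0)), LinearMap.add_apply,
    chainEval_increment_cycle, add_zero]

/-- A loop defines a homology class. -/
theorem exists_class_of_loop (γ : C(I, S)) (hγ : γ 0 = γ 1) :
    ∃ ρ : H1 S, ∀ φ : C(I, S) → ℝ, ∀ h : IsPathCocycle φ, h.eval ρ = φ γ := by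
  obtain ⟨c, rfl⟩ := simplexPath_surjective γ
  have hd : ((singularChains S).d 1 0).hom (simplexChain c) = 0 := by
    rw [d_simplexChain, Fin.sum_univ_two]
    have : (singularSet S).δ 0 c = (singularSet S).δ 1 c := by
      apply (TopCat.toSSetObjEquiv (TopCat.of S) _).injective
      ext t
      have ht : t = stdSimplex.vertex (0 : Fin 1) := Subsingleton.elim (α := stdSimplex ℝ (Fin 1)) _ _
      rw [ht]
      exact (vertex_face_zero c).trans (hγ.symm.trans (vertex_face_one c).symm)
    rw [this]
    simp
  let k : realCoeff.{u} ⟶ (singularChains S).X 1 :=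
    (singularSet S).ιChainComplex (R := realCoeff.{u}) c
  have hk : k ≫ (singularChains S).d 1 0 = 0 := by
    refine ModuleCat.hom_ext (LinearMap.ext fun a => ?_)
    obtain ⟨a⟩ := a
    have ha : (ULift.up a : ULift.{u} ℝ) = a • ULift.up 1 := congrArg ULift.up (mul_one a).symm
    rw [ha, LinearMap.map_smul]
    exact (congrArg (a • ·) hd).trans (smul_zero a)
  refine ⟨((singularChains S).homologyπ 1).hom
    (((singularChains S).liftCycles k 0 (by simp) hk).hom (ULift.up 1)), fun φ h => ?_⟩
  have e : ((singularChains S).iCycles 1).hom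
      (((singularChains S).liftCycles k 0 (by simp) hk).hom (ULift.up 1)) = simplexChain c :=
    congrArg (fun h => h.hom (ULift.up 1)) ((singularChains S).liftCycles_i k 0 (by simp) hk)
  rw [h.eval_apply, e, chainEval_simplexChain]

theorem simplexPath_injective : Function.Injective (simplexPath (S := S)) := by
  intro c c' h
  apply (TopCat.toSSetObjEquiv (TopCat.of S) _).injective
  ext t
  have := DFunLike.congr_fun h (stdSimplexHomeomorphUnitInterval t)
  change TopCat.toSSetObjEquiv (TopCat.of S) _ c (stdSimplexHomeomorphUnitInterval.symm _) =
    TopCat.toSSetObjEquiv (TopCat.of S) _ c' (stdSimplexHomeomorphUnitInterval.symm _) at this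
  rwa [Homeomorph.symm_apply_apply] at this

/-- Every linear form on `H₁(S, ℝ)` comes from a path cocycle. -/
theorem exists_pathCocycle (l : H1 S →ₗ[ℝ] ℝ) :
    ∃ φ : C(I, S) → ℝ, ∃ h : IsPathCocycle φ, h.eval = l := by
  have hinj : Function.Injective ((singularChains S).iCycles 1).hom :=
    (ModuleCat.mono_iff_injective _).1 inferInstance
  -- Over a field the inclusion of the cycles in the chains splits, so the form extends from cycles
  -- to all chains; any extension will do.
  obtain ⟨r, hr⟩ := LinearMap.exists_leftInverse_of_injective ((singularChains S).iCycles 1).hom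
    (LinearMap.ker_eq_bot.2 hinj)
  have hr' : ∀ z, r (((singularChains S).iCycles 1).hom z) = z := LinearMap.congr_fun hr
  let L : (singularChains S).X 1 →ₗ[ℝ] ℝ :=
    (l.comp ((singularChains S).homologyπ 1).hom).comp r
  choose c hc using simplexPath_surjective (S := S)
  let φ : C(I, S) → ℝ := fun γ => L (simplexChain (c γ))
  have hφ : ∀ d, φ (simplexPath d) = L (simplexChain d) := fun d => by
    simp only [φ]
    rw [simplexPath_injective (hc (simplexPath d))]
  have hφL : chainEval φ = ULift.moduleEquiv.symm.toLinearMap.comp L := by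
    refine chain_ext fun d => ?_
    rw [chainEval_simplexChain, hφ]
    rfl
  have hLd : ∀ w, L (((singularChains S).d 2 1).hom w) = 0 := by
    intro w
    have e1 : ((singularChains S).d 2 1).hom w =
        ((singularChains S).iCycles 1).hom (((singularChains S).toCycles 2 1).hom w) :=
      congrArg (fun h => h.hom w) ((singularChains S).toCycles_i 2 1).symm
    have e2 : ((singularChains S).homologyπ 1).hom (((singularChains S).toCycles 2 1).hom w) = 0 :=
      congrArg (fun h => h.hom w) ((singularChains S).toCycles_comp_homologyπ 2 1)
    rw [e1]
    simp only [L, LinearMap.comp_apply]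
    rw [hr']
    exact (congrArg l e2).trans (map_zero l)
  have hcoc : IsPathCocycle φ := by
    intro x
    obtain ⟨x, rfl⟩ := (TopCat.toSSetObjEquiv (TopCat.of S) (.op (SimplexCategory.mk 2))).surjective x
    have := hLd (simplexChain x)
    rw [d_simplexChain, map_sum, Fin.sum_univ_three] at this
    simp only [map_zsmul, ← hφ] at this
    change φ (simplexPath ((singularSet S).δ 0 x)) - φ (simplexPath ((singularSet S).δ 1 x)) +
      φ (simplexPath ((singularSet S).δ 2 x)) = 0
    rw [← this]
    simp
    ring
  refine ⟨φ, hcoc, LinearMap.ext fun ρ => ?_⟩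
  obtain ⟨z, rfl⟩ := exists_cycle ρ
  rw [hcoc.eval_apply, hφL]
  change L _ = _
  simp only [L, LinearMap.comp_apply]
  rw [hr']
  rfl

theorem homologyMap_comp (f g : C(S, S)) :
    homologyMap (f.comp g) = (homologyMap f).comp (homologyMap g) := by
  have := (((AlgebraicTopology.singularHomologyFunctor (ModuleCat.{u} ℝ) 1).obj realCoeff.{u}).map_comp
    (TopCat.ofHom g) (TopCat.ofHom f))
  exact congrArg ModuleCat.Hom.hom this

theorem homologyMap_id : homologyMap (ContinuousMap.id S) = LinearMap.id := by
  have := (((AlgebraicTopology.singularHomologyFunctor (ModuleCat.{u} ℝ) 1).obj realCoeff.{u}).map_id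
    (TopCat.of S))
  exact congrArg ModuleCat.Hom.hom this

end Cocycles

end

noncomputable section

/-! ### Potentials of path cocycles on convex sets -/

section CocyclePotential

variable {S : Type u} [TopologicalSpace S]

theorem triangleEdge_apply (i j : Fin 3) (t : I) :
    (triangleEdge i t).1 j =
      (if i.succAbove (0 : Fin 2) = j then 1 - (t : ℝ) else 0) +
        if i.succAbove (1 : Fin 2) = j then (t : ℝ) else 0 := by
  change FunOnFinite.linearMap ℝ ℝ (fun k : Fin 2 => i.succAbove k) ![1 - (t : ℝ), t] j = _
  rw [FunOnFinite.linearMap_apply_apply, Finset.sum_filter, Fin.sum_univ_two]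
  rfl

theorem stdSimplex_coord_add_mem (x : stdSimplex ℝ (Fin 3)) : x.1 1 + x.1 2 ∈ I := by
  have h := x.2.2
  rw [Fin.sum_univ_three] at h
  exact ⟨add_nonneg (x.2.1 1) (x.2.1 2), by linarith [x.2.1 0]⟩

theorem stdSimplex_coord_mem (x : stdSimplex ℝ (Fin 3)) : x.1 2 ∈ I :=
  mem_Icc_of_mem_stdSimplex x.2 2

/-- The triangle below the diagonal of the square. -/
def lowerTriangle : C(stdSimplex ℝ (Fin 3), I × I) where
  toFun x := (⟨x.1 1 + x.1 2, stdSimplex_coord_add_mem x⟩, ⟨x.1 2, stdSimplex_coord_mem x⟩)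
  continuous_toFun := by
    refine Continuous.prodMk (Continuous.subtype_mk ?_ _) (Continuous.subtype_mk ?_ _)
    · exact ((continuous_apply 1).comp continuous_subtype_val).add
        ((continuous_apply 2).comp continuous_subtype_val)
    · exact (continuous_apply 2).comp continuous_subtype_val

/-- The diagonal cuts the square into two triangles, exchanged by the swap of coordinates; the value
on the diagonal cancels between the two cocycle relations. -/
theorem IsPathCocycle.square {φ : C(I, S) → ℝ} (h : IsPathCocycle φ) (Ψ : C(I × I, S)) :
    φ (Ψ.comp ⟨fun t => (t, 0), by fun_prop⟩) + φ (Ψ.comp ⟨fun t => (1, t), by fun_prop⟩) =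
      φ (Ψ.comp ⟨fun t => (0, t), by fun_prop⟩) + φ (Ψ.comp ⟨fun t => (t, 1), by fun_prop⟩) := by
  have hs : ∀ i j : Fin 3, ∀ t : I, (triangleEdge i t).1 j = _ := triangleEdge_apply
  have e0 : lowerTriangle.comp (triangleEdge 0) = ⟨fun t => (1, t), by fun_prop⟩ := by
    ext t
    · simp [lowerTriangle, triangleEdge_apply, Fin.succAbove, Fin.ext_iff]
    · simp [lowerTriangle, triangleEdge_apply, Fin.succAbove, Fin.ext_iff]
  have e1 : lowerTriangle.comp (triangleEdge 1) = ⟨fun t => (t, t), by fun_prop⟩ := by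
    ext t
    · simp [lowerTriangle, triangleEdge_apply, Fin.succAbove, Fin.ext_iff]
    · simp [lowerTriangle, triangleEdge_apply, Fin.succAbove, Fin.ext_iff]
  have e2 : lowerTriangle.comp (triangleEdge 2) = ⟨fun t => (t, 0), by fun_prop⟩ := by
    ext t
    · simp [lowerTriangle, triangleEdge_apply, Fin.succAbove, Fin.ext_iff]
    · simp [lowerTriangle, triangleEdge_apply, Fin.succAbove, Fin.ext_iff]
  have h1 := h (Ψ.comp lowerTriangle)
  have h2 := h ((Ψ.comp ContinuousMap.prodSwap).comp lowerTriangle)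
  simp only [ContinuousMap.comp_assoc, e0, e1, e2] at h1 h2
  have s0 : (ContinuousMap.prodSwap : C(I × I, I × I)).comp ⟨fun t : I => (1, t), by fun_prop⟩ =
    ⟨fun t => (t, 1), by fun_prop⟩ := rfl
  have s1 : (ContinuousMap.prodSwap : C(I × I, I × I)).comp ⟨fun t : I => (t, t), by fun_prop⟩ =
    ⟨fun t => (t, t), by fun_prop⟩ := rfl
  have s2 : (ContinuousMap.prodSwap : C(I × I, I × I)).comp ⟨fun t : I => (t, 0), by fun_prop⟩ =
    ⟨fun t => (0, t), by fun_prop⟩ := rfl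
  rw [s0, s1, s2] at h2
  linarith

/-- The three edges of a constant triangle give φ - φ + φ = 0. -/
theorem IsPathCocycle.const {φ : C(I, S) → ℝ} (h : IsPathCocycle φ) (x : S) :
    φ (ContinuousMap.const I x) = 0 := by
  have := h (ContinuousMap.const _ x)
  simpa using this

/-- On a convex set, a path cocycle is the increment of a function. -/
theorem IsPathCocycle.exists_potential {φ : C(I, S) → ℝ} (h : IsPathCocycle φ) {E : Type*}
    [NormedAddCommGroup E] [NormedSpace ℝ E] {K : Set E} (hK : Convex ℝ K) (Φ : C(K, S)) :
    ∃ F : K → ℝ, ∀ τ : C(I, K), φ (Φ.comp τ) = F (τ 1) - F (τ 0) := by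
  rcases K.eq_empty_or_nonempty with rfl | ⟨x₀, hx₀⟩
  · exact ⟨0, fun τ => (τ 0).2.elim⟩
  have hmem : ∀ (a : K) (t : I), AffineMap.lineMap x₀ (a : E) (t : ℝ) ∈ K :=
    fun a t => hK.lineMap_mem hx₀ a.2 t.2
  let seg : K → C(I, K) := fun a => ⟨fun t => ⟨AffineMap.lineMap x₀ (a : E) (t : ℝ), hmem a t⟩,
    by simp only [AffineMap.lineMap_apply]; fun_prop⟩
  refine ⟨fun a => φ (Φ.comp (seg a)), fun τ => ?_⟩
  -- The cone over `τ` with apex x₀: one side is `τ`, the opposite side is constant, and the other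
  -- two are the segments to the endpoints of `τ`.
  let Ψ : C(I × I, K) := ⟨fun x => ⟨AffineMap.lineMap x₀ (τ x.2 : E) (x.1 : ℝ), hmem _ _⟩,
    by simp only [AffineMap.lineMap_apply]; fun_prop⟩
  have := h.square (Φ.comp Ψ)
  simp only [ContinuousMap.comp_assoc] at this
  have s0 : Ψ.comp ⟨fun t : I => (t, 0), by fun_prop⟩ = seg (τ 0) := rfl
  have s1 : Ψ.comp ⟨fun t : I => (t, 1), by fun_prop⟩ = seg (τ 1) := rfl
  have s2 : Ψ.comp ⟨fun t : I => (1, t), by fun_prop⟩ = τ := by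
    ext t
    simp [Ψ]
  have s3 : Ψ.comp ⟨fun t : I => (0, t), by fun_prop⟩ = ContinuousMap.const I ⟨x₀, hx₀⟩ := by
    ext t
    simp [Ψ]
  rw [s0, s1, s2, s3, ContinuousMap.comp_const, h.const] at this
  linarith

end CocyclePotential

/-! ### Smoothing local functions into closed forms -/

section Smoothing

variable {S : Type u} [TopologicalSpace S] [ChartedSpace Plane S]

theorem two_le_infty : (2 : ℕ∞ω) ≤ ∞ :=
  WithTop.coe_le_coe.2 (le_top : (2 : ℕ∞) ≤ ⊤)

theorem contMDiffAt_mul_of_tsupport {n : ℕ∞ω} {χ g : S → ℝ}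
    (hχ : ContMDiff (𝓡 2) 𝓘(ℝ, ℝ) n χ) {x : S}
    (hg : x ∈ tsupport χ → ContMDiffAt (𝓡 2) 𝓘(ℝ, ℝ) n g x) :
    ContMDiffAt (𝓡 2) 𝓘(ℝ, ℝ) n (fun y => χ y * g y) x := by
  by_cases hx : x ∈ tsupport χ
  · exact hχ.contMDiffAt.mul (hg hx)
  · refine (contMDiffAt_const (c := (0 : ℝ))).congr_of_eventuallyEq ?_
    filter_upwards [(isClosed_tsupport χ).isOpen_compl.mem_nhds hx] with y hy
    rw [image_eq_zero_of_notMem_tsupport hy, zero_mul]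

variable [IsManifold (𝓡 2) ∞ S]

/-- On a compact surface, finite smooth partitions of unity exist. -/
theorem exists_finite_partition [CompactSpace S] [T2Space S] {U : S → Set S}
    (hUo : ∀ p, IsOpen (U p)) (hU : ∀ p, p ∈ U p) :
    ∃ (χ : S → S → ℝ) (t : Finset S), (∀ i, ContMDiff (𝓡 2) 𝓘(ℝ, ℝ) ∞ (χ i)) ∧
      (∀ i, tsupport (χ i) ⊆ U i) ∧ ∀ x, ∑ i ∈ t, χ i x = 1 := by
  obtain ⟨χ, hχ⟩ := SmoothPartitionOfUnity.exists_isSubordinate (𝓡 2) (isClosed_univ (X := S)) U hUo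
    (fun x _ => Set.mem_iUnion.2 ⟨x, hU x⟩)
  have hfin := χ.locallyFinite.finite_nonempty_of_compact
  refine ⟨fun i => χ i, hfin.toFinset, fun i => (χ i).contMDiff, hχ, fun x => ?_⟩
  rw [← χ.sum_eq_one (Set.mem_univ x)]
  refine (finsum_eq_sum_of_support_subset _ fun i hi => ?_).symm
  simp only [Set.Finite.coe_toFinset, Set.mem_ofPred_eq]
  exact ⟨x, hi⟩

/-- Local functions with locally constant differences are, up to one global function, local
primitives of a closed form. -/
theorem exists_smoothing [CompactSpace S] [T2Space S] {U : S → Set S} (hUo : ∀ p, IsOpen (U p))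
    (hU : ∀ p, p ∈ U p) (g : S → S → ℝ)
    (hg : ∀ p q x, x ∈ U p → x ∈ U q → ∀ᶠ y in 𝓝 x, g p y - g p x = g q y - g q x) :
    ∃ (η : OneForm S) (G : S → ℝ), IsClosedForm η ∧
      (∀ p, ∀ x ∈ U p, IsPrimitiveNear η (fun y => g p y - G y) x) ∧
      ∀ n : ℕ∞, (∀ p, ∀ x ∈ U p, ContMDiffAt (𝓡 2) 𝓘(ℝ, ℝ) n (g p) x) →
        ContMDiff (𝓡 2) 𝓘(ℝ, ℝ) n G := by
  obtain ⟨χ, t, hχ, hχU, hχ1⟩ := exists_finite_partition hUo hU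
  let G : S → ℝ := fun y => ∑ i ∈ t, χ i y * g i y
  have hsm : ∀ p, ∀ x ∈ U p, ContMDiffAt (𝓡 2) 𝓘(ℝ, ℝ) 2 (fun y => g p y - G y) x := by
    intro p x hx
    -- The individual `g i` need not even be continuous, but on the support of `χ i` the difference
    -- `g p - g i` is locally constant, so every summand is smooth. This is the Čech argument with a
    -- partition of unity.
    have e : (fun y => g p y - G y) = fun y => ∑ i ∈ t, χ i y * (g p y - g i y) := by
      funext y
      simp only [G, mul_sub, Finset.sum_sub_distrib, ← Finset.sum_mul, hχ1 y, one_mul]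
    rw [e]
    refine contMDiffAt_finsetSum fun i _ => ?_
    refine contMDiffAt_mul_of_tsupport ((hχ i).of_le two_le_infty) fun hxi => ?_
    refine (contMDiffAt_const (c := g p x - g i x)).congr_of_eventuallyEq ?_
    filter_upwards [hg p i x hx (hχU i hxi)] with y hy
    linarith
  let η : OneForm S := fun x => mfderiv (𝓡 2) 𝓘(ℝ, ℝ) (fun y => g x y - G y) x
  have hprim : ∀ p, ∀ x ∈ U p, IsPrimitiveNear η (fun y => g p y - G y) x := by
    intro p x hx
    filter_upwards [(hUo p).mem_nhds hx] with y hy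
    refine ⟨hsm p y hy, fun v => ?_⟩
    have h1 : (fun z => g p z - G z) =ᶠ[𝓝 y] fun z => (g y z - G z) + (g p y - g y y) := by
      filter_upwards [hg p y y hy (hU y)] with z hz
      linarith
    rw [h1.mfderiv_eq]
    have e := mfderiv_add ((hsm y y (hU y)).mdifferentiableAt (by norm_num))
      (show MDifferentiableAt (𝓡 2) 𝓘(ℝ, ℝ) (fun _ : S => g p y - g y y) y
        from mdifferentiableAt_const)
    refine (DFunLike.congr_fun e v).trans ?_
    rw [mfderiv_const]
    exact add_zero _
  refine ⟨η, G, fun p => ⟨_, hprim p p (hU p)⟩, hprim, fun n hn => ?_⟩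
  intro x
  refine contMDiffAt_finsetSum fun i _ => ?_
  exact contMDiffAt_mul_of_tsupport ((hχ i).of_le (by exact_mod_cast le_top))
    fun hxi => hn i x (hχU i hxi)

end Smoothing

end

noncomputable section

/-! ### The pairing of closed forms and homology classes -/

section Pairing

variable {S : Type u} [TopologicalSpace S] [ChartedSpace Plane S]

theorem isOpen_setOf_isPrimitiveNear (η : OneForm S) (g : S → ℝ) :
    IsOpen {x | IsPrimitiveNear η g x} :=
  isOpen_iff_mem_nhds.2 fun _ hx => IsPrimitiveNear.eventually hx

variable [IsManifold (𝓡 2) ∞ S] {η β : OneForm S}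

/-- A closed form has a potential along any map of the triangle, and its increments along the three
edges cancel. -/
theorem isPathCocycle_pathIntegral (hη : IsClosedForm η) : IsPathCocycle (pathIntegral η) := by
  intro x
  obtain ⟨F, -, hF⟩ := ((convex_stdSimplex ℝ (Fin 3)).gluesLocalFunctions
    (isCompact_stdSimplex ℝ (Fin 3))).exists_potential hη x
  have h1 : triangleEdge 0 0 = triangleEdge 2 1 := by
    refine Subtype.ext (funext fun j => ?_)
    rw [triangleEdge_apply, triangleEdge_apply]
    fin_cases j <;> simp [Fin.succAbove, Fin.ext_iff]
  have h2 : triangleEdge 0 1 = triangleEdge 1 1 := by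
    refine Subtype.ext (funext fun j => ?_)
    rw [triangleEdge_apply, triangleEdge_apply]
    fin_cases j <;> simp [Fin.succAbove, Fin.ext_iff]
  have h3 : triangleEdge 1 0 = triangleEdge 2 0 := by
    refine Subtype.ext (funext fun j => ?_)
    rw [triangleEdge_apply, triangleEdge_apply]
    fin_cases j <;> simp [Fin.succAbove, Fin.ext_iff]
  rw [hF, hF, hF, h1, h2, h3]
  ring

theorem formPairing_eq_eval (hη : IsClosedForm η) (ρ : H1 S) :
    formPairing η ρ = (isPathCocycle_pathIntegral hη).eval ρ :=
  (isPathCocycle_pathIntegral hη).eval_eq ρ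

variable (S) in
/-- The pairing of closed forms with homology classes, as a bilinear map. -/
def pairing : closedForms S →ₗ[ℝ] (H1 S →ₗ[ℝ] ℝ) where
  toFun η := (isPathCocycle_pathIntegral η.2).eval
  map_add' η β := by
    ext ρ
    obtain ⟨z, rfl⟩ := exists_cycle ρ
    refine (IsPathCocycle.eval_apply _ z).trans (Eq.trans ?_ (congrArg₂ (fun a b : ℝ => a + b)
      (IsPathCocycle.eval_apply _ z) (IsPathCocycle.eval_apply _ z)).symm)
    have : pathIntegral ((η + β : closedForms S) : OneForm S) =
        fun γ => pathIntegral (η : OneForm S) γ + pathIntegral (β : OneForm S) γ :=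
      funext (pathIntegral_add η.2 β.2)
    rw [this, chainEval_add]
    rfl
  map_smul' a η := by
    ext ρ
    obtain ⟨z, rfl⟩ := exists_cycle ρ
    refine (IsPathCocycle.eval_apply _ z).trans (Eq.trans ?_ (congrArg (fun b : ℝ => a * b)
      (IsPathCocycle.eval_apply _ z)).symm)
    have : pathIntegral ((a • η : closedForms S) : OneForm S) =
        fun γ => a * pathIntegral (η : OneForm S) γ :=
      funext (pathIntegral_const_smul η.2 a)
    rw [this, chainEval_const_mul]
    rfl

theorem pairing_apply (η : closedForms S) (ρ : H1 S) : pairing S η ρ = formPairing η.1 ρ :=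
  (formPairing_eq_eval η.2 ρ).symm

/-- A closed form that pairs trivially with homology is exact. -/
theorem exists_primitive_of_pairing_eq_zero [ConnectedSpace S] (η : closedForms S)
    (h : pairing S η = 0) : ∃ G : S → ℝ, ∀ p, IsPrimitiveNear η.1 G p := by
  refine exists_primitive_of_loops η.2 fun x γ => ?_
  obtain ⟨ρ, hρ⟩ := exists_class_of_loop γ.toContinuousMap (by simp)
  exact (hρ _ (isPathCocycle_pathIntegral η.2)).symm.trans (LinearMap.congr_fun h ρ)

/-- Allows a period to be computed from any cocycle that agrees with path integration up to
increments of a function, whatever the regularity of that function. -/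
theorem formPairing_eq_of_increment (hη : IsClosedForm η) {φ : C(I, S) → ℝ} (hφ : IsPathCocycle φ)
    (w : S → ℝ) (h : ∀ γ, φ γ = pathIntegral η γ + (w (γ 1) - w (γ 0))) (ρ : H1 S) :
    formPairing η ρ = hφ.eval ρ := by
  rw [formPairing_eq_eval hη, ← hφ.eval_congr (isPathCocycle_pathIntegral hη) w h]

theorem pairing_eq_zero_of_exact (η : closedForms S) {G : S → ℝ}
    (hG : ∀ p, IsPrimitiveNear η.1 G p) : pairing S η = 0 := by
  ext ρ
  have h0 : IsPathCocycle (fun _ : C(I, S) => (0 : ℝ)) := fun x => by simp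
  rw [pairing_apply, formPairing_eq_of_increment η.2 h0 (fun x => - G x) (fun γ => by
    rw [pathIntegral_of_isPrimitiveNear fun t => hG (γ t)]; ring) ρ]
  obtain ⟨z, rfl⟩ := exists_cycle ρ
  rw [h0.eval_apply]
  have : chainEval (fun _ : C(I, S) => (0 : ℝ)) = 0 := by
    refine chain_ext fun c => ?_
    rw [chainEval_simplexChain]
    rfl
  rw [this]
  rfl

variable [CompactSpace S] [T2Space S]

/-- The pull-back of a closed form by a continuous map is cohomologous to a closed form; if the map
is of class `C¹` then so is the correction. -/
theorem exists_pullback (f : C(S, S)) (hβ : IsClosedForm β) :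
    ∃ (η : OneForm S) (G : S → ℝ), IsClosedForm η ∧ Continuous G ∧
      (∀ γ : C(I, S), pathIntegral β (f.comp γ) = pathIntegral η γ + (G (γ 1) - G (γ 0))) ∧
      (ContMDiff (𝓡 2) (𝓡 2) 1 f → ContMDiff (𝓡 2) 𝓘(ℝ, ℝ) 1 G ∧
        ∀ (x : S) (v : TangentSpace (𝓡 2) x),
          β (f x) (mfderiv (𝓡 2) (𝓡 2) f x v) = η x v + differentialAt G x v) := by
  choose k hk using hβ
  -- Composing a C² primitive with a map of class C¹ only gives a C¹ function, so the naive
  -- pull-back need not be a closed form of class C¹. The smoothing replaces it by η at the price of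
  -- the exact correction dG.
  obtain ⟨η, G, hη, hprim, hreg⟩ := exists_smoothing
    (U := fun p => {x | IsPrimitiveNear β (k (f p)) (f x)})
    (fun p => (isOpen_setOf_isPrimitiveNear β _).preimage f.continuous) (fun p => hk (f p))
    (fun p y => k (f p) (f y))
    (fun p q x hp hq => f.continuous.continuousAt.eventually (hp.sub_eq_sub hq))
  have hGc : Continuous G := by
    refine (hreg 0 fun p x hx => ?_).continuous
    have h1 : ContMDiffAt (𝓡 2) 𝓘(ℝ, ℝ) 0 (k (f p)) (f x) := hx.self_of_nhds.1.of_le (by norm_num)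
    exact h1.comp x (contMDiff_zero_iff.2 f.continuous).contMDiffAt
  refine ⟨η, G, hη, hGc, fun γ => ?_, fun hf => ?_⟩
  · obtain ⟨F, hF⟩ := exists_primitive_path hη γ
    rw [pathIntegral_eq hF, pathIntegral_eq (F := fun t => F t + G (γ t))]
    · ring
    intro t
    obtain ⟨g, hg, hFg⟩ := hF t
    refine ⟨k (f (γ t)), hk _, ?_⟩
    filter_upwards [hFg, γ.continuous.continuousAt.eventually
      (hg.sub_eq_sub (hprim (γ t) (γ t) (hk _)))] with s h1 h2
    simp only [ContinuousMap.comp_apply]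
    linarith
  · have hG1 := hreg 1 (fun p x hx => by
      have h1 : ContMDiffAt (𝓡 2) 𝓘(ℝ, ℝ) 1 (k (f p)) (f x) :=
        hx.self_of_nhds.1.of_le (by norm_num)
      exact h1.comp x hf.contMDiffAt)
    refine ⟨hG1, fun x v => ?_⟩
    have hx := (hprim x x (hk (f x))).self_of_nhds
    have hkx := (hk (f x)).self_of_nhds
    have e0 : HasMFDerivAt (𝓡 2) 𝓘(ℝ, ℝ) (fun y => k (f x) (f y)) x _ :=
      (hkx.1.mdifferentiableAt (by norm_num)).hasMFDerivAt.comp x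
        ((hf x).mdifferentiableAt (by norm_num)).hasMFDerivAt
    have e1 := mfderiv_add (hx.1.mdifferentiableAt (by norm_num))
      ((hG1 x).mdifferentiableAt (by norm_num))
    have e2 : ((fun y => k (f x) (f y) - G y) + G) = fun y => k (f x) (f y) := by
      funext y
      simp
    rw [e2, e0.mfderiv] at e1
    have e3 := DFunLike.congr_fun e1 v
    exact (hkx.2 _).symm.trans (e3.trans (congrArg₂ (fun a b : ℝ => a + b) (hx.2 v) rfl))

/-- Every linear form on homology is given by a closed form. -/
theorem pairing_surjective : Function.Surjective (pairing S) := by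
  classical
  intro l
  obtain ⟨φ, hφ, rfl⟩ := exists_pathCocycle l
  choose r hr ht _ using fun p : S => exists_chart_ball (p := p) (Filter.univ_mem)
  let B : S → Set Plane := fun p => Metric.ball (chartAt Plane p p) (r p)
  let U : S → Set S := fun p => (chartAt Plane p).source ∩ (chartAt Plane p) ⁻¹' B p
  have hUo : ∀ p, IsOpen (U p) := fun p =>
    (chartAt Plane p).isOpen_inter_preimage Metric.isOpen_ball
  have hU : ∀ p, p ∈ U p := fun p => ⟨mem_chart_source _ p, Metric.mem_ball_self (hr p)⟩
  let Φ : ∀ p, C(B p, S) := fun p => ⟨fun y => (chartAt Plane p).symm y,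
    ((chartAt Plane p).continuousOn_symm.mono (ht p)).domRestrict⟩
  -- On each chart ball the cocycle is an increment of a function. No regularity of that function is
  -- known, and none is needed for the smoothing below.
  choose F hF using fun p => hφ.exists_potential (convex_ball _ _) (Φ p)
  let g : S → S → ℝ := fun p y => if h : y ∈ U p then F p ⟨chartAt Plane p y, h.2⟩ else 0
  have hg : ∀ p (γ : C(I, S)), (∀ t, γ t ∈ U p) → φ γ = g p (γ 1) - g p (γ 0) := by
    intro p γ hγ
    have := hF p ⟨fun t => ⟨chartAt Plane p (γ t), (hγ t).2⟩, by
      refine Continuous.subtype_mk ?_ _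
      exact (chartAt Plane p).continuousOn.comp_continuous γ.continuous fun t => (hγ t).1⟩
    have e : (Φ p).comp ⟨fun t => ⟨chartAt Plane p (γ t), (hγ t).2⟩, by
      refine Continuous.subtype_mk ?_ _
      exact (chartAt Plane p).continuousOn.comp_continuous γ.continuous fun t => (hγ t).1⟩ = γ := by
      ext t
      exact (chartAt Plane p).left_inv (hγ t).1
    rw [e] at this
    rw [this]
    simp only [g, hγ, dif_pos, ContinuousMap.coe_mk]
  obtain ⟨η, G, hη, hprim, -⟩ := exists_smoothing hUo hU g (by
    intro p q x hp hq
    filter_upwards [exists_small_path (((hUo p).inter (hUo q)).mem_nhds ⟨hp, hq⟩)] with y hy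
    obtain ⟨τ, hτ⟩ := hy
    have h1 := hg p τ.toContinuousMap fun t => (hτ t).1
    have h2 := hg q τ.toContinuousMap fun t => (hτ t).2
    simp only [Path.coe_toContinuousMap, τ.source, τ.target] at h1 h2
    linarith)
  refine ⟨⟨η, hη⟩, LinearMap.ext fun ρ => ?_⟩
  rw [pairing_apply]
  refine formPairing_eq_of_increment hη hφ G (fun γ => ?_) ρ
  obtain ⟨A, hA⟩ := hφ.exists_potential (convex_Icc (0 : ℝ) 1) γ
  have hA1 := hA (ContinuousMap.id I)
  rw [ContinuousMap.comp_id] at hA1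
  rw [hA1, pathIntegral_eq (F := fun t => A t - G (γ t))]
  · simp only [ContinuousMap.id_apply]
    ring
  intro t
  refine ⟨fun y => g (γ t) y - G y, hprim _ _ (hU _), ?_⟩
  -- For s close to t the whole subpath between t and s stays in one chart ball, where the potential
  -- `A` along the path can be compared with the local function `g (γ t)`.
  have hnear : ∀ᶠ s : I in 𝓝 t, ∀ r : I, γ (⟨AffineMap.lineMap (t : ℝ) (s : ℝ) (r : ℝ),
      (convex_Icc (0 : ℝ) 1).lineMap_mem t.2 s.2 r.2⟩) ∈ U (γ t) := by
    have hn : γ ⁻¹' U (γ t) ∈ 𝓝 t := γ.continuous.continuousAt.preimage_mem_nhds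
      ((hUo _).mem_nhds (hU _))
    obtain ⟨ε, hε, hb⟩ := Metric.mem_nhds_iff.1 hn
    filter_upwards [Metric.ball_mem_nhds t hε] with s hs r
    apply hb
    rw [Metric.mem_ball, Subtype.dist_eq] at hs ⊢
    rw [dist_lineMap_left, Real.norm_of_nonneg r.2.1, dist_comm]
    calc (r : ℝ) * dist (s : ℝ) t ≤ 1 * dist (s : ℝ) t := by gcongr; exact r.2.2
      _ < ε := by rwa [one_mul]
  filter_upwards [hnear] with s hs
  have h1 := hA ⟨fun r => ⟨AffineMap.lineMap (t : ℝ) (s : ℝ) (r : ℝ),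
      (convex_Icc (0 : ℝ) 1).lineMap_mem t.2 s.2 r.2⟩, by
        simp only [AffineMap.lineMap_apply]; fun_prop⟩
  rw [hg (γ t) _ hs] at h1
  simp only [ContinuousMap.comp_apply, ContinuousMap.coe_mk, Set.Icc.coe_zero, Set.Icc.coe_one,
    AffineMap.lineMap_apply_zero, AffineMap.lineMap_apply_one, Subtype.coe_eta] at h1
  linarith

end Pairing

end

noncomputable section

/-! ### Compactly supported functions on the plane -/

section PlaneAnalysis

open MeasureTheory

/-- The vectors of the standard basis of the plane. -/
abbrev basisVec (i : Fin 2) : Plane := EuclideanSpace.single i (1 : ℝ)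

theorem add_smul_basisVec_apply_same (y : Plane) (t : ℝ) (i : Fin 2) :
    (y + t • basisVec i) i = y i + t := by
  simp [basisVec]

theorem add_smul_basisVec_apply_ne (y : Plane) (t : ℝ) {i j : Fin 2} (h : j ≠ i) :
    (y + t • basisVec i) j = y j := by
  simp [basisVec, h]

/-- A closed square in the plane. -/
def closedSquare (c : Plane) (r : ℝ) : Set Plane := {y | ∀ i, |y i - c i| ≤ r}

theorem isClosed_closedSquare (c : Plane) (r : ℝ) : IsClosed (closedSquare c r) := by
  have : closedSquare c r = ⋂ i, {y : Plane | |y i - c i| ≤ r} := by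
    ext y
    simp [closedSquare]
  rw [this]
  exact isClosed_iInter fun i => isClosed_le (by fun_prop) continuous_const

theorem closedSquare_subset_closedBall (c : Plane) {r : ℝ} (hr : 0 ≤ r) :
    closedSquare c r ⊆ Metric.closedBall c (2 * r) := by
  intro y hy
  rw [Metric.mem_closedBall, EuclideanSpace.dist_eq]
  refine Real.sqrt_le_iff.2 ⟨by linarith, ?_⟩
  rw [Fin.sum_univ_two, Real.dist_eq, Real.dist_eq]
  have h0 := pow_le_pow_left₀ (abs_nonneg _) (hy 0) 2
  have h1 := pow_le_pow_left₀ (abs_nonneg _) (hy 1) 2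
  nlinarith [sq_nonneg r]

theorem isCompact_closedSquare (c : Plane) {r : ℝ} (hr : 0 ≤ r) : IsCompact (closedSquare c r) :=
  (isCompact_closedBall c (2 * r)).of_isClosed_subset (isClosed_closedSquare c r)
    (closedSquare_subset_closedBall c hr)

theorem closedSquare_mem_nhds (c : Plane) {r : ℝ} (hr : 0 < r) : closedSquare c r ∈ 𝓝 c := by
  have : ∀ i : Fin 2, ∀ᶠ y : Plane in 𝓝 c, |y i - c i| ≤ r := by
    intro i
    have hc : ContinuousAt (fun y : Plane => |y i - c i|) c := by fun_prop
    filter_upwards [hc.eventually_lt (continuousAt_const (y := r)) (by simpa using hr)] with y hy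
    exact hy.le
  exact Filter.eventually_all.2 this

theorem HasCompactSupport.exists_norm_bound {v : Plane → ℝ} (hv : HasCompactSupport v) :
    ∃ R : ℝ, ∀ y, R < ‖y‖ → v y = 0 := by
  obtain ⟨R, hR⟩ := hv.isCompact.isBounded.exists_norm_le
  exact ⟨R, fun y hy => image_eq_zero_of_notMem_tsupport fun h => not_lt.2 (hR y h) hy⟩

/-- Weighted integrals along lines depend smoothly on the line. -/
theorem contDiff_lineIntegral {v : Plane → ℝ} {n : ℕ∞} (hv : ContDiff ℝ n v)
    (hc : HasCompactSupport v) {w : ℝ → ℝ} (hw : LocallyIntegrable w) (i : Fin 2) :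
    ContDiff ℝ n fun y => ∫ t : ℝ, w t * v (y + (-t) • basisVec i) := by
  obtain ⟨R, hR⟩ := hc.exists_norm_bound
  rw [contDiff_iff_contDiffAt]
  intro y₀
  -- The integrand must vanish for t outside a compact set common to all parameters. This holds for
  -- y in the ball of radius ‖y₀‖ + 1, since v(y + t e) ≠ 0 then forces |t| ≤ R + ‖y₀‖ + 1. The
  -- convolution is evaluated at 0, whence the sign of t.
  have h := contDiffOn_convolution_right_with_param_comp (𝕜 := ℝ) (n := n) (μ := volume)
    (ContinuousLinearMap.mul ℝ ℝ) (s := Metric.ball (0 : Plane) (‖y₀‖ + 1)) (v := fun _ => (0 : ℝ))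
    contDiffOn_const (f := w) (g := fun y t => v (y + t • basisVec i))
    (k := Metric.closedBall 0 (R + (‖y₀‖ + 1))) Metric.isOpen_ball (isCompact_closedBall _ _)
    (by
      intro y t hy ht
      apply hR
      rw [mem_ball_zero_iff] at hy
      rw [mem_closedBall_zero_iff, not_le] at ht
      have h1 : ‖t • basisVec i‖ = ‖t‖ := by rw [norm_smul]; simp [basisVec]
      have h2 := norm_sub_norm_le (t • basisVec i) (-y)
      rw [norm_neg, sub_neg_eq_add, add_comm _ y] at h2
      linarith) hw
    (by
      refine ContDiff.contDiffOn ?_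
      change ContDiff ℝ n fun x : Plane × ℝ => v (x.1 + x.2 • basisVec i)
      fun_prop)
  have h2 := h.contDiffAt (Metric.isOpen_ball.mem_nhds
    (show y₀ ∈ Metric.ball (0 : Plane) (‖y₀‖ + 1) by simp))
  simpa [convolution] using h2

theorem line_continuous (y : Plane) (i : Fin 2) : Continuous fun t : ℝ => y + t • basisVec i := by
  fun_prop

theorem hasCompactSupport_line {v : Plane → ℝ} (hc : HasCompactSupport v) (y : Plane) (i : Fin 2) :
    HasCompactSupport fun t : ℝ => v (y + t • basisVec i) := by
  obtain ⟨R, hR⟩ := hc.exists_norm_bound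
  refine HasCompactSupport.intro (isCompact_closedBall (0 : ℝ) (R + ‖y‖)) fun t ht => hR _ ?_
  rw [mem_closedBall_zero_iff, not_le] at ht
  have h1 : ‖t • basisVec i‖ = ‖t‖ := by rw [norm_smul]; simp [basisVec]
  have h2 := norm_sub_norm_le (t • basisVec i) (-y)
  rw [norm_neg, sub_neg_eq_add, add_comm _ y] at h2
  linarith

theorem integrable_line {v : Plane → ℝ} (hv : Continuous v) (hc : HasCompactSupport v) (y : Plane)
    (i : Fin 2) : Integrable fun t : ℝ => v (y + t • basisVec i) :=
  (hv.comp (line_continuous y i)).integrable_of_hasCompactSupport (hasCompactSupport_line hc y i)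

/-- A function supported in a square whose integrals along the lines of one direction vanish is
the derivative in this direction of a function supported in the square. -/
theorem exists_directional_primitive {v : Plane → ℝ} (hv : ContDiff ℝ 1 v) {c : Plane} {r : ℝ}
    (hr : 0 ≤ r) (hs : ∀ y, y ∉ closedSquare c r → v y = 0) (i : Fin 2)
    (h_int : ∀ y, ∫ t : ℝ, v (y + t • basisVec i) = 0) :
    ∃ P : Plane → ℝ, ContDiff ℝ 1 P ∧ (∀ y, y ∉ closedSquare c r → P y = 0) ∧
      ∀ y, fderiv ℝ P y (basisVec i) = v y := by
  have hc : HasCompactSupport v := HasCompactSupport.intro (isCompact_closedSquare c hr) hs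
  -- The primitive from -∞ along the line, written as a weighted integral over the whole line so
  -- that its regularity follows from `contDiff_lineIntegral`.
  set P : Plane → ℝ := fun y => ∫ t : ℝ, (Set.Ici (0 : ℝ)).indicator 1 t * v (y + (-t) • basisVec i)
    with hP
  have hPd : ContDiff ℝ 1 P := by
    refine contDiff_lineIntegral (n := 1) hv hc ?_ i
    exact (locallyIntegrable_const (1 : ℝ)).indicator measurableSet_Ici
  have hPi : ∀ (y : Plane) (h : ℝ), P (y + h • basisVec i) = ∫ s : ℝ in Set.Iic h, v (y + s • basisVec i) := by
    intro y h
    rw [hP, ← integral_indicator measurableSet_Iic, ← integral_sub_left_eq_self _ _ h]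
    refine integral_congr_ae (Filter.Eventually.of_forall fun t => ?_)
    simp only
    have e : y + h • basisVec i + -t • basisVec i = y + (h - t) • basisVec i := by
      rw [add_assoc, ← add_smul, sub_eq_add_neg]
    rw [e]
    by_cases ht : 0 ≤ t
    · have h1 : h - t ∈ Set.Iic h := by simpa using ht
      rw [Set.indicator_of_mem (by simpa using ht), Set.indicator_of_mem h1]
      simp
    · have h1 : h - t ∉ Set.Iic h := by simpa using ht
      rw [Set.indicator_of_notMem (by simpa using ht), Set.indicator_of_notMem h1]
      simp
  have hPi0 : ∀ y, P y = ∫ s : ℝ in Set.Iic 0, v (y + s • basisVec i) := by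
    intro y
    have := hPi y 0
    rwa [zero_smul, add_zero] at this
  refine ⟨P, hPd, fun y hy => ?_, fun y => ?_⟩
  · rw [hPi0]
    simp only [closedSquare, Set.mem_ofPred_eq, not_forall, not_le] at hy
    obtain ⟨j, hj⟩ := hy
    by_cases hji : j = i
    · subst hji
      rcases lt_abs.1 hj with h1 | h1
      -- Beyond the square in the positive direction, the integral up to the point is the whole line
      -- integral, which vanishes by assumption.
      · have hy := h_int y
        rw [← integral_add_compl (measurableSet_Iic (a := (0 : ℝ)))
          (integrable_line hv.continuous hc y j)] at hy
        rw [eq_neg_of_add_eq_zero_left hy, setIntegral_eq_zero_of_forall_eq_zero, neg_zero]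
        intro s hs'
        refine hs _ fun h => ?_
        have h2 := (abs_le.1 (h j)).2
        rw [add_smul_basisVec_apply_same] at h2
        have : 0 < s := by simpa using hs'
        linarith
      · refine setIntegral_eq_zero_of_forall_eq_zero fun s hs' => hs _ fun h => ?_
        have h2 := (abs_le.1 (h j)).1
        rw [add_smul_basisVec_apply_same] at h2
        have : s ≤ 0 := hs'
        linarith
    · refine setIntegral_eq_zero_of_forall_eq_zero fun s hs' => hs _ fun h => ?_
      have h2 := h j
      rw [add_smul_basisVec_apply_ne _ _ hji] at h2
      linarith
  · have h1 : HasDerivAt (fun h : ℝ => P (y + h • basisVec i)) (fderiv ℝ P y (basisVec i)) 0 := by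
      have := (hPd.differentiable (by norm_num) y).hasFDerivAt.hasLineDerivAt (basisVec i)
      exact this
    have hcont : Continuous fun s : ℝ => v (y + s • basisVec i) :=
      hv.continuous.comp (line_continuous y i)
    have h2 : HasDerivAt (fun h : ℝ => P (y + h • basisVec i)) (v y) 0 := by
      have e : (fun h : ℝ => P (y + h • basisVec i)) = fun h =>
          (∫ s : ℝ in Set.Iic 0, v (y + s • basisVec i)) + ∫ s in (0 : ℝ)..h, v (y + s • basisVec i) := by
        funext h
        rw [hPi, ← intervalIntegral.integral_Iic_sub_Iic
          (integrable_line hv.continuous hc y i).integrableOn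
          (integrable_line hv.continuous hc y i).integrableOn]
        ring
      rw [e]
      have := intervalIntegral.integral_hasDerivAt_right (hcont.intervalIntegrable 0 0)
        hcont.stronglyMeasurable.stronglyMeasurableAtFilter hcont.continuousAt
      simpa using this.const_add (∫ s : ℝ in Set.Iic 0, v (y + s • basisVec i))
    exact h1.unique h2

/-- Integration over the plane as an iterated integral. -/
theorem integral_plane_eq {v : Plane → ℝ} (hv : Continuous v) (hc : HasCompactSupport v) :
    ∫ y, v y = ∫ s : ℝ, ∫ t : ℝ, v ((0 + s • basisVec 0) + t • basisVec 1) := by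
  have mp : MeasurePreserving (fun x : ℝ × ℝ => WithLp.toLp 2 ![x.1, x.2] : ℝ × ℝ → Plane)
      volume volume :=
    (PiLp.volume_preserving_toLp (Fin 2)).comp ((volume_preserving_finTwoArrow ℝ).symm _)
  have me : MeasurableEmbedding (fun x : ℝ × ℝ => WithLp.toLp 2 ![x.1, x.2] : ℝ × ℝ → Plane) :=
    (MeasurableEquiv.toLp 2 (Fin 2 → ℝ)).measurableEmbedding.comp
      (MeasurableEquiv.finTwoArrow.symm.measurableEmbedding)
  rw [← mp.integral_comp me v]
  have h_int : Integrable (fun x : ℝ × ℝ => v (WithLp.toLp 2 ![x.1, x.2])) :=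
    (mp.integrable_comp_emb me).2 (hv.integrable_of_hasCompactSupport hc)
  rw [show (volume : Measure (ℝ × ℝ)) = volume.prod volume from rfl] at h_int ⊢
  rw [integral_prod _ h_int]
  refine integral_congr_ae (Filter.Eventually.of_forall fun s => ?_)
  refine integral_congr_ae (Filter.Eventually.of_forall fun t => ?_)
  simp only
  congr 1
  ext j
  fin_cases j <;> simp [basisVec]

/-- A function of class `C¹` supported in a square and of integral zero is a divergence of
functions supported in the square. -/
theorem exists_divergence_primitive {v : Plane → ℝ} (hv : ContDiff ℝ 1 v) {c : Plane} {r : ℝ}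
    (hr : 0 < r) (hs : ∀ y, y ∉ closedSquare c r → v y = 0) (h_int : ∫ y, v y = 0) :
    ∃ P Q : Plane → ℝ, ContDiff ℝ 1 P ∧ ContDiff ℝ 1 Q ∧
      (∀ y, y ∉ closedSquare c r → P y = 0) ∧ (∀ y, y ∉ closedSquare c r → Q y = 0) ∧
      ∀ y, fderiv ℝ Q y (basisVec 0) + fderiv ℝ P y (basisVec 1) = v y := by
  have hc : HasCompactSupport v := HasCompactSupport.intro (isCompact_closedSquare c hr.le) hs
  let bump : ContDiffBump (c 1) := ⟨r / 2, r, by linarith, by linarith⟩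
  let b : ℝ → ℝ := bump.normed volume
  have hb : ContDiff ℝ 1 b := bump.contDiff_normed
  have hb1 : ∫ t : ℝ, b t = 1 := bump.integral_normed
  have hb0 : ∀ t : ℝ, r < |t - c 1| → b t = 0 := by
    intro t ht
    have : t ∉ Function.support b := by
      rw [bump.support_normed_eq, Metric.mem_ball, Real.dist_eq]
      exact not_lt.2 ht.le
    simpa using this
  -- Split v = (v - F b) + F b, with F the integral of v along direction 1 and b a bump of integral
  -- one in coordinate 1. The first term has zero integrals along direction 1; the second has zero
  -- integrals along direction 0, because there F integrates to ∫ v = 0.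
  set F : Plane → ℝ := fun y => ∫ t : ℝ, v (y + t • basisVec 1) with hF
  have hFd : ContDiff ℝ 1 F := by
    have := contDiff_lineIntegral (n := 1) hv hc (locallyIntegrable_const (1 : ℝ)) 1
    have e : F = fun y => ∫ t : ℝ, 1 * v (y + (-t) • basisVec 1) := by
      funext y
      rw [hF, ← integral_neg_eq_self]
      simp
    rw [e]
    exact this
  have hF1 : ∀ (y : Plane) (t : ℝ), F (y + t • basisVec 1) = F y := by
    intro y t
    rw [hF]
    simp only
    rw [← integral_add_left_eq_self (fun s => v (y + s • basisVec 1)) t]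
    simp only [add_smul, add_assoc]
  have hF0 : ∀ y : Plane, r < |y 0 - c 0| → F y = 0 := by
    intro y hy
    refine integral_eq_zero_of_ae (Filter.Eventually.of_forall fun t => hs _ fun h => ?_)
    have := h 0
    rw [add_smul_basisVec_apply_ne _ _ (by decide)] at this
    linarith
  have hFb : ContDiff ℝ 1 fun y : Plane => F y * b (y 1) :=
    hFd.mul (hb.comp (by fun_prop))
  have hFb0 : ∀ y, y ∉ closedSquare c r → F y * b (y 1) = 0 := by
    intro y hy
    simp only [closedSquare, Set.mem_ofPred_eq, not_forall, not_le] at hy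
    obtain ⟨j, hj⟩ := hy
    fin_cases j
    · rw [hF0 y hj, zero_mul]
    · rw [hb0 (y 1) hj, mul_zero]
  obtain ⟨P, hPd, hP0, hP⟩ := exists_directional_primitive (v := fun y => v y - F y * b (y 1))
    (hv.sub hFb) hr.le (fun y hy => by rw [hs y hy, hFb0 y hy, sub_zero]) 1 (by
      intro y
      simp only [hF1, add_smul_basisVec_apply_same]
      have hbi : Integrable fun t => b (y 1 + t) := bump.integrable_normed.comp_add_left (y 1)
      rw [integral_sub (integrable_line hv.continuous hc y 1) (hbi.const_mul _),
        integral_const_mul, integral_add_left_eq_self b (y 1), hb1, mul_one, sub_self])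
  obtain ⟨Q, hQd, hQ0, hQ⟩ := exists_directional_primitive (v := fun y => F y * b (y 1))
    hFb hr.le hFb0 0 (by
      intro y
      simp only [add_smul_basisVec_apply_ne y _ (show (1 : Fin 2) ≠ 0 by decide)]
      rw [integral_mul_const]
      have e : ∀ t : ℝ, F (y + t • basisVec 0) = F (0 + (y 0 + t) • basisVec 0) := by
        intro t
        rw [← hF1 (0 + (y 0 + t) • basisVec 0) (y 1)]
        congr 1
        ext j
        fin_cases j <;> simp [basisVec]
      simp only [e]
      rw [integral_add_left_eq_self (fun s => F (0 + s • basisVec 0)) (y 0)]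
      rw [integral_plane_eq hv.continuous hc] at h_int
      rw [h_int, zero_mul])
  refine ⟨P, Q, hPd, hQd, hP0, hQ0, fun y => ?_⟩
  rw [hQ, hP]
  ring

/-- The integral of a directional derivative of a compactly supported function vanishes. -/
theorem integral_fderiv_eq_zero {w : Plane → ℝ} (hw : ContDiff ℝ 1 w) (hc : HasCompactSupport w)
    (e : Plane) : ∫ y, fderiv ℝ w y e = 0 := by
  have hci : Continuous fun y => fderiv ℝ w y e :=
    (hw.continuous_fderiv (by norm_num)).clm_apply continuous_const
  have hcs : HasCompactSupport fun y => fderiv ℝ w y e := hc.fderiv_apply ℝ e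
  have := integral_mul_fderiv_eq_neg_fderiv_mul_of_integrable (μ := (volume : Measure Plane))
    (f := fun _ => (1 : ℝ)) (g := w) (v := e) (by simp)
    (by simpa using hci.integrable_of_hasCompactSupport hcs)
    (by simpa using hw.continuous.integrable_of_hasCompactSupport hc)
    (fun x _ => differentiableAt_const _) (fun x _ => hw.differentiable (by norm_num) x)
  simpa using this

end PlaneAnalysis

end

noncomputable section

/-! ### Determinants and wedge products of linear forms in the plane -/

/-- The wedge product of two linear forms, evaluated on the standard basis. -/
def wedgeAt (a b : Plane →L[ℝ] ℝ) : ℝ :=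
  a (basisVec 0) * b (basisVec 1) - a (basisVec 1) * b (basisVec 0)

theorem plane_eq_sum (v : Plane) : v = v 0 • basisVec 0 + v 1 • basisVec 1 := by
  ext j
  fin_cases j <;> simp [basisVec]

theorem det_plane (A : Plane →L[ℝ] Plane) :
    A.det = A (basisVec 0) 0 * A (basisVec 1) 1 - A (basisVec 1) 0 * A (basisVec 0) 1 := by
  have := LinearMap.det_toMatrix (EuclideanSpace.basisFun (Fin 2) ℝ).toBasis
    (A : Plane →ₗ[ℝ] Plane)
  rw [Matrix.det_fin_two] at this
  rw [ContinuousLinearMap.det, ← this]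
  simp [LinearMap.toMatrix_apply, basisVec]

theorem det_comp_plane (A B : Plane →L[ℝ] Plane) : (A.comp B).det = A.det * B.det :=
  LinearMap.det_comp (A : Plane →ₗ[ℝ] Plane) (B : Plane →ₗ[ℝ] Plane)

theorem det_id_plane : (ContinuousLinearMap.id ℝ Plane).det = 1 :=
  LinearMap.det_id

theorem wedgeAt_comp (a b : Plane →L[ℝ] ℝ) (A : Plane →L[ℝ] Plane) :
    wedgeAt (a.comp A) (b.comp A) = wedgeAt a b * A.det := by
  have h : ∀ (c : Plane →L[ℝ] ℝ) (i : Fin 2),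
      c (A (basisVec i)) = A (basisVec i) 0 * c (basisVec 0) + A (basisVec i) 1 * c (basisVec 1) := by
    intro c i
    conv_lhs => rw [plane_eq_sum (A (basisVec i))]
    simp only [map_add, map_smul, smul_eq_mul]
  simp only [wedgeAt, ContinuousLinearMap.comp_apply, h, det_plane]
  ring

theorem wedgeAt_swap (a b : Plane →L[ℝ] ℝ) : wedgeAt b a = -wedgeAt a b := by
  simp only [wedgeAt]; ring

/-! ### One-forms and two-forms read in charts -/

section ChartForms

variable {S : Type u} [TopologicalSpace S] [ChartedSpace Plane S]

/-- The value of a one-form at a point, as a linear form on the model space. -/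
def formAt (η : OneForm S) (x : S) : Plane →L[ℝ] ℝ := η x

/-- The one-form `u θ`. -/
def scaleForm (u : S → ℝ) (θ : OneForm S) : OneForm S := fun x => u x • θ x

/-- The differential of a function. -/
def dForm (g : S → ℝ) : OneForm S := fun x => mfderiv (𝓡 2) 𝓘(ℝ, ℝ) g x

/-- The wedge product of two one-forms. A two-form is represented by its value on the standard
basis of each tangent space. -/
def wedge (η β : OneForm S) (x : S) : ℝ := wedgeAt (formAt η x) (formAt β x)

/-- The expression of a one-form in a chart. -/
def chartForm (p : S) (η : OneForm S) (y : Plane) : Plane →L[ℝ] ℝ :=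
  (formAt η ((chartAt Plane p).symm y)).comp (chartDeriv p y)

/-- The coefficient of a two-form in a chart. -/
def chartCoef (p : S) (m : S → ℝ) (y : Plane) : ℝ :=
  m ((chartAt Plane p).symm y) * (chartDeriv p y).det

theorem chartCoef_wedge (p : S) (η β : OneForm S) (y : Plane) :
    chartCoef p (wedge η β) y = wedgeAt (chartForm p η y) (chartForm p β y) :=
  (wedgeAt_comp _ _ _).symm

theorem wedgeCoeff_eq (p : S) (η β : OneForm S) (y : Plane) :
    wedgeCoeff η β p y = chartCoef p (wedge η β) y := by
  rw [chartCoef_wedge]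
  rfl

theorem wedge_swap (η β : OneForm S) : wedge β η = -wedge η β :=
  funext fun x => wedgeAt_swap (formAt η x) (formAt β x)

variable [IsManifold (𝓡 2) ∞ S]

/-- The tangent space at a point is read in the preferred chart there, so the differential of an
inverse chart is that of a transition map. This is how the oriented atlas controls its sign. -/
theorem chartDeriv_eq {p : S} {y : Plane} (hy : y ∈ (chartAt Plane p).target) :
    chartDeriv p y =
      fderiv ℝ (chartAt Plane ((chartAt Plane p).symm y) ∘ (chartAt Plane p).symm) y := by
  refine (mdifferentiableAt_chart_symm hy).mfderiv.trans ?_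
  rw [show Set.range (𝓡 2) = Set.univ by simp, fderivWithin_univ]
  rfl

theorem det_chartDeriv_pos [OrientedAtlas S] {p : S} {y : Plane}
    (hy : y ∈ (chartAt Plane p).target) : 0 < (chartDeriv p y).det := by
  rw [chartDeriv_eq hy]
  refine OrientedAtlas.det_pos _ (chart_mem_atlas Plane p) _
    (chart_mem_atlas Plane ((chartAt Plane p).symm y)) y ?_
  rw [OpenPartialHomeomorph.trans_source]
  exact ⟨hy, mem_chart_source _ _⟩

/-- The differential of a self-map of the surface, as an endomorphism of the model space. -/
def tangentMapAt (f : S → S) (x : S) : Plane →L[ℝ] Plane := mfderiv (𝓡 2) (𝓡 2) f x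

theorem OrientationPreserving.det_pos {f : S → S} (hf : OrientationPreserving f) {x : S}
    (hfx : MDifferentiableAt (𝓡 2) (𝓡 2) f x) : 0 < (tangentMapAt f x).det := by
  have e : tangentMapAt f x =
      fderiv ℝ (chartAt Plane (f x) ∘ f ∘ (chartAt Plane x).symm) (chartAt Plane x x) := by
    refine hfx.mfderiv.trans ?_
    rw [show Set.range (𝓡 2) = Set.univ by simp, fderivWithin_univ]
    rfl
  rw [e]
  exact hf x

theorem contDiffOn_comp_chart_symm {n : ℕ∞} {g : S → ℝ} {p : S} {s : Set Plane}
    (hs : s ⊆ (chartAt Plane p).target)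
    (hg : ∀ y ∈ s, ContMDiffAt (𝓡 2) 𝓘(ℝ, ℝ) n g ((chartAt Plane p).symm y)) :
    ContDiffOn ℝ n (fun y => g ((chartAt Plane p).symm y)) s := by
  intro y hy
  have h1 : ContMDiffAt (𝓡 2) (𝓡 2) n (chartAt Plane p).symm y :=
    ((show ContMDiffOn (𝓡 2) (𝓡 2) ∞ (chartAt Plane p).symm _ from
      contMDiffOn_chart_symm).contMDiffAt
      ((chartAt Plane p).open_target.mem_nhds (hs hy))).of_le (by exact_mod_cast le_top)
  exact ((hg y hy).comp y h1).contDiffAt.contDiffWithinAt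

theorem chartForm_dForm {g : S → ℝ} {p : S} {y : Plane} (hy : y ∈ (chartAt Plane p).target)
    (hg : MDifferentiableAt (𝓡 2) 𝓘(ℝ, ℝ) g ((chartAt Plane p).symm y)) :
    chartForm p (dForm g) y = fderiv ℝ (fun y => g ((chartAt Plane p).symm y)) y :=
  (hasFDerivAt_comp_chart_symm hy hg).fderiv.symm

/-- The one-form `θ` is of class `C^n`. -/
def FormOfClass (n : ℕ∞) (θ : OneForm S) : Prop :=
  ∀ p, ContDiffOn ℝ n (chartForm p θ) (chartAt Plane p).target

/-- The two-form `m` is of class `C^n`. -/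
def TwoFormOfClass (n : ℕ∞) (m : S → ℝ) : Prop :=
  ∀ p, ContDiffOn ℝ n (chartCoef p m) (chartAt Plane p).target

variable {n : ℕ∞} {θ θ' η β : OneForm S} {m m' : S → ℝ} {u : S → ℝ}

theorem FormOfClass.of_le {k : ℕ∞} (h : FormOfClass n θ) (hk : k ≤ n) : FormOfClass k θ :=
  fun p => (h p).of_le (by exact_mod_cast hk)

theorem FormOfClass.add (h : FormOfClass n θ) (h' : FormOfClass n θ') : FormOfClass n (θ + θ') :=
  fun p => (h p).add (h' p)

theorem FormOfClass.const_smul (h : FormOfClass n θ) (c : ℝ) : FormOfClass n (c • θ) :=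
  fun p => (h p).const_smul c

theorem FormOfClass.scale (h : FormOfClass n θ) (hu : ContMDiff (𝓡 2) 𝓘(ℝ, ℝ) n u) :
    FormOfClass n (scaleForm u θ) :=
  fun p => (contDiffOn_comp_chart_symm subset_rfl fun _ _ => hu.contMDiffAt).smul (h p)

theorem formOfClass_dForm (hu : ContMDiff (𝓡 2) 𝓘(ℝ, ℝ) (n + 1 : ℕ∞) u) :
    FormOfClass n (dForm u) := by
  intro p
  have h := contDiffOn_comp_chart_symm (p := p) subset_rfl fun _ _ => hu.contMDiffAt
  refine (h.fderiv_of_isOpen (m := n) (chartAt Plane p).open_target (by simp)).congr fun y hy => ?_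
  exact chartForm_dForm hy (hu.contMDiffAt.mdifferentiableAt (by simp))

theorem FormOfClass.wedge (h : FormOfClass n η) (h' : FormOfClass n β) :
    TwoFormOfClass n (wedge η β) := by
  intro p
  refine ContDiffOn.congr (f := fun y => wedgeAt (chartForm p η y) (chartForm p β y)) ?_
    fun y _ => chartCoef_wedge p η β y
  have e : ∀ {τ : OneForm S}, FormOfClass n τ → ∀ i : Fin 2,
      ContDiffOn ℝ n (fun y => chartForm p τ y (basisVec i)) (chartAt Plane p).target :=
    fun hτ i => (hτ p).clm_apply contDiffOn_const
  exact ((e h 0).mul (e h' 1)).sub ((e h 1).mul (e h' 0))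

theorem TwoFormOfClass.add (h : TwoFormOfClass n m) (h' : TwoFormOfClass n m') :
    TwoFormOfClass n (m + m') :=
  fun p => ((h p).add (h' p)).congr fun _ _ => add_mul _ _ _

theorem TwoFormOfClass.const_smul (h : TwoFormOfClass n m) (c : ℝ) : TwoFormOfClass n (c • m) :=
  fun p => (contDiffOn_const.mul (h p)).congr fun _ _ => mul_assoc c _ _

theorem TwoFormOfClass.scale (h : TwoFormOfClass n m) (hu : ContMDiff (𝓡 2) 𝓘(ℝ, ℝ) n u) :
    TwoFormOfClass n (u * m) :=
  fun p => ((contDiffOn_comp_chart_symm subset_rfl fun _ _ => hu.contMDiffAt).mul (h p)).congr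
    fun _ _ => mul_assoc _ _ _

/-- The two-form `m` is the exterior derivative of the one-form `θ` of class `C¹`. -/
def HasExteriorDeriv (θ : OneForm S) (m : S → ℝ) : Prop :=
  FormOfClass 1 θ ∧ ∀ p, ∀ y ∈ (chartAt Plane p).target,
    fderiv ℝ (chartForm p θ) y (basisVec 0) (basisVec 1) -
      fderiv ℝ (chartForm p θ) y (basisVec 1) (basisVec 0) = chartCoef p m y

theorem FormOfClass.differentiableAt (h : FormOfClass 1 θ) {p : S} {y : Plane}
    (hy : y ∈ (chartAt Plane p).target) : DifferentiableAt ℝ (chartForm p θ) y :=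
  ((h p).contDiffAt ((chartAt Plane p).open_target.mem_nhds hy)).differentiableAt (by simp)

theorem HasExteriorDeriv.add (h : HasExteriorDeriv θ m) (h' : HasExteriorDeriv θ' m') :
    HasExteriorDeriv (θ + θ') (m + m') := by
  refine ⟨h.1.add h'.1, fun p y hy => ?_⟩
  have e : fderiv ℝ (chartForm p (θ + θ')) y = fderiv ℝ (chartForm p θ) y +
      fderiv ℝ (chartForm p θ') y :=
    fderiv_add (h.1.differentiableAt hy) (h'.1.differentiableAt hy)
  have e2 : chartCoef p (m + m') y = chartCoef p m y + chartCoef p m' y := add_mul _ _ _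
  rw [e, e2, ← h.2 p y hy, ← h'.2 p y hy]
  simp only [add_apply]
  ring

theorem HasExteriorDeriv.const_smul (h : HasExteriorDeriv θ m) (c : ℝ) :
    HasExteriorDeriv (c • θ) (c • m) := by
  refine ⟨h.1.const_smul c, fun p y hy => ?_⟩
  have e : fderiv ℝ (chartForm p (c • θ)) y = c • fderiv ℝ (chartForm p θ) y :=
    fderiv_const_smul (h.1.differentiableAt hy) c
  have e2 : chartCoef p (c • m) y = c * chartCoef p m y := mul_assoc _ _ _
  rw [e, e2, ← h.2 p y hy]
  simp only [smul_apply, smul_eq_mul]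
  ring

/-- The Leibniz rule. -/
theorem HasExteriorDeriv.scale (h : HasExteriorDeriv θ m) (hu : ContMDiff (𝓡 2) 𝓘(ℝ, ℝ) 1 u) :
    HasExteriorDeriv (scaleForm u θ) (wedge (dForm u) θ + u * m) := by
  refine ⟨h.1.scale hu, fun p y hy => ?_⟩
  have hu' : MDifferentiableAt (𝓡 2) 𝓘(ℝ, ℝ) u ((chartAt Plane p).symm y) :=
    hu.contMDiffAt.mdifferentiableAt (by simp)
  have e : fderiv ℝ (chartForm p (scaleForm u θ)) y =
      u ((chartAt Plane p).symm y) • fderiv ℝ (chartForm p θ) y +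
        (fderiv ℝ (fun y => u ((chartAt Plane p).symm y)) y).smulRight (chartForm p θ y) :=
    fderiv_fun_smul (hasFDerivAt_comp_chart_symm hy hu').differentiableAt (h.1.differentiableAt hy)
  have e2 : chartCoef p (wedge (dForm u) θ + u * m) y =
      chartCoef p (wedge (dForm u) θ) y + u ((chartAt Plane p).symm y) * chartCoef p m y := by
    simp only [chartCoef, Pi.add_apply, Pi.mul_apply]
    ring
  rw [e, e2, ← h.2 p y hy, chartCoef_wedge, chartForm_dForm hy hu', wedgeAt]
  simp only [add_apply, smul_apply, smul_eq_mul, ContinuousLinearMap.smulRight_apply]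
  ring

theorem HasExteriorDeriv.twoFormOfClass (h : HasExteriorDeriv θ m) : TwoFormOfClass 0 m := by
  intro p
  refine ContDiffOn.congr (f := fun y => fderiv ℝ (chartForm p θ) y (basisVec 0) (basisVec 1) -
      fderiv ℝ (chartForm p θ) y (basisVec 1) (basisVec 0)) ?_ fun y hy => (h.2 p y hy).symm
  have hd : ContDiffOn ℝ 0 (fderiv ℝ (chartForm p θ)) (chartAt Plane p).target :=
    (h.1 p).fderiv_of_isOpen (m := 0) (chartAt Plane p).open_target (by simp)
  have e : ∀ i j : Fin 2, ContDiffOn ℝ 0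
      (fun y => fderiv ℝ (chartForm p θ) y (basisVec i) (basisVec j)) (chartAt Plane p).target :=
    fun i j => (hd.clm_apply contDiffOn_const).clm_apply contDiffOn_const
  exact (e 0 1).sub (e 1 0)

theorem HasExteriorDeriv.unique [OrientedAtlas S] (h : HasExteriorDeriv θ m)
    (h' : HasExteriorDeriv θ m') : m = m' := by
  funext x
  have hy := mem_chart_target Plane x
  have := (h.2 x _ hy).symm.trans (h'.2 x _ hy)
  have e := mul_right_cancel₀ (det_chartDeriv_pos hy).ne' this
  rwa [(chartAt Plane x).left_inv (mem_chart_source _ x)] at e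

/-- Closed forms have zero exterior derivative. -/
theorem IsClosedForm.hasExteriorDeriv (h : IsClosedForm η) : HasExteriorDeriv η 0 := by
  have key : ∀ p, ∀ y ∈ (chartAt Plane p).target, ContDiffAt ℝ 1 (chartForm p η) y ∧
      fderiv ℝ (chartForm p η) y (basisVec 0) (basisVec 1) =
      fderiv ℝ (chartForm p η) y (basisVec 1) (basisVec 0) := by
    intro p y hy
    obtain ⟨g, hg⟩ := h ((chartAt Plane p).symm y)
    have hg2 : ContDiffAt ℝ 2 (fun y => g ((chartAt Plane p).symm y)) y := by
        have h1 : ContMDiffAt (𝓡 2) (𝓡 2) 2 (chartAt Plane p).symm y :=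
          ((show ContMDiffOn (𝓡 2) (𝓡 2) ∞ (chartAt Plane p).symm _ from
            contMDiffOn_chart_symm).contMDiffAt
            ((chartAt Plane p).open_target.mem_nhds hy)).of_le two_le_infty
        exact (hg.self_of_nhds.1.comp y h1).contDiffAt
    have ev : chartForm p η =ᶠ[𝓝 y] fderiv ℝ (fun y => g ((chartAt Plane p).symm y)) := by
      filter_upwards [((chartAt Plane p).continuousAt_symm hy).eventually hg,
        (chartAt Plane p).open_target.mem_nhds hy] with z hz hzt
      refine Eq.trans ?_ (chartForm_dForm hzt (hz.1.mdifferentiableAt (by norm_num)))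
      exact congrArg (fun a : Plane →L[ℝ] ℝ => a.comp (chartDeriv p z))
        (ContinuousLinearMap.ext hz.2).symm
    refine ⟨(hg2.fderiv_right (m := 1) (by norm_num)).congr_of_eventuallyEq ev, ?_⟩
    rw [ev.fderiv_eq]
    exact hg2.isSymmSndFDerivAt (by simp) _ _
  refine ⟨fun p y hy => (key p y hy).1.contDiffWithinAt, fun p y hy => ?_⟩
  rw [(key p y hy).2, sub_self]
  simp [chartCoef]

/-- The differential of a chart, as an endomorphism of the model space. -/
theorem chartDeriv_comp_mfderiv_chart {p x : S} (hx : x ∈ (chartAt Plane p).source) :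
    (chartDeriv p (chartAt Plane p x)).comp (show Plane →L[ℝ] Plane from
      mfderiv (𝓡 2) (𝓡 2) (chartAt Plane p) x) = ContinuousLinearMap.id ℝ Plane := by
  have h1 := (mdifferentiableAt_chart_symm ((chartAt Plane p).map_source hx)).hasMFDerivAt.comp x
    (mdifferentiableAt_chart hx).hasMFDerivAt
  have h2 : HasMFDerivAt (𝓡 2) (𝓡 2) ((chartAt Plane p).symm ∘ chartAt Plane p) x
      (ContinuousLinearMap.id ℝ (TangentSpace (𝓡 2) x)) :=
    (hasMFDerivAt_id x).congr_of_eventuallyEq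
      (Filter.eventually_of_mem ((chartAt Plane p).open_source.mem_nhds hx)
        fun z hz => (chartAt Plane p).left_inv hz)
  exact hasMFDerivAt_unique h1 h2

/-- The Poincaré lemma. -/
theorem HasExteriorDeriv.exists_isPrimitiveNear (h : HasExteriorDeriv θ m) {p : S}
    (hm : ∀ᶠ x in 𝓝 p, m x = 0) : ∃ g, IsPrimitiveNear θ g p := by
  obtain ⟨r, hr, ht, hW⟩ := exists_chart_ball hm
  set B := Metric.ball (chartAt Plane p p) r with hB
  have hsymm : ∀ a ∈ B, ∀ x y, fderiv ℝ (chartForm p θ) a x y = fderiv ℝ (chartForm p θ) a y x := by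
    intro a ha x y
    have e := h.2 p a (ht ha)
    rw [chartCoef, show m _ = 0 from hW a ha, zero_mul] at e
    rw [plane_eq_sum x, plane_eq_sum y]
    simp only [map_add, map_smul, add_apply, smul_apply, smul_eq_mul]
    linear_combination (x 0 * y 1 - x 1 * y 0) * e
  obtain ⟨g, hg⟩ := (convex_ball (chartAt Plane p p) r).exists_forall_hasFDerivAt_of_fderiv_symmetric
    Metric.isOpen_ball (((h.1 p).mono ht).differentiableOn (by simp)) hsymm
  have hgd : ContDiffOn ℝ 2 g B := by
    rw [show (2 : ℕ∞ω) = 1 + 1 by norm_num, contDiffOn_succ_iff_fderiv_of_isOpen Metric.isOpen_ball]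
    refine ⟨fun a ha => (hg a ha).differentiableAt.differentiableWithinAt, by simp, ?_⟩
    exact ((h.1 p).mono ht).congr fun a ha => (hg a ha).fderiv
  refine ⟨fun x => g (chartAt Plane p x), ?_⟩
  have hev : ∀ᶠ x in 𝓝 p, x ∈ (chartAt Plane p).source ∧ chartAt Plane p x ∈ B :=
    Filter.inter_mem ((chartAt Plane p).open_source.mem_nhds (mem_chart_source _ p))
      (((chartAt Plane p).continuousAt (mem_chart_source _ p)).eventually
        (Metric.ball_mem_nhds _ hr))
  filter_upwards [hev] with x hx
  have hc : ContMDiffAt (𝓡 2) (𝓡 2) 2 (chartAt Plane p) x :=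
    ((show ContMDiffOn (𝓡 2) (𝓡 2) ∞ (chartAt Plane p) _ from contMDiffOn_chart).contMDiffAt
      ((chartAt Plane p).open_source.mem_nhds hx.1)).of_le two_le_infty
  refine ⟨((hgd.contDiffAt (Metric.isOpen_ball.mem_nhds hx.2)).contMDiffAt).comp x hc, fun v => ?_⟩
  have h1 := (hg _ hx.2).hasMFDerivAt.comp x (mdifferentiableAt_chart hx.1).hasMFDerivAt
  refine (DFunLike.congr_fun h1.mfderiv v).trans ?_
  have h2 := DFunLike.congr_fun (chartDeriv_comp_mfderiv_chart hx.1) v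
  change formAt θ ((chartAt Plane p).symm (chartAt Plane p x)) ((chartDeriv p (chartAt Plane p x)) _) =
    formAt θ x v
  rw [(chartAt Plane p).left_inv hx.1]
  exact congrArg (formAt θ x) h2

theorem HasExteriorDeriv.isClosedForm (h : HasExteriorDeriv θ 0) : IsClosedForm θ :=
  fun _ => h.exists_isPrimitiveNear (Filter.Eventually.of_forall fun _ => rfl)

end ChartForms

end

noncomputable section

/-! ### Integration of two-forms -/

section Integration

open MeasureTheory

/-- Extension by zero is regular because the function already vanishes near the boundary of the open
set. -/
theorem contDiff_indicator {T K : Set Plane} {v : Plane → ℝ} {n : ℕ∞} (hT : IsOpen T)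
    (hK : IsCompact K) (hKT : K ⊆ T) (hv : ContDiffOn ℝ n v T) (h0 : ∀ y ∈ T, y ∉ K → v y = 0) :
    ContDiff ℝ n (T.indicator v) ∧ HasCompactSupport (T.indicator v) := by
  have h : ∀ y, y ∉ K → T.indicator v y = 0 := by
    intro y hy
    by_cases hyT : y ∈ T
    · rw [Set.indicator_of_mem hyT, h0 y hyT hy]
    · exact Set.indicator_of_notMem hyT v
  refine ⟨contDiff_iff_contDiffAt.2 fun y => ?_, HasCompactSupport.intro hK h⟩
  by_cases hy : y ∈ K
  · refine (hv.contDiffAt (hT.mem_nhds (hKT hy))).congr_of_eventuallyEq ?_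
    filter_upwards [hT.mem_nhds (hKT hy)] with z hz
    exact Set.indicator_of_mem hz v
  · refine (contDiffAt_const (c := (0 : ℝ))).congr_of_eventuallyEq ?_
    filter_upwards [hK.isClosed.isOpen_compl.mem_nhds hy] with z hz
    exact h z hz

variable {S : Type u} [TopologicalSpace S] [ChartedSpace Plane S] [IsManifold (𝓡 2) ∞ S]
  {n : ℕ∞} {m m' : S → ℝ}

theorem TwoFormOfClass.indicator (hm : TwoFormOfClass n m) {K : Set S} (hK : IsCompact K) {p : S}
    (hKp : K ⊆ (chartAt Plane p).source) (h0 : ∀ x ∉ K, m x = 0) :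
    ContDiff ℝ n ((chartAt Plane p).target.indicator (chartCoef p m)) ∧
      HasCompactSupport ((chartAt Plane p).target.indicator (chartCoef p m)) := by
  refine contDiff_indicator (chartAt Plane p).open_target
    (hK.image_of_continuousOn ((chartAt Plane p).continuousOn.mono hKp)) ?_ (hm p) ?_
  · rintro _ ⟨x, hx, rfl⟩
    exact (chartAt Plane p).map_source (hKp hx)
  · intro y hy hyK
    rw [chartCoef, h0, zero_mul]
    exact fun h => hyK ⟨_, h, (chartAt Plane p).right_inv hy⟩

theorem TwoFormOfClass.integrableOn (hm : TwoFormOfClass n m) {K : Set S} (hK : IsCompact K) {p : S}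
    (hKp : K ⊆ (chartAt Plane p).source) (h0 : ∀ x ∉ K, m x = 0) :
    IntegrableOn (chartCoef p m) (chartAt Plane p).target := by
  obtain ⟨h1, h2⟩ := hm.indicator hK hKp h0
  rw [← integrable_indicator_iff (chartAt Plane p).open_target.measurableSet]
  exact h1.continuous.integrable_of_hasCompactSupport h2

/-- The pullback of a two-form by a differentiable map. -/
def pullbackTwoForm (f : S → S) (m : S → ℝ) (x : S) : ℝ := m (f x) * (tangentMapAt f x).det

/-- Change of variables in charts. -/
theorem setIntegral_chartCoef_pullback [OrientedAtlas S] {f : S → S} (hf : Function.Bijective f)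
    (hfc : Continuous f) (hfd : ∀ x, MDifferentiableAt (𝓡 2) (𝓡 2) f x)
    (hfo : ∀ x, 0 < (tangentMapAt f x).det) {A : Set S} (hA : IsOpen A) {p q : S}
    (hAq : A ⊆ (chartAt Plane q).source) (hAp : ∀ x, f x ∈ A → x ∈ (chartAt Plane p).source)
    (h0 : ∀ x ∉ A, m x = 0) :
    ∫ y in (chartAt Plane p).target, chartCoef p (pullbackTwoForm f m) y =
      ∫ y in (chartAt Plane q).target, chartCoef q m y := by
  set sp := (chartAt Plane p).symm with hsp
  set sq := (chartAt Plane q).symm with hsq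
  set B : Set Plane := (chartAt Plane p).target ∩ sp ⁻¹' (f ⁻¹' A) with hB
  have hBo : IsOpen B := sp.isOpen_inter_preimage (hA.preimage hfc)
  set F : Plane → Plane := fun y => chartAt Plane q (f (sp y)) with hF
  have hmaps : ∀ y ∈ B, F y ∈ (chartAt Plane q).target := fun y hy =>
    (chartAt Plane q).map_source (hAq hy.2)
  have hsF : ∀ y ∈ B, sq (F y) = f (sp y) := fun y hy => (chartAt Plane q).left_inv (hAq hy.2)
  have hdiff : ∀ y ∈ B, MDifferentiableAt (𝓡 2) (𝓡 2) F y := fun y hy =>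
    (mdifferentiableAt_chart (hAq hy.2)).comp y
      ((hfd (sp y)).comp y (mdifferentiableAt_chart_symm hy.1))
  have hF' : ∀ y ∈ B, HasFDerivAt F (fderiv ℝ F y) y := fun y hy =>
    (hdiff y hy).differentiableAt.hasFDerivAt
  -- Chain rule for the two factorisations of the same local map, f ∘ sp = sq ∘ F. It matches the
  -- coefficients of the two-form with the Jacobian of F and shows that this Jacobian is positive,
  -- so no absolute value survives in the change of variables.
  have hchain : ∀ y ∈ B, (chartDeriv q (F y)).det * (fderiv ℝ F y).det =
      (tangentMapAt f (sp y)).det * (chartDeriv p y).det := by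
    intro y hy
    rw [← det_comp_plane, ← det_comp_plane]
    congr 1
    have h1 := (mdifferentiableAt_chart_symm (hmaps y hy)).hasMFDerivAt.comp y
      (hF' y hy).hasMFDerivAt
    have h2 := (hfd (sp y)).hasMFDerivAt.comp y (mdifferentiableAt_chart_symm hy.1).hasMFDerivAt
    have h3 : (f ∘ sp) =ᶠ[𝓝 y] (sq ∘ F) := by
      filter_upwards [hBo.mem_nhds hy] with z hz using (hsF z hz).symm
    have h4 : (mfderiv (𝓡 2) (𝓡 2) (sq ∘ F) y : Plane →L[ℝ] Plane) =
      (mfderiv (𝓡 2) (𝓡 2) (f ∘ sp) y : Plane →L[ℝ] Plane) := (h3.mfderiv_eq).symm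
    exact (h1.mfderiv.symm.trans h4).trans h2.mfderiv
  have hdet : ∀ y ∈ B, 0 < (fderiv ℝ F y).det := by
    intro y hy
    have h1 := mul_pos (hfo (sp y)) (det_chartDeriv_pos hy.1)
    rw [← hchain y hy] at h1
    exact (pos_iff_pos_of_mul_pos h1).1 (det_chartDeriv_pos (hmaps y hy))
  have hinj : Set.InjOn F B := by
    intro y hy z hz hyz
    have h1 : f (sp y) = f (sp z) := by rw [← hsF y hy, ← hsF z hz, hyz]
    exact sp.injOn hy.1 hz.1 (hf.1 h1)
  have himg : F '' B = (chartAt Plane q).target ∩ sq ⁻¹' A := by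
    ext z
    constructor
    · rintro ⟨y, hy, rfl⟩
      refine ⟨hmaps y hy, ?_⟩
      rw [Set.mem_preimage, hsF y hy]
      exact hy.2
    · rintro ⟨hz, hzA⟩
      obtain ⟨x, hx⟩ := hf.2 (sq z)
      have hxp := hAp x (by rw [hx]; exact hzA)
      have e : sp (chartAt Plane p x) = x := (chartAt Plane p).left_inv hxp
      refine ⟨chartAt Plane p x, ⟨(chartAt Plane p).map_source hxp, ?_⟩, ?_⟩
      · rw [Set.mem_preimage, e, Set.mem_preimage, hx]
        exact hzA
      · simp only [hF]
        rw [e, hx]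
        exact (chartAt Plane q).right_inv hz
  have hR : ∫ y in (chartAt Plane q).target, chartCoef q m y = ∫ y in F '' B, chartCoef q m y := by
    rw [himg]
    refine setIntegral_eq_of_subset_of_forall_sdiff_eq_zero
      (chartAt Plane q).open_target.measurableSet Set.inter_subset_left fun y hy => ?_
    rw [chartCoef, h0, zero_mul]
    exact fun h => hy.2 ⟨hy.1, h⟩
  have hL : ∫ y in (chartAt Plane p).target, chartCoef p (pullbackTwoForm f m) y =
      ∫ y in B, chartCoef p (pullbackTwoForm f m) y := by
    refine setIntegral_eq_of_subset_of_forall_sdiff_eq_zero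
      (chartAt Plane p).open_target.measurableSet Set.inter_subset_left fun y hy => ?_
    rw [chartCoef, pullbackTwoForm, h0, zero_mul, zero_mul]
    exact fun h => hy.2 ⟨hy.1, h⟩
  rw [hR, hL, integral_image_eq_integral_abs_det_fderiv_smul volume hBo.measurableSet
    (fun y hy => (hF' y hy).hasFDerivWithinAt) hinj]
  refine setIntegral_congr_fun hBo.measurableSet fun y hy => ?_
  simp only [smul_eq_mul]
  rw [abs_of_pos (hdet y hy), chartCoef, chartCoef, pullbackTwoForm]
  change m (f (sp y)) * (tangentMapAt f (sp y)).det * _ = _ * (m (sq (F y)) * _)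
  rw [hsF y hy, mul_assoc, ← hchain y hy]
  ring

theorem pullbackTwoForm_id : pullbackTwoForm id m = m := by
  funext x
  have : tangentMapAt (id : S → S) x = ContinuousLinearMap.id ℝ Plane := mfderiv_id
  rw [pullbackTwoForm, this, det_id_plane, mul_one, id]

/-- The integral of a two-form supported in two charts does not depend on the chart. -/
theorem setIntegral_chartCoef_eq [OrientedAtlas S] {p q : S}
    (h0 : ∀ x, m x ≠ 0 → x ∈ (chartAt Plane p).source ∧ x ∈ (chartAt Plane q).source) :
    ∫ y in (chartAt Plane p).target, chartCoef p m y =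
      ∫ y in (chartAt Plane q).target, chartCoef q m y := by
  have := setIntegral_chartCoef_pullback (f := (id : S → S)) (m := m) Function.bijective_id
    continuous_id (fun x => mdifferentiableAt_id) (fun x => by
      rw [show tangentMapAt (id : S → S) x = ContinuousLinearMap.id ℝ Plane from mfderiv_id,
        det_id_plane]
      exact one_pos)
    ((chartAt Plane p).open_source.inter (chartAt Plane q).open_source) (p := p) (q := q)
    Set.inter_subset_right (fun x hx => hx.1)
    (fun x hx => by
      by_contra h
      exact hx (h0 x h))
  rwa [pullbackTwoForm_id] at this

variable [CompactSpace S] [T2Space S]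

/-- The integral of a two-form over the surface. -/
def integralTwoForm (m : S → ℝ) : ℝ :=
  ∑ᶠ p : S, ∫ y in (chartAt Plane p).target,
    chartPartition S p ((chartAt Plane p).symm y) * chartCoef p m y

theorem integralWedge_eq (η β : OneForm S) :
    integralWedge η β = integralTwoForm (wedge η β) := by
  simp only [integralWedge, integralTwoForm, wedgeCoeff_eq]

theorem tsupport_chartPartition_subset (p : S) :
    tsupport (chartPartition S p) ⊆ (chartAt Plane p).source :=
  Classical.choose_spec
    (SmoothPartitionOfUnity.exists_isSubordinate_chartAt_source (𝓡 2) S) p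

variable (S) in
-- By compactness only finitely many functions of the partition are nonzero, so a single finite
-- index set serves all two-forms.
theorem exists_integralTwoForm_eq_sum : ∃ J : Finset S,
    (∀ m : S → ℝ, integralTwoForm m = ∑ p ∈ J, ∫ y in (chartAt Plane p).target,
      chartCoef p (chartPartition S p * m) y) ∧ ∀ x, ∑ p ∈ J, chartPartition S p x = 1 := by
  have hfin := (chartPartition S).locallyFinite.finite_nonempty_of_compact
  refine ⟨hfin.toFinset, fun m => ?_, fun x => ?_⟩
  · have e : ∀ (p : S) (y : Plane), chartPartition S p ((chartAt Plane p).symm y) *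
      chartCoef p m y = chartCoef p (chartPartition S p * m) y := fun p y => (mul_assoc _ _ _).symm
    simp only [integralTwoForm, e]
    refine finsum_eq_sum_of_support_subset _ fun p hp => ?_
    simp only [Set.Finite.coe_toFinset, Set.mem_ofPred_eq]
    by_contra h
    refine hp ?_
    rw [Set.not_nonempty_iff_eq_empty, Function.support_eq_empty_iff] at h
    simp only [chartCoef, h, zero_mul, Pi.zero_apply, integral_zero]
  · rw [← (chartPartition S).sum_eq_one (Set.mem_univ x)]
    refine (finsum_eq_sum_of_support_subset _ fun i hi => ?_).symm
    simp only [Set.Finite.coe_toFinset, Set.mem_ofPred_eq]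
    exact ⟨x, hi⟩

theorem contMDiff_chartPartition (p : S) : ContMDiff (𝓡 2) 𝓘(ℝ, ℝ) n (chartPartition S p) :=
  (chartPartition S p).contMDiff.of_le (by exact_mod_cast le_top)

theorem integrableOn_chartCoef_partition (hm : TwoFormOfClass n m) (p : S) :
    IntegrableOn (chartCoef p (chartPartition S p * m)) (chartAt Plane p).target :=
  (hm.scale (contMDiff_chartPartition p)).integrableOn (isClosed_tsupport _).isCompact
    (tsupport_chartPartition_subset p) fun x hx => by
      rw [Pi.mul_apply, image_eq_zero_of_notMem_tsupport hx, zero_mul]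

theorem integralTwoForm_add (hm : TwoFormOfClass n m) (hm' : TwoFormOfClass n m') :
    integralTwoForm (m + m') = integralTwoForm m + integralTwoForm m' := by
  obtain ⟨J, hJ, -⟩ := exists_integralTwoForm_eq_sum S
  rw [hJ, hJ, hJ, ← Finset.sum_add_distrib]
  refine Finset.sum_congr rfl fun p _ => ?_
  rw [← integral_add (integrableOn_chartCoef_partition hm p)
    (integrableOn_chartCoef_partition hm' p)]
  congr 1
  funext y
  simp only [chartCoef, Pi.mul_apply, Pi.add_apply]
  ring

theorem integralTwoForm_smul (c : ℝ) (m : S → ℝ) :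
    integralTwoForm (c • m) = c * integralTwoForm m := by
  obtain ⟨J, hJ, -⟩ := exists_integralTwoForm_eq_sum S
  rw [hJ, hJ, Finset.mul_sum]
  refine Finset.sum_congr rfl fun p _ => ?_
  rw [← integral_const_mul]
  congr 1
  funext y
  simp only [chartCoef, Pi.mul_apply, Pi.smul_apply, smul_eq_mul]
  ring

theorem twoFormOfClass_zero : TwoFormOfClass n (0 : S → ℝ) := fun p =>
  (contDiffOn_const (c := (0 : ℝ))).congr fun y _ => by simp [chartCoef]

theorem integralTwoForm_zero : integralTwoForm (0 : S → ℝ) = 0 := by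
  have := integralTwoForm_smul (S := S) 0 0
  rwa [zero_smul, zero_mul] at this

theorem TwoFormOfClass.sum {t : Finset S} {k : S → S → ℝ} (h : ∀ i ∈ t, TwoFormOfClass n (k i)) :
    TwoFormOfClass n (∑ i ∈ t, k i) ∧
      integralTwoForm (∑ i ∈ t, k i) = ∑ i ∈ t, integralTwoForm (k i) := by
  classical
  induction t using Finset.induction_on with
  | empty => exact ⟨by simpa using twoFormOfClass_zero, by simpa using integralTwoForm_zero⟩
  | insert a t ha ih =>
    have h1 := ih fun i hi => h i (Finset.mem_insert_of_mem hi)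
    have h2 := h a (Finset.mem_insert_self a t)
    rw [Finset.sum_insert ha, Finset.sum_insert ha]
    exact ⟨h2.add h1.1, by rw [integralTwoForm_add h2 h1.1, h1.2]⟩

variable [OrientedAtlas S]

/-- The integral of a two-form supported in a chart. -/
theorem integralTwoForm_eq_setIntegral (hm : TwoFormOfClass n m) {K : Set S} (hK : IsCompact K)
    {p : S} (hKp : K ⊆ (chartAt Plane p).source) (h0 : ∀ x ∉ K, m x = 0) :
    integralTwoForm m = ∫ y in (chartAt Plane p).target, chartCoef p m y := by
  obtain ⟨J, hJ, hJ1⟩ := exists_integralTwoForm_eq_sum S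
  have hs : ∀ i : S, ∀ x ∉ K, (chartPartition S i * m) x = 0 := fun i x hx => by
    rw [Pi.mul_apply, h0 x hx, mul_zero]
  have e : ∀ i : S, ∫ y in (chartAt Plane i).target, chartCoef i (chartPartition S i * m) y =
      ∫ y in (chartAt Plane p).target, chartCoef p (chartPartition S i * m) y := by
    intro i
    refine setIntegral_chartCoef_eq fun x hx => ⟨?_, ?_⟩
    · refine tsupport_chartPartition_subset i (subset_tsupport _ ?_)
      exact left_ne_zero_of_mul hx
    · exact hKp (by_contra fun h => hx (hs i x h))
  rw [hJ]
  simp only [e]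
  rw [← integral_finsetSum _ fun i _ =>
    (hm.scale (contMDiff_chartPartition i)).integrableOn hK hKp (hs i)]
  congr 1
  funext y
  simp only [chartCoef, Pi.mul_apply]
  rw [← Finset.sum_mul, ← Finset.sum_mul, hJ1, one_mul]

/-- The integral is invariant under orientation-preserving diffeomorphisms. -/
theorem integralTwoForm_pullback {f : S → S} (hf : IsHomeomorph f)
    (hfd : ∀ x, MDifferentiableAt (𝓡 2) (𝓡 2) f x) (hfo : ∀ x, 0 < (tangentMapAt f x).det)
    (hm : TwoFormOfClass 0 m) (hfm : TwoFormOfClass 0 (pullbackTwoForm f m)) :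
    integralTwoForm (pullbackTwoForm f m) = integralTwoForm m := by
  choose k hk using hf.bijective.2
  -- The cover is chosen so that each piece of the partition is supported in one chart and its
  -- preimage under f in one chart as well; the change of variables in charts then applies piece by
  -- piece.
  let U : S → Set S := fun x => (chartAt Plane x).source ∩ f '' (chartAt Plane (k x)).source
  obtain ⟨χ, t, hχ, hχU, hχ1⟩ := exists_finite_partition (U := U)
    (fun x => (chartAt Plane x).open_source.inter
      (hf.isOpenMap _ (chartAt Plane (k x)).open_source))
    (fun x => ⟨mem_chart_source _ x, k x, mem_chart_source _ _, hk x⟩)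
  have hχ0 : ∀ i, ContMDiff (𝓡 2) 𝓘(ℝ, ℝ) ((0 : ℕ∞) : ℕ∞ω) (χ i) :=
    fun i => (hχ i).of_le (by exact_mod_cast le_top)
  have hχf : ∀ i, ContMDiff (𝓡 2) 𝓘(ℝ, ℝ) ((0 : ℕ∞) : ℕ∞ω) (χ i ∘ f) := fun i =>
    contMDiff_zero_iff.2 ((hχ i).continuous.comp hf.continuous)
  have e1 : m = ∑ i ∈ t, χ i * m := by
    rw [← Finset.sum_mul]
    funext x
    rw [Pi.mul_apply, Finset.sum_apply, hχ1, one_mul]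
  have e2 : pullbackTwoForm f m = ∑ i ∈ t, (χ i ∘ f) * pullbackTwoForm f m := by
    rw [← Finset.sum_mul]
    funext x
    rw [Pi.mul_apply, Finset.sum_apply]
    simp only [Function.comp_apply, hχ1, one_mul]
  rw [e2, (TwoFormOfClass.sum fun i _ => hfm.scale (hχf i)).2]
  conv_rhs => rw [e1, (TwoFormOfClass.sum fun i _ => hm.scale (hχ0 i)).2]
  refine Finset.sum_congr rfl fun i _ => ?_
  have hsrc : ∀ x, f x ∈ U i → x ∈ (chartAt Plane (k i)).source := by
    rintro x ⟨-, z, hz, hzx⟩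
    rwa [← hf.bijective.1 hzx]
  rw [integralTwoForm_eq_setIntegral (hm.scale (hχ0 i)) (isClosed_tsupport (χ i)).isCompact
      ((hχU i).trans Set.inter_subset_left)
      (fun x hx => by rw [Pi.mul_apply, image_eq_zero_of_notMem_tsupport hx, zero_mul]),
    integralTwoForm_eq_setIntegral (hfm.scale (hχf i)) (p := k i)
      ((isClosed_tsupport (χ i)).preimage hf.continuous).isCompact
      (fun x hx => hsrc x (hχU i hx))
      (fun x hx => by
        rw [Pi.mul_apply, Function.comp_apply, image_eq_zero_of_notMem_tsupport hx, zero_mul])]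
  rw [← setIntegral_chartCoef_pullback hf.bijective hf.continuous hfd hfo (A := U i) (p := k i)
    ((chartAt Plane i).open_source.inter (hf.isOpenMap _ (chartAt Plane (k i)).open_source))
    Set.inter_subset_left hsrc (m := χ i * m) (fun x hx => by
      rw [Pi.mul_apply, image_eq_zero_of_notMem_tsupport fun h => hx (hχU i h), zero_mul])]
  congr 1
  funext y
  simp only [chartCoef, pullbackTwoForm, Pi.mul_apply, Function.comp_apply]
  ring

end Integration

end

noncomputable section

/-! ### Stokes' theorem and exact two-forms -/

section Exactness

open MeasureTheory

variable {S : Type u} [TopologicalSpace S] [ChartedSpace Plane S] [IsManifold (𝓡 2) ∞ S]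
  {θ θ' η : OneForm S} {m m' : S → ℝ}

theorem formOfClass_zero {n : ℕ∞} : FormOfClass n (0 : OneForm S) := fun _ =>
  (contDiffOn_const (c := (0 : Plane →L[ℝ] ℝ))).congr fun _ _ =>
    ContinuousLinearMap.zero_comp _

theorem hasExteriorDeriv_zero : HasExteriorDeriv (0 : OneForm S) 0 := by
  refine ⟨formOfClass_zero, fun p y _ => ?_⟩
  have e : chartForm p (0 : OneForm S) = fun _ => 0 :=
    funext fun y => ContinuousLinearMap.zero_comp _
  rw [e]
  simp [chartCoef]

theorem HasExteriorDeriv.sum {t : Finset S} {τ : S → OneForm S} {k : S → S → ℝ}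
    (h : ∀ i ∈ t, HasExteriorDeriv (τ i) (k i)) :
    HasExteriorDeriv (∑ i ∈ t, τ i) (∑ i ∈ t, k i) := by
  classical
  induction t using Finset.induction_on with
  | empty => simpa using hasExteriorDeriv_zero
  | insert a t ha ih =>
    rw [Finset.sum_insert ha, Finset.sum_insert ha]
    exact (h a (Finset.mem_insert_self a t)).add (ih fun i hi => h i (Finset.mem_insert_of_mem hi))

theorem HasExteriorDeriv.sub (h : HasExteriorDeriv θ m) (h' : HasExteriorDeriv θ' m') :
    HasExteriorDeriv (θ - θ') (m - m') := by
  have := h.add (h'.const_smul (-1))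
  have e : θ - θ' = θ + (-1 : ℝ) • θ' := by rw [sub_eq_add_neg, ← neg_one_smul ℝ θ']
  rwa [neg_one_smul ℝ m', ← sub_eq_add_neg, ← e] at this

theorem TwoFormOfClass.sub {n : ℕ∞} (h : TwoFormOfClass n m) (h' : TwoFormOfClass n m') :
    TwoFormOfClass n (m - m') := by
  have := h.add (h'.const_smul (-1))
  rwa [neg_one_smul, ← sub_eq_add_neg] at this

theorem dForm_eq_zero_of_eventuallyEq {u : S → ℝ} {x : S} {c : ℝ} (h : ∀ᶠ z in 𝓝 x, u z = c) :
    dForm u x = 0 := by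
  have h' : u =ᶠ[𝓝 x] fun _ => c := h
  exact h'.mfderiv_eq.trans mfderiv_const

theorem wedge_eq_zero_left {η β : OneForm S} {x : S} (h : η x = 0) : wedge η β x = 0 := by
  rw [wedge, show formAt η x = 0 from h, wedgeAt]
  simp

theorem wedge_eq_zero_right {η β : OneForm S} {x : S} (h : β x = 0) : wedge η β x = 0 := by
  rw [wedge, show formAt β x = 0 from h, wedgeAt]
  simp

theorem eq_of_chartCoef_eq [OrientedAtlas S] {p : S} {y : Plane}
    (hy : y ∈ (chartAt Plane p).target) (h : chartCoef p m y = chartCoef p m' y) :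
    m ((chartAt Plane p).symm y) = m' ((chartAt Plane p).symm y) :=
  mul_right_cancel₀ (det_chartDeriv_pos hy).ne' h

theorem HasExteriorDeriv.eq_zero [OrientedAtlas S] (h : HasExteriorDeriv θ m) {K : Set S}
    (hK : IsClosed K) (h0 : ∀ x ∉ K, θ x = 0) {x : S} (hx : x ∉ K) : m x = 0 := by
  have hy := mem_chart_target Plane x
  have hinv := (chartAt Plane x).left_inv (mem_chart_source Plane x)
  have ev : chartForm x θ =ᶠ[𝓝 (chartAt Plane x x)] fun _ => 0 := by
    have : ∀ᶠ y in 𝓝 (chartAt Plane x x), (chartAt Plane x).symm y ∉ K :=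
      ((chartAt Plane x).continuousAt_symm hy).eventually
        (hK.isOpen_compl.mem_nhds (by rwa [hinv]))
    filter_upwards [this] with y hyK
    rw [chartForm, show formAt θ ((chartAt Plane x).symm y) = 0 from h0 _ hyK,
      ContinuousLinearMap.zero_comp]
  have e := h.2 x _ hy
  rw [ev.fderiv_eq] at e
  have := eq_of_chartCoef_eq (m := m) (m' := 0) hy (by rw [← e]; simp [chartCoef])
  rwa [hinv] at this

variable [CompactSpace S] [T2Space S] [OrientedAtlas S]

/-- In the chart the integrand is ∂₀w₁ - ∂₁w₀ with w₀, w₁ of class C¹ and compactly supported in the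
plane, and each partial derivative integrates to zero. -/
theorem HasExteriorDeriv.integral_eq_zero_of_support (h : HasExteriorDeriv θ m) {K : Set S}
    (hK : IsCompact K) {p : S} (hKp : K ⊆ (chartAt Plane p).source) (h0 : ∀ x ∉ K, θ x = 0) :
    integralTwoForm m = 0 := by
  rw [integralTwoForm_eq_setIntegral h.twoFormOfClass hK hKp
    fun x hx => h.eq_zero hK.isClosed h0 hx]
  set T := (chartAt Plane p).target with hT
  have hTo : IsOpen T := (chartAt Plane p).open_target
  set C := chartAt Plane p '' K with hC
  have hCc : IsCompact C := hK.image_of_continuousOn ((chartAt Plane p).continuousOn.mono hKp)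
  have hCT : C ⊆ T := by
    rintro _ ⟨x, hx, rfl⟩
    exact (chartAt Plane p).map_source (hKp hx)
  have hC0 : ∀ i : Fin 2, ∀ y ∈ T, y ∉ C → chartForm p θ y (basisVec i) = 0 := by
    intro i y hy hyC
    rw [chartForm, show formAt θ ((chartAt Plane p).symm y) = 0 from
      h0 _ fun hk => hyC ⟨_, hk, (chartAt Plane p).right_inv hy⟩, ContinuousLinearMap.zero_comp]
    rfl
  let w : Fin 2 → Plane → ℝ := fun i => T.indicator fun y => chartForm p θ y (basisVec i)
  have hw : ∀ i, ContDiff ℝ 1 (w i) ∧ HasCompactSupport (w i) := fun i =>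
    contDiff_indicator (n := 1) hTo hCc hCT ((h.1 p).clm_apply contDiffOn_const) (hC0 i)
  have hwT : ∀ i j, ∀ y ∈ T, fderiv ℝ (w i) y (basisVec j) =
      fderiv ℝ (chartForm p θ) y (basisVec j) (basisVec i) := by
    intro i j y hy
    have ev : w i =ᶠ[𝓝 y] fun y => chartForm p θ y (basisVec i) := by
      filter_upwards [hTo.mem_nhds hy] with z hz
      exact Set.indicator_of_mem hz _
    rw [ev.fderiv_eq]
    have := (h.1.differentiableAt hy).hasFDerivAt.clm_apply (hasFDerivAt_const (basisVec i) y)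
    rw [this.fderiv]
    simp
  have hwC : ∀ i j, ∀ y ∉ T, fderiv ℝ (w i) y (basisVec j) = 0 := by
    intro i j y hy
    have ev : w i =ᶠ[𝓝 y] fun _ => 0 := by
      filter_upwards [hCc.isClosed.isOpen_compl.mem_nhds fun hyC => hy (hCT hyC)] with z hz
      by_cases hzT : z ∈ T
      · exact (Set.indicator_of_mem hzT _).trans (hC0 i z hzT hz)
      · exact Set.indicator_of_notMem hzT _
    rw [ev.fderiv_eq]
    simp
  have h_int : ∀ i j, Integrable fun y => fderiv ℝ (w i) y (basisVec j) := fun i j =>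
    (((hw i).1.continuous_fderiv (by norm_num)).clm_apply
      continuous_const).integrable_of_hasCompactSupport ((hw i).2.fderiv_apply ℝ _)
  calc ∫ y in T, chartCoef p m y
      = ∫ y in T, (fderiv ℝ (w 1) y (basisVec 0) - fderiv ℝ (w 0) y (basisVec 1)) := by
        refine setIntegral_congr_fun hTo.measurableSet fun y hy => ?_
        simp only [hwT 1 0 y hy, hwT 0 1 y hy, h.2 p y hy]
    _ = ∫ y, (fderiv ℝ (w 1) y (basisVec 0) - fderiv ℝ (w 0) y (basisVec 1)) :=
        setIntegral_eq_integral_of_forall_compl_eq_zero fun y hy => by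
          rw [hwC 1 0 y hy, hwC 0 1 y hy, sub_zero]
    _ = 0 := by
        rw [integral_sub (h_int 1 0) (h_int 0 1), integral_fderiv_eq_zero (hw 1).1 (hw 1).2,
          integral_fderiv_eq_zero (hw 0).1 (hw 0).2, sub_zero]

/-- Stokes' theorem on a closed surface. -/
theorem HasExteriorDeriv.integral_eq_zero (h : HasExteriorDeriv θ m) : integralTwoForm m = 0 := by
  obtain ⟨χ, t, hχ, hχU, hχ1⟩ := exists_finite_partition (S := S)
    (fun x => (chartAt Plane x).open_source) (fun x => mem_chart_source _ x)
  have hi : ∀ i ∈ t, HasExteriorDeriv (scaleForm (χ i) θ) (wedge (dForm (χ i)) θ + χ i * m) :=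
    fun i _ => h.scale ((hχ i).of_le (by exact_mod_cast le_top))
  have hs : ∑ i ∈ t, scaleForm (χ i) θ = θ := by
    funext x
    rw [Finset.sum_apply]
    change ∑ i ∈ t, χ i x • θ x = θ x
    rw [← Finset.sum_smul, hχ1, one_smul]
  have hsum := HasExteriorDeriv.sum hi
  rw [hs] at hsum
  -- Uniqueness of the exterior derivative identifies m with the sum of the d(χᵢθ), each covered by
  -- the case of a form supported in a chart.
  rw [h.unique hsum, (TwoFormOfClass.sum fun i hit => (hi i hit).twoFormOfClass).2]
  refine Finset.sum_eq_zero fun i hit => ?_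
  refine (hi i hit).integral_eq_zero_of_support (isClosed_tsupport (χ i)).isCompact (hχU i)
    fun x hx => ?_
  change χ i x • θ x = 0
  rw [image_eq_zero_of_notMem_tsupport hx, zero_smul]

/-- Functions defined near a closed set can be extended after shrinking their domain. -/
theorem exists_global_extension {n : ℕ∞} {K U : Set S} (hK : IsClosed K) (hU : IsOpen U)
    (hKU : K ⊆ U) {g : S → ℝ} (hg : ∀ x ∈ U, ContMDiffAt (𝓡 2) 𝓘(ℝ, ℝ) n g x) :
    ∃ k : S → ℝ, ContMDiff (𝓡 2) 𝓘(ℝ, ℝ) n k ∧ ∀ x ∈ K, k =ᶠ[𝓝 x] g := by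
  obtain ⟨ψ, h0, h1, -⟩ := exists_contMDiffMap_zero_one_nhds_of_isClosed (𝓡 2) (n := n)
    hU.isClosed_compl hK (Set.disjoint_left.2 fun x hx hxK => hx (hKU hxK))
  refine ⟨fun x => ψ x * g x, fun x => contMDiffAt_mul_of_tsupport ψ.contMDiff fun hx => hg x ?_,
    fun x hx => ?_⟩
  · by_contra hxU
    exact (notMem_tsupport_iff_eventuallyEq.2 (nhds_le_nhdsSet hxU h0)) hx
  · filter_upwards [(nhds_le_nhdsSet hx) h1] with z hz
    have hz' : ψ z = 1 := hz
    rw [hz', one_mul]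

/-- A function on the plane, supported in the target of a chart, as a function on the surface. -/
def chartFun (p : S) (w : Plane → ℝ) : S → ℝ :=
  (chartAt Plane p).source.indicator fun x => w (chartAt Plane p x)

theorem chartFun_symm {p : S} (w : Plane → ℝ) {y : Plane} (hy : y ∈ (chartAt Plane p).target) :
    chartFun p w ((chartAt Plane p).symm y) = w y := by
  rw [chartFun, Set.indicator_of_mem ((chartAt Plane p).map_target hy),
    (chartAt Plane p).right_inv hy]

theorem chartFun_eq_zero {p : S} {w : Plane → ℝ} {C : Set Plane} (h0 : ∀ y ∉ C, w y = 0) {x : S}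
    (hx : x ∉ (chartAt Plane p).symm '' C) : chartFun p w x = 0 := by
  by_cases hxs : x ∈ (chartAt Plane p).source
  · rw [chartFun, Set.indicator_of_mem hxs]
    exact h0 _ fun h => hx ⟨_, h, (chartAt Plane p).left_inv hxs⟩
  · exact Set.indicator_of_notMem hxs _

theorem isCompact_symm_image {p : S} {C : Set Plane} (hC : IsCompact C)
    (hCT : C ⊆ (chartAt Plane p).target) : IsCompact ((chartAt Plane p).symm '' C) :=
  hC.image_of_continuousOn ((chartAt Plane p).continuousOn_symm.mono hCT)

theorem symm_image_subset {p : S} {C : Set Plane} (hCT : C ⊆ (chartAt Plane p).target) :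
    (chartAt Plane p).symm '' C ⊆ (chartAt Plane p).source := by
  rintro _ ⟨y, hy, rfl⟩
  exact (chartAt Plane p).map_target (hCT hy)

theorem contMDiff_chartFun {n : ℕ∞} {p : S} {w : Plane → ℝ} (hw : ContDiff ℝ n w) {C : Set Plane}
    (hC : IsCompact C) (hCT : C ⊆ (chartAt Plane p).target) (h0 : ∀ y ∉ C, w y = 0) :
    ContMDiff (𝓡 2) 𝓘(ℝ, ℝ) n (chartFun p w) := by
  intro x
  by_cases hx : x ∈ (chartAt Plane p).source
  · have hc : ContMDiffAt (𝓡 2) (𝓡 2) n (chartAt Plane p) x :=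
      ((show ContMDiffOn (𝓡 2) (𝓡 2) ∞ (chartAt Plane p) _ from contMDiffOn_chart).contMDiffAt
        ((chartAt Plane p).open_source.mem_nhds hx)).of_le (by exact_mod_cast le_top)
    refine (hw.contDiffAt.contMDiffAt.comp x hc).congr_of_eventuallyEq ?_
    filter_upwards [(chartAt Plane p).open_source.mem_nhds hx] with z hz
    exact Set.indicator_of_mem hz _
  · refine (contMDiffAt_const (c := (0 : ℝ))).congr_of_eventuallyEq ?_
    filter_upwards [(isCompact_symm_image hC hCT).isClosed.isOpen_compl.mem_nhds
      fun h => hx (symm_image_subset hCT h)] with z hz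
    exact chartFun_eq_zero h0 hz

theorem chartForm_dForm_chartFun {p : S} {w : Plane → ℝ} (hw : ContDiff ℝ 1 w) {C : Set Plane}
    (hC : IsCompact C) (hCT : C ⊆ (chartAt Plane p).target) (h0 : ∀ y ∉ C, w y = 0) {y : Plane}
    (hy : y ∈ (chartAt Plane p).target) :
    chartForm p (dForm (chartFun p w)) y = fderiv ℝ w y := by
  rw [chartForm_dForm hy ((contMDiff_chartFun (n := 1) hw hC hCT h0).contMDiffAt.mdifferentiableAt
    (by simp))]
  refine Filter.EventuallyEq.fderiv_eq ?_
  filter_upwards [(chartAt Plane p).open_target.mem_nhds hy] with z hz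
  exact chartFun_symm w hz

/-- Coordinate functions of a chart, extended to the surface away from a compact set. -/
theorem exists_coordinates {p : S} {C : Set Plane} (hC : IsCompact C)
    (hCT : C ⊆ (chartAt Plane p).target) (i : Fin 2) : ∃ k : S → ℝ,
    ContMDiff (𝓡 2) 𝓘(ℝ, ℝ) ∞ k ∧ ∀ y ∈ C, ∀ v, chartForm p (dForm k) y v = v i := by
  obtain ⟨k, hk, hkK⟩ := exists_global_extension (n := ⊤) (g := fun x => chartAt Plane p x i)
    (isCompact_symm_image hC hCT).isClosed (chartAt Plane p).open_source (symm_image_subset hCT)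
    (fun x hx => by
      have hc : ContMDiffAt (𝓡 2) (𝓡 2) ∞ (chartAt Plane p) x :=
        (show ContMDiffOn (𝓡 2) (𝓡 2) ∞ (chartAt Plane p) _ from contMDiffOn_chart).contMDiffAt
          ((chartAt Plane p).open_source.mem_nhds hx)
      have hpr : ContDiff ℝ ∞ fun y : Plane => y i := by fun_prop
      exact hpr.contDiffAt.contMDiffAt.comp x hc)
  refine ⟨k, hk, fun y hy v => ?_⟩
  rw [chartForm_dForm (hCT hy) (hk.contMDiffAt.mdifferentiableAt (by simp))]
  have ev : (fun y => k ((chartAt Plane p).symm y)) =ᶠ[𝓝 y]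
      (EuclideanSpace.proj i : Plane →L[ℝ] ℝ) := by
    filter_upwards [((chartAt Plane p).continuousAt_symm (hCT hy)).eventually (hkK _ ⟨y, hy, rfl⟩),
      (chartAt Plane p).open_target.mem_nhds (hCT hy)] with z hz hzT
    rw [hz, (chartAt Plane p).right_inv hzT]
    rfl
  rw [ev.fderiv_eq, ContinuousLinearMap.fderiv]
  rfl

/-- A two-form of integral zero supported in a square is the exterior derivative of a one-form
supported in the square. -/
theorem exists_exteriorDeriv_of_square {p : S} {c : Plane} {r : ℝ} (hr : 0 < r)
    (hcT : closedSquare c r ⊆ (chartAt Plane p).target) (hm : TwoFormOfClass 1 m)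
    (h0 : ∀ x ∉ (chartAt Plane p).symm '' closedSquare c r, m x = 0)
    (h_int : integralTwoForm m = 0) :
    ∃ θ, HasExteriorDeriv θ m ∧ ∀ x ∉ (chartAt Plane p).symm '' closedSquare c r, θ x = 0 := by
  have hC := isCompact_closedSquare c hr.le
  set K := (chartAt Plane p).symm '' closedSquare c r with hK
  have hKc : IsCompact K := isCompact_symm_image hC hcT
  have hKs : K ⊆ (chartAt Plane p).source := symm_image_subset hcT
  obtain ⟨hv, -⟩ := hm.indicator hKc hKs h0
  rw [integralTwoForm_eq_setIntegral hm hKc hKs h0,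
    ← integral_indicator (chartAt Plane p).open_target.measurableSet] at h_int
  obtain ⟨P, Q, hP, hQ, hP0, hQ0, hPQ⟩ := exists_divergence_primitive hv hr (c := c)
    (fun y hy => by
      by_cases hyT : y ∈ (chartAt Plane p).target
      · rw [Set.indicator_of_mem hyT, chartCoef, h0, zero_mul]
        rintro ⟨z, hz, hzy⟩
        exact hy (by rwa [← (chartAt Plane p).symm.injOn (hcT hz) hyT hzy])
      · exact Set.indicator_of_notMem hyT _) h_int
  obtain ⟨k₀, hk₀, hk₀C⟩ := exists_coordinates hC hcT 0
  obtain ⟨k₁, hk₁, hk₁C⟩ := exists_coordinates hC hcT 1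
  have hclosed : ∀ {k : S → ℝ}, ContMDiff (𝓡 2) 𝓘(ℝ, ℝ) ∞ k → HasExteriorDeriv (dForm k) 0 :=
    fun {k} hk => IsClosedForm.hasExteriorDeriv fun x =>
      ⟨k, Filter.Eventually.of_forall fun y => ⟨(hk.of_le two_le_infty).contMDiffAt, fun _ => rfl⟩⟩
  have hQm := contMDiff_chartFun (n := 1) hQ hC hcT hQ0
  have hPm := contMDiff_chartFun (n := 1) hP hC hcT hP0
  have key := ((hclosed hk₁).scale hQm).sub ((hclosed hk₀).scale hPm)
  -- The form Q dy₀-free part and P part are combined as Q dy₁ - P dy₀, whose exterior derivative is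
  -- (∂₀Q + ∂₁P) dy₀ ∧ dy₁. The extended coordinates k₀, k₁ matter only on the square, since P and Q
  -- vanish outside it.
  refine ⟨scaleForm (chartFun p Q) (dForm k₁) - scaleForm (chartFun p P) (dForm k₀), ?_, ?_⟩
  · convert key using 1
    funext x
    simp only [mul_zero, add_zero, Pi.sub_apply]
    by_cases hx : x ∈ K
    · obtain ⟨y, hy, rfl⟩ := hx
      have e : ∀ k k' : S → ℝ, chartCoef p (k - k') y = chartCoef p k y - chartCoef p k' y :=
        fun k k' => sub_mul _ _ _
      refine eq_of_chartCoef_eq (m' := wedge (dForm (chartFun p Q)) (dForm k₁) -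
        wedge (dForm (chartFun p P)) (dForm k₀)) (hcT hy) ?_
      rw [e, chartCoef_wedge, chartCoef_wedge, wedgeAt, wedgeAt,
        chartForm_dForm_chartFun hQ hC hcT hQ0 (hcT hy),
        chartForm_dForm_chartFun hP hC hcT hP0 (hcT hy)]
      simp only [hk₀C y hy, hk₁C y hy]
      have := hPQ y
      rw [Set.indicator_of_mem (hcT hy)] at this
      rw [← this]
      simp [basisVec]
    · rw [h0 x hx]
      have hz : ∀ {w : Plane → ℝ}, (∀ y ∉ closedSquare c r, w y = 0) →
          dForm (chartFun p w) x = 0 := fun {w} hw0 =>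
        dForm_eq_zero_of_eventuallyEq (c := 0) (by
          filter_upwards [hKc.isClosed.isOpen_compl.mem_nhds hx] with z hz
          exact chartFun_eq_zero hw0 hz)
      rw [wedge_eq_zero_left (hz hQ0), wedge_eq_zero_left (hz hP0), sub_zero]
  · intro x hx
    change chartFun p Q x • dForm k₁ x - chartFun p P x • dForm k₀ x = 0
    rw [chartFun_eq_zero hQ0 hx, chartFun_eq_zero hP0 hx, zero_smul, zero_smul, sub_zero]

end Exactness

end

noncomputable section

/-! ### Two-forms of integral zero are exact -/

section TopDegree

open MeasureTheory

variable {S : Type u} [TopologicalSpace S] [ChartedSpace Plane S]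

/-- A closed square in the domain of a chart. -/
def IsChartSquare (B : Set S) : Prop :=
  ∃ (p : S) (c : Plane) (r : ℝ), 0 < r ∧ closedSquare c r ⊆ (chartAt Plane p).target ∧
    B = (chartAt Plane p).symm '' closedSquare c r

variable [IsManifold (𝓡 2) ∞ S] [CompactSpace S] [T2Space S]

theorem IsChartSquare.isCompact {B : Set S} (hB : IsChartSquare B) : IsCompact B := by
  obtain ⟨p, c, r, hr, hT, rfl⟩ := hB
  exact (isCompact_closedSquare c hr.le).image_of_continuousOn
    ((chartAt Plane p).continuousOn_symm.mono hT)

theorem exists_chartSquare {x : S} {W : Set S} (hW : W ∈ 𝓝 x) :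
    ∃ B, IsChartSquare B ∧ B ∈ 𝓝 x ∧ B ⊆ W := by
  obtain ⟨R, hR, hT, hRW⟩ := exists_chart_ball hW
  -- A square of half-side R/4 lies in the closed ball of radius R/2, hence in the open ball of
  -- radius R.
  have hsub : closedSquare (chartAt Plane x x) (R / 4) ⊆ Metric.ball (chartAt Plane x x) R :=
    (closedSquare_subset_closedBall _ (by linarith)).trans
      (Metric.closedBall_subset_ball (by linarith))
  refine ⟨_, ⟨x, _, R / 4, by linarith, hsub.trans hT, rfl⟩, ?_, ?_⟩
  · have h1 := ((chartAt Plane x).continuousAt (mem_chart_source Plane x)).eventually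
      (closedSquare_mem_nhds (chartAt Plane x x) (r := R / 4) (by linarith))
    filter_upwards [h1, (chartAt Plane x).open_source.mem_nhds (mem_chart_source Plane x)]
      with z hz hzs
    exact ⟨_, hz, (chartAt Plane x).left_inv hzs⟩
  · rintro _ ⟨y, hy, rfl⟩
    exact hRW y (hsub hy)

/-- A two-form of integral one supported in `B`. -/
def IsBump (δ : S → ℝ) (B : Set S) : Prop :=
  TwoFormOfClass 1 δ ∧ (∀ x ∉ B, δ x = 0) ∧ integralTwoForm δ = 1

theorem IsBump.mono {δ : S → ℝ} {B B' : Set S} (h : IsBump δ B) (hB : B ⊆ B') : IsBump δ B' :=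
  ⟨h.1, fun x hx => h.2.1 x fun hxB => hx (hB hxB), h.2.2⟩

theorem integralTwoForm_sub {n : ℕ∞} {m m' : S → ℝ} (hm : TwoFormOfClass n m)
    (hm' : TwoFormOfClass n m') :
    integralTwoForm (m - m') = integralTwoForm m - integralTwoForm m' := by
  have := integralTwoForm_add hm (hm'.const_smul (-1))
  rw [integralTwoForm_smul, neg_one_smul, ← sub_eq_add_neg] at this
  rw [this]
  ring

variable [OrientedAtlas S]

/-- A normalised bump w of the plane gives w dk₀ ∧ dk₁, where k₀, k₁ extend the chart coordinates,
so that dk₀ ∧ dk₁ has coefficient 1 on the square. -/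
theorem IsChartSquare.exists_bump {B : Set S} (hB : IsChartSquare B) : ∃ δ, IsBump δ B := by
  obtain ⟨p, c, r, hr, hT, rfl⟩ := hB
  have hC := isCompact_closedSquare c hr.le
  let bump : ContDiffBump c := ⟨r / 2, r, by linarith, by linarith⟩
  let w : Plane → ℝ := bump.normed volume
  have hw : ContDiff ℝ 1 w := bump.contDiff_normed
  have hw1 : ∫ y, w y = 1 := bump.integral_normed
  have hw0 : ∀ y ∉ closedSquare c r, w y = 0 := by
    intro y hy
    have : y ∉ Function.support w := by
      rw [bump.support_normed_eq]
      refine fun h => hy fun i => ?_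
      have h1 := PiLp.norm_apply_le (y - c) i
      rw [Metric.mem_ball, dist_eq_norm] at h
      exact (h1.trans h.le)
    simpa using this
  obtain ⟨k₀, hk₀, hk₀C⟩ := exists_coordinates hC hT 0
  obtain ⟨k₁, hk₁, hk₁C⟩ := exists_coordinates hC hT 1
  have hcls : ∀ {k : S → ℝ}, ContMDiff (𝓡 2) 𝓘(ℝ, ℝ) ∞ k → FormOfClass 1 (dForm k) :=
    fun hk => formOfClass_dForm (hk.of_le (by exact_mod_cast le_top))
  have hcl : TwoFormOfClass 1 (chartFun p w * wedge (dForm k₀) (dForm k₁)) :=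
    ((hcls hk₀).wedge (hcls hk₁)).scale (contMDiff_chartFun (n := 1) hw hC hT hw0)
  have h0 : ∀ x ∉ (chartAt Plane p).symm '' closedSquare c r,
      (chartFun p w * wedge (dForm k₀) (dForm k₁)) x = 0 := fun x hx => by
    rw [Pi.mul_apply, chartFun_eq_zero hw0 hx, zero_mul]
  refine ⟨_, hcl, h0, ?_⟩
  rw [integralTwoForm_eq_setIntegral hcl (isCompact_symm_image hC hT) (symm_image_subset hT) h0,
    ← hw1, ← setIntegral_eq_integral_of_forall_compl_eq_zero (s := (chartAt Plane p).target)
      fun y hy => hw0 y fun h => hy (hT h)]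
  refine setIntegral_congr_fun (chartAt Plane p).open_target.measurableSet fun y hy => ?_
  have e : chartCoef p (chartFun p w * wedge (dForm k₀) (dForm k₁)) y =
      w y * chartCoef p (wedge (dForm k₀) (dForm k₁)) y := by
    rw [← chartFun_symm w hy]
    exact mul_assoc _ _ _
  refine e.trans ?_
  by_cases hyC : y ∈ closedSquare c r
  · rw [chartCoef_wedge, wedgeAt]
    simp [hk₀C y hyC, hk₁C y hyC, basisVec]
  · rw [hw0 y hyC, zero_mul]

theorem IsChartSquare.exists_exteriorDeriv {B : Set S} (hB : IsChartSquare B) {m : S → ℝ}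
    (hm : TwoFormOfClass 1 m) (h0 : ∀ x ∉ B, m x = 0) (h_int : integralTwoForm m = 0) :
    ∃ θ, HasExteriorDeriv θ m ∧ ∀ x ∉ B, θ x = 0 := by
  obtain ⟨p, c, r, hr, hT, rfl⟩ := hB
  exact exists_exteriorDeriv_of_square hr hT hm h0 h_int

theorem IsBump.exists_exteriorDeriv {B : Set S} (hB : IsChartSquare B) {δ δ' : S → ℝ}
    (h : IsBump δ B) (h' : IsBump δ' B) :
    ∃ θ, HasExteriorDeriv θ (δ - δ') ∧ ∀ x ∉ B, θ x = 0 :=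
  hB.exists_exteriorDeriv (h.1.sub h'.1)
    (fun x hx => by rw [Pi.sub_apply, h.2.1 x hx, h'.2.1 x hx, sub_zero])
    (by rw [integralTwoForm_sub h.1 h'.1, h.2.2, h'.2.2, sub_self])

/-- Any two bumps are cohomologous. -/
theorem IsBump.exists_exteriorDeriv_of_connected [ConnectedSpace S] {B : S → Set S}
    (hB : ∀ x, IsChartSquare (B x)) (hBx : ∀ x, B x ∈ 𝓝 x) {δ : S → S → ℝ}
    (hδ : ∀ x, IsBump (δ x) (B x)) (x z : S) : ∃ θ, HasExteriorDeriv θ (δ x - δ z) := by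
  refine isPreconnected_univ.induction₂ (fun x z => ∃ θ, HasExteriorDeriv θ (δ x - δ z))
    (fun x _ => ?_) (fun x y z _ _ _ => ?_) (fun x y _ _ => ?_) (Set.mem_univ x) (Set.mem_univ z)
  · rw [nhdsWithin_univ]
    filter_upwards [eventually_mem_nhds_iff.2 (hBx x)] with z hz
    -- For z near x the squares around x and z share a smaller square. A bump in it differs from
    -- either of the two given bumps by an exact form, since each difference has zero integral in a
    -- single square.
    obtain ⟨C, hC, -, hCs⟩ := exists_chartSquare (Filter.inter_mem hz (hBx z))
    obtain ⟨e, he⟩ := hC.exists_bump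
    obtain ⟨θ₁, h₁, -⟩ := (hδ x).exists_exteriorDeriv (hB x)
      (he.mono (hCs.trans Set.inter_subset_left))
    obtain ⟨θ₂, h₂, -⟩ := (he.mono (hCs.trans Set.inter_subset_right)).exists_exteriorDeriv (hB z)
      (hδ z)
    exact ⟨θ₁ + θ₂, by simpa using h₁.add h₂⟩
  · rintro ⟨θ₁, h₁⟩ ⟨θ₂, h₂⟩
    exact ⟨θ₁ + θ₂, by simpa using h₁.add h₂⟩
  · rintro ⟨θ, h⟩
    exact ⟨(-1 : ℝ) • θ, by simpa using h.const_smul (-1)⟩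

/-- On a closed connected oriented surface, a two-form of integral zero is exact. -/
theorem TwoFormOfClass.exists_exteriorDeriv [ConnectedSpace S] {m : S → ℝ}
    (hm : TwoFormOfClass 1 m) (h_int : integralTwoForm m = 0) : ∃ θ, HasExteriorDeriv θ m := by
  choose B hB hBx hBW using fun x : S => exists_chartSquare (x := x) Filter.univ_mem
  choose δ hδ using fun x => (hB x).exists_bump
  obtain ⟨χ, t, hχ, hχU, hχ1⟩ := exists_finite_partition (S := S) (U := fun x => interior (B x))
    (fun x => isOpen_interior) (fun x => mem_interior_iff_mem_nhds.2 (hBx x))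
  obtain ⟨x₀⟩ : Nonempty S := inferInstance
  have hχm : ∀ i, TwoFormOfClass 1 (χ i * m) := fun i =>
    hm.scale ((hχ i).of_le (by exact_mod_cast le_top))
  have e1 : m = ∑ i ∈ t, χ i * m := by
    rw [← Finset.sum_mul]
    funext x
    rw [Pi.mul_apply, Finset.sum_apply, hχ1, one_mul]
  -- Each localised piece is exact up to its mass times a bump, and every bump can be moved to x₀.
  -- The remaining multiple of the bump at x₀ is the total integral, which is zero.
  have h1 : ∀ i, ∃ θ, HasExteriorDeriv θ (χ i * m - integralTwoForm (χ i * m) • δ i) := by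
    intro i
    obtain ⟨θ, hθ, -⟩ := (hB i).exists_exteriorDeriv
      ((hχm i).sub ((hδ i).1.const_smul (integralTwoForm (χ i * m))))
      (fun x hx => by
        rw [Pi.sub_apply, Pi.mul_apply, Pi.smul_apply, (hδ i).2.1 x hx,
          image_eq_zero_of_notMem_tsupport fun h => hx (interior_subset (hχU i h))]
        simp)
      (by rw [integralTwoForm_sub (hχm i) ((hδ i).1.const_smul _), integralTwoForm_smul,
        (hδ i).2.2, mul_one, sub_self])
    exact ⟨θ, hθ⟩
  choose θ₁ hθ₁ using h1
  choose θ₂ hθ₂ using fun i => IsBump.exists_exteriorDeriv_of_connected hB hBx hδ i x₀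
  have hs := HasExteriorDeriv.sum (t := t) fun i _ =>
    (hθ₁ i).add ((hθ₂ i).const_smul (integralTwoForm (χ i * m)))
  refine ⟨∑ i ∈ t, (θ₁ i + integralTwoForm (χ i * m) • θ₂ i), ?_⟩
  convert hs using 1
  have e2 : ∀ i, χ i * m - integralTwoForm (χ i * m) • δ i +
      integralTwoForm (χ i * m) • (δ i - δ x₀) =
      χ i * m - integralTwoForm (χ i * m) • δ x₀ := fun i => by rw [smul_sub]; abel
  simp only [e2]
  rw [Finset.sum_sub_distrib, ← Finset.sum_smul,
    ← (TwoFormOfClass.sum fun i _ => hχm i).2, ← e1, h_int, zero_smul, sub_zero]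

/-! ### Nondegeneracy of the wedge pairing -/

theorem integralWedge_add_right {n : ℕ∞} {η β β' : OneForm S} (hη : FormOfClass n η)
    (hβ : FormOfClass n β) (hβ' : FormOfClass n β') :
    integralWedge η (β + β') = integralWedge η β + integralWedge η β' := by
  have e : wedge η (β + β') = wedge η β + wedge η β' := by
    funext x
    simp only [wedge, wedgeAt, Pi.add_apply, show formAt (β + β') x = formAt β x + formAt β' x
      from rfl, add_apply]
    ring
  rw [integralWedge_eq, integralWedge_eq, integralWedge_eq, e,
    integralTwoForm_add (hη.wedge hβ) (hη.wedge hβ')]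

theorem integralWedge_smul_right (c : ℝ) (η β : OneForm S) :
    integralWedge η (c • β) = c * integralWedge η β := by
  have e : wedge η (c • β) = c • wedge η β := by
    funext x
    simp only [wedge, wedgeAt, Pi.smul_apply, show formAt (c • β) x = c • formAt β x
      from rfl, smul_apply, smul_eq_mul]
    ring
  rw [integralWedge_eq, integralWedge_eq, e, integralTwoForm_smul]

theorem integralWedge_swap (η β : OneForm S) : integralWedge β η = -integralWedge η β := by
  rw [integralWedge_eq, integralWedge_eq, wedge_swap, ← neg_one_smul ℝ, integralTwoForm_smul,
    neg_one_mul]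

theorem integralWedge_add_left {n : ℕ∞} {η η' β : OneForm S} (hη : FormOfClass n η)
    (hη' : FormOfClass n η') (hβ : FormOfClass n β) :
    integralWedge (η + η') β = integralWedge η β + integralWedge η' β := by
  rw [integralWedge_swap β, integralWedge_add_right hβ hη hη', integralWedge_swap η,
    integralWedge_swap η']
  ring

theorem integralWedge_smul_left (c : ℝ) (η β : OneForm S) :
    integralWedge (c • η) β = c * integralWedge η β := by
  rw [integralWedge_swap β, integralWedge_smul_right, integralWedge_swap η]
  ring

/-- Integration by parts against a one-form supported where `g` is a primitive of `η`. -/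
theorem HasExteriorDeriv.integralWedge_eq_neg {θ η : OneForm S} {m g : S → ℝ}
    (h : HasExteriorDeriv θ m) (hm : TwoFormOfClass 0 m) (hg : ContMDiff (𝓡 2) 𝓘(ℝ, ℝ) 2 g)
    {B : Set S} (h0 : ∀ x ∉ B, θ x = 0) (hgη : ∀ x ∈ B, dForm g x = η x) :
    integralWedge η θ = -integralTwoForm (g * m) := by
  have hg1 : ContMDiff (𝓡 2) 𝓘(ℝ, ℝ) 1 g := hg.of_le (by norm_num)
  have hst := (h.scale hg1).integral_eq_zero
  have e : wedge (dForm g) θ = wedge η θ := by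
    funext x
    by_cases hx : x ∈ B
    · rw [wedge, wedge, show formAt (dForm g) x = formAt η x from hgη x hx]
    · rw [wedge_eq_zero_right (h0 x hx), wedge_eq_zero_right (h0 x hx)]
  have hw : TwoFormOfClass 0 (wedge (dForm g) θ) :=
    (formOfClass_dForm (n := 0) (by simpa using hg1)).wedge (h.1.of_le zero_le_one)
  rw [integralTwoForm_add hw (hm.scale (hg.of_le (by norm_num))), e] at hst
  rw [integralWedge_eq]
  linarith

/-- A closed form that is orthogonal to all closed forms is exact. -/
theorem exists_primitive_of_integralWedge_eq_zero [ConnectedSpace S] {η : OneForm S}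
    (hη : IsClosedForm η) (h : ∀ β, IsClosedForm β → integralWedge η β = 0) :
    ∃ G : S → ℝ, ∀ p, IsPrimitiveNear η G p := by
  have hloc : ∀ p : S, ∃ (g : S → ℝ) (B : Set S), ContMDiff (𝓡 2) 𝓘(ℝ, ℝ) 2 g ∧
      IsChartSquare B ∧ B ∈ 𝓝 p ∧ ∀ x ∈ B, IsPrimitiveNear η g x := by
    intro p
    obtain ⟨g, hg⟩ := hη p
    have hU : IsOpen {x | IsPrimitiveNear η g x} := isOpen_setOf_isPrimitiveNear η g
    obtain ⟨B, hB, hBp, hBU⟩ := exists_chartSquare (hU.mem_nhds hg)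
    obtain ⟨k, hk, hkB⟩ := exists_global_extension (n := 2) (g := g) hB.isCompact.isClosed hU hBU
      fun x hx => (Filter.Eventually.self_of_nhds hx).1
    exact ⟨k, B, hk, hB, hBp, fun x hx => (hBU hx).congr (hkB x hx)⟩
  choose g B hg hB hBx hgB using hloc
  choose δ hδ using fun x => (hB x).exists_bump
  obtain ⟨x₀⟩ : Nonempty S := inferInstance
  choose θ hθ using fun x => IsBump.exists_exteriorDeriv_of_connected hB hBx hδ x x₀
  have hη1 : FormOfClass 1 η := hη.hasExteriorDeriv.1
  have hgd : ∀ p, ∀ x ∈ B p, dForm (g p) x = η x := fun p x hx =>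
    ContinuousLinearMap.ext (hgB p x hx).self_of_nhds.2
  have h10 : ∀ {m : S → ℝ}, TwoFormOfClass 1 m → TwoFormOfClass 0 m := fun hm p =>
    (hm p).of_le (by simp)
  have hgc : ∀ p, ContMDiff (𝓡 2) 𝓘(ℝ, ℝ) ((1 : ℕ∞) : ℕ∞ω) (g p) := fun p =>
    (hg p).of_le (by norm_num)
  -- Here dθ_x = δ_x - δ_{x₀}. For a global primitive u of η, Stokes gives -∫ η ∧ θ_x = ∫ u δ_x - ∫
  -- u δ_{x₀}, the increment of u between two averages; then g_x(x) - ∫ g_x δ_x is the increment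
  -- from the average near x to the value at x. The sum is defined without assuming that u exists.
  let G : S → ℝ := fun x => -integralWedge η (θ x) - integralTwoForm (g x * δ x) + g x x
  refine ⟨G, fun p => ?_⟩
  have key : ∀ᶠ x in 𝓝 p, G x =
      g p x + (-integralWedge η (θ p) - integralTwoForm (g p * δ p)) := by
    filter_upwards [eventually_mem_nhds_iff.2 (hBx p)] with x hx
    have hconst := (hgB p x (mem_of_mem_nhds hx)).sub_eq_sub (hgB x x (mem_of_mem_nhds (hBx x)))
    -- The bump e in a small square near x links δ_x to δ_p. The form θ_x - (θ_p + τ₁ + τ₂) is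
    -- closed, hence orthogonal to η. On the small square g_p - g_x is constant and e has integral
    -- one, which turns the comparison into g_p(x) - g_x(x).
    obtain ⟨C, hC, -, hCs⟩ := exists_chartSquare
      (Filter.inter_mem (Filter.inter_mem hx (hBx x)) hconst)
    obtain ⟨e, he⟩ := hC.exists_bump
    have hep := he.mono (fun z hz => (hCs hz).1.1 : C ⊆ B p)
    have hex := he.mono (fun z hz => (hCs hz).1.2 : C ⊆ B x)
    obtain ⟨τ₁, h₁, h₁0⟩ := (hδ x).exists_exteriorDeriv (hB x) hex
    obtain ⟨τ₂, h₂, h₂0⟩ := hep.exists_exteriorDeriv (hB p) (hδ p)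
    have hcl : IsClosedForm (θ x - (θ p + τ₁ + τ₂)) := by
      have := (hθ x).sub (((hθ p).add h₁).add h₂)
      refine HasExteriorDeriv.isClosedForm ?_
      convert this using 1
      abel
    have hsum : integralWedge η (θ x) = integralWedge η (θ p) + integralWedge η τ₁ +
        integralWedge η τ₂ := by
      have hd := integralWedge_add_right hη1 hcl.hasExteriorDeriv.1
        (((hθ p).add h₁).add h₂).1
      rw [sub_add_cancel, h _ hcl, zero_add, integralWedge_add_right hη1 ((hθ p).add h₁).1 h₂.1,
        integralWedge_add_right hη1 (hθ p).1 h₁.1] at hd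
      exact hd
    rw [h₁.integralWedge_eq_neg (h10 ((hδ x).1.sub he.1)) (hg x) h₁0 (hgd x),
      h₂.integralWedge_eq_neg (h10 (he.1.sub (hδ p).1)) (hg p) h₂0 (hgd p), mul_sub, mul_sub,
      integralTwoForm_sub ((hδ x).1.scale (hgc x)) (he.1.scale (hgc x)),
      integralTwoForm_sub (he.1.scale (hgc p)) ((hδ p).1.scale (hgc p))] at hsum
    have hdiff : integralTwoForm (g p * e) - integralTwoForm (g x * e) = g p x - g x x := by
      rw [← integralTwoForm_sub (he.1.scale (hgc p)) (he.1.scale (hgc x))]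
      have e1 : g p * e - g x * e = (g p x - g x x) • e := by
        funext z
        simp only [Pi.sub_apply, Pi.mul_apply, Pi.smul_apply, smul_eq_mul]
        by_cases hz : z ∈ C
        · have : g p z - g p x = g x z - g x x := (hCs hz).2
          rw [← sub_mul]
          congr 1
          linarith
        · rw [he.2.1 z hz]
          ring
      rw [e1, integralTwoForm_smul, he.2.2, mul_one]
    simp only [G]
    linarith
  exact ((hgB p p (mem_of_mem_nhds (hBx p))).add_const _).congr
    key

end TopDegree

end

noncomputable section

/-! ### Linear algebra -/

section LinearAlgebra

variable {V W : Type*} [AddCommMonoid V] [Module ℝ V] [AddCommGroup W] [Module ℝ W]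

/-- A linear form that vanishes on the common kernel of a family of forms of finite rank belongs
to the family. -/
theorem exists_eq_of_common_ker [FiniteDimensional ℝ W] (P : V →ₗ[ℝ] W)
    (B : V →ₗ[ℝ] Module.Dual ℝ V) (hB : ∀ v, P v = 0 → B v = 0) (l : Module.Dual ℝ V)
    (hl : ∀ v, (∀ b, B b v = 0) → l v = 0) : ∃ b, B b = l := by
  let _ : AddCommGroup V := Module.addCommMonoidToAddCommGroup ℝ
  have hker : LinearMap.ker P ≤ LinearMap.ker B := fun v hv => hB v hv
  have hfin : FiniteDimensional ℝ (V ⧸ LinearMap.ker P) :=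
    Module.Finite.equiv P.quotKerEquivRange.symm
  have hfin' : FiniteDimensional ℝ (LinearMap.range B) := by
    rw [← Submodule.range_liftQ _ _ hker]
    infer_instance
  -- B factors through V/ker P, so its range is finite-dimensional and equals the set of all linear
  -- forms vanishing on its common kernel, even though V itself may be infinite-dimensional.
  have hl : l ∈ LinearMap.range B := by
    rw [← Subspace.dualCoannihilator_dualAnnihilator_eq (W := LinearMap.range B),
      Submodule.mem_dualAnnihilator]
    intro v hv
    rw [Submodule.mem_dualCoannihilator] at hv
    exact hl v fun b => hv (B b) ⟨b, rfl⟩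
  exact hl

/-- W is a quotient of V/ker F, which embeds in ℝ². -/
theorem finrank_le_two_of_surjective {P : V →ₗ[ℝ] W} (hP : Function.Surjective P)
    (F : V →ₗ[ℝ] ℝ × ℝ) (hF : ∀ v, F v = 0 → P v = 0) : Module.finrank ℝ W ≤ 2 := by
  let _ : AddCommGroup V := Module.addCommMonoidToAddCommGroup ℝ
  have hker : LinearMap.ker F ≤ LinearMap.ker P := fun v hv => hF v hv
  have hfin : FiniteDimensional ℝ (V ⧸ LinearMap.ker F) :=
    Module.Finite.equiv F.quotKerEquivRange.symm
  have h1 : Module.finrank ℝ (V ⧸ LinearMap.ker F) ≤ 2 := by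
    rw [F.quotKerEquivRange.finrank_eq]
    refine (Submodule.finrank_le _).trans ?_
    simp
  refine le_trans (LinearMap.finrank_le_finrank_of_surjective
    (f := (LinearMap.ker F).liftQ P hker) fun w => ?_) h1
  obtain ⟨v, hv⟩ := hP w
  exact ⟨Submodule.Quotient.mk v, hv⟩

end LinearAlgebra

/-! ### Poincaré duality -/

section PoincareDuality

variable {S : Type u} [TopologicalSpace S] [ChartedSpace Plane S] [IsManifold (𝓡 2) ∞ S]
  [CompactSpace S] [T2Space S] [OrientedAtlas S]

theorem IsClosedForm.formOfClass {η : OneForm S} (h : IsClosedForm η) : FormOfClass 1 η :=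
  h.hasExteriorDeriv.1

/-- The differential of a function is orthogonal to closed forms. -/
theorem integralWedge_dForm_left {G : S → ℝ} (hG : ContMDiff (𝓡 2) 𝓘(ℝ, ℝ) 1 G) {β : OneForm S}
    (hβ : IsClosedForm β) : integralWedge (dForm G) β = 0 := by
  have := (hβ.hasExteriorDeriv.scale hG).integral_eq_zero
  rwa [mul_zero, add_zero, ← integralWedge_eq] at this

theorem integralWedge_eq_zero_of_exact {η β : OneForm S} {G : S → ℝ}
    (hG : ∀ p, IsPrimitiveNear η G p) (hβ : IsClosedForm β) : integralWedge η β = 0 := by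
  have e : η = dForm G :=
    funext fun p => (ContinuousLinearMap.ext (hG p).self_of_nhds.2).symm
  rw [e]
  exact integralWedge_dForm_left
    (fun p => (hG p).self_of_nhds.1.of_le (by norm_num)) hβ

variable (S) in
/-- The wedge pairing of closed forms; the second form is the first argument. -/
def wedgePairing : closedForms S →ₗ[ℝ] Module.Dual ℝ (closedForms S) :=
  LinearMap.mk₂ ℝ (fun β η => integralWedge η.1 β.1)
    (fun β β' η => integralWedge_add_right η.2.formOfClass β.2.formOfClass β'.2.formOfClass)
    (fun c β η => integralWedge_smul_right c η.1 β.1)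
    (fun β η η' => integralWedge_add_left η.2.formOfClass η'.2.formOfClass β.2.formOfClass)
    (fun c β η => integralWedge_smul_left c η.1 β.1)

theorem wedgePairing_apply (β η : closedForms S) :
    wedgePairing S β η = integralWedge η.1 β.1 := rfl

variable [ConnectedSpace S]

/-- The wedge pairing has finite rank because forms without periods are exact and exact forms are
orthogonal to closed ones. A form orthogonal to all closed forms is exact and so pairs trivially
with ρ; hence η ↦ ⟨η, ρ⟩ is the wedge pairing with some closed form. -/
theorem exists_isPoincareDual [FiniteDimensional ℝ (H1 S)] (ρ : H1 S) :
    ∃ β, IsPoincareDual ρ β := by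
  obtain ⟨β, hβ⟩ := exists_eq_of_common_ker (pairing S) (wedgePairing S) (fun β hβ => by
    obtain ⟨G, hG⟩ := exists_primitive_of_pairing_eq_zero β hβ
    refine LinearMap.ext fun η => ?_
    rw [wedgePairing_apply, integralWedge_swap, integralWedge_eq_zero_of_exact hG η.2, neg_zero]
    rfl) ((pairing S).flip ρ) (fun η hη => by
    obtain ⟨G, hG⟩ := exists_primitive_of_integralWedge_eq_zero η.2
      fun β hβ => hη ⟨β, hβ⟩
    exact LinearMap.congr_fun (pairing_eq_zero_of_exact η hG) ρ)
  refine ⟨β.1, β.2, fun η hη => ?_⟩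
  exact (pairing_apply ⟨η, hη⟩ ρ).symm.trans (LinearMap.congr_fun hβ ⟨η, hη⟩).symm

theorem isPoincareDual_poincareDual [FiniteDimensional ℝ (H1 S)] (ρ : H1 S) :
    IsPoincareDual ρ (poincareDual ρ) :=
  Classical.epsilon_spec (exists_isPoincareDual ρ)

theorem intersectionForm_eq_formPairing [FiniteDimensional ℝ (H1 S)] (ρ ρ' : H1 S) :
    intersectionForm ρ ρ' = formPairing (poincareDual ρ) ρ' :=
  ((isPoincareDual_poincareDual ρ').2 _ (isPoincareDual_poincareDual ρ).1).symm

theorem intersectionForm_swap (ρ ρ' : H1 S) :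
    intersectionForm ρ ρ' = -intersectionForm ρ' ρ :=
  integralWedge_swap _ _

/-- The intersection form can be computed from any Poincaré dual. -/
theorem IsPoincareDual.intersectionForm_eq [FiniteDimensional ℝ (H1 S)] {ρ : H1 S} {β : OneForm S}
    (h : IsPoincareDual ρ β) (ρ' : H1 S) : intersectionForm ρ ρ' = formPairing β ρ' := by
  rw [intersectionForm_swap, intersectionForm_eq_formPairing,
    h.2 _ (isPoincareDual_poincareDual ρ').1, integralWedge_swap, neg_neg,
    (isPoincareDual_poincareDual ρ').2 _ h.1]

end PoincareDuality

/-! ### Loops of maps based at the identity -/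

section LoopsOfMaps

variable {S : Type u} [TopologicalSpace S] [ChartedSpace Plane S] [IsManifold (𝓡 2) ∞ S]

/-- Near `p`, the function `g` is a primitive of `η` and `k` is a primitive of `g β - θ`. -/
def IsIteratedPrimitive (η β θ : OneForm S) (g k : S → ℝ) (p : S) : Prop :=
  IsPrimitiveNear η g p ∧ IsPrimitiveNear (scaleForm g β - θ) k p

variable {η β θ : OneForm S} {g g' h k k' : S → ℝ} {p : S}

/-- Adding the constant c = g'(p) - g(p) to the primitive of η adds cβ to gβ - θ, hence c times a
primitive of β to the iterated primitive. -/
theorem IsIteratedPrimitive.sub_eq_sub (hk : IsIteratedPrimitive η β θ g k p)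
    (hk' : IsIteratedPrimitive η β θ g' k' p) (hh : IsPrimitiveNear β h p) :
    ∀ᶠ y in 𝓝 p, k' y - k' p = k y - k p + (g' p - g p) * (h y - h p) := by
  have h1 : IsPrimitiveNear (scaleForm g' β - θ) (fun y => k y + (g' p - g p) * h y) p := by
    filter_upwards [hk.2.add (hh.const_smul (g' p - g p)), hk.1.sub_eq_sub hk'.1] with y hy hg
    refine ⟨hy.1, fun v => (hy.2 v).trans ?_⟩
    change (g y * β y v - θ y v) + (g' p - g p) * β y v = g' y * β y v - θ y v
    rw [show g' y = g y + (g' p - g p) by linarith]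
    ring
  filter_upwards [hk'.2.sub_eq_sub h1] with y hy
  linarith

theorem IsPrimitiveAlongMap.eventually_sub_eq {X : Type*} [TopologicalSpace X] {Φ : X → S}
    (hΦ : Continuous Φ) {F : X → ℝ} (hF : IsPrimitiveAlongMap η Φ F) {x : X}
    (hg : IsPrimitiveNear η g (Φ x)) : ∀ᶠ y in 𝓝 x, F y - F x = g (Φ y) - g (Φ x) := by
  obtain ⟨g₀, hg₀, h₀⟩ := hF x
  filter_upwards [h₀, hΦ.continuousAt.eventually (hg₀.sub_eq_sub hg)] with y h1 h2
  rw [h1, h2]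

/-- `K` is a primitive along `Φ` of `G β - θ`, where `G` is a primitive of `η` along `Φ`. -/
def IsIteratedPrimitiveAlong {X : Type*} [TopologicalSpace X] (η β θ : OneForm S) (Φ : X → S)
    (G K : X → ℝ) : Prop :=
  ∀ x, ∃ g h k : S → ℝ, IsIteratedPrimitive η β θ g k (Φ x) ∧ IsPrimitiveNear β h (Φ x) ∧
    ∀ᶠ y in 𝓝 x, K y - K x =
      k (Φ y) - k (Φ x) + (G x - g (Φ x)) * (h (Φ y) - h (Φ x))

/-- The chosen local primitive g of η differs from the primitive G along the map by a local
constant; the term (G - g) h corrects for it, and the corrected local functions have locally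
constant differences. -/
theorem GluesLocalFunctions.exists_iteratedPrimitive {X : Type*} [TopologicalSpace X]
    (hX : GluesLocalFunctions X) (hβ : IsClosedForm β)
    (hθ : ∀ p, ∃ g k, IsIteratedPrimitive η β θ g k p) {Φ : X → S} (hΦ : Continuous Φ) {G : X → ℝ}
    (hG : IsPrimitiveAlongMap η Φ G) : ∃ K, IsIteratedPrimitiveAlong η β θ Φ G K := by
  choose g k hgk using hθ
  choose h hh using hβ
  obtain ⟨K, hK⟩ := hX (fun x y => k (Φ x) (Φ y) + (G x - g (Φ x) (Φ x)) * h (Φ x) (Φ y)) (by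
    intro x
    filter_upwards [hΦ.continuousAt.eventually (hgk (Φ x)).1.eventually,
      hΦ.continuousAt.eventually (hgk (Φ x)).2.eventually,
      hΦ.continuousAt.eventually (hh (Φ x)).eventually,
      hG.eventually_sub_eq hΦ (hgk (Φ x)).1] with y h1 h2 h3 h4
    filter_upwards [hΦ.continuousAt.eventually
      (IsIteratedPrimitive.sub_eq_sub ⟨h1, h2⟩ (hgk (Φ y)) h3),
      hΦ.continuousAt.eventually (h3.sub_eq_sub (hh (Φ y)))] with z h5 h6
    rw [show G x = G y - (g (Φ x) (Φ y) - g (Φ x) (Φ x)) by linarith]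
    linear_combination (-1 : ℝ) * h5 + (G y - g (Φ y) (Φ y)) * h6)
  refine ⟨K, fun x => ⟨g (Φ x), h (Φ x), k (Φ x), hgk _, hh _, ?_⟩⟩
  filter_upwards [hK x] with y hy
  rw [hy]
  ring

/-- Iterated primitives along two lifts of the same map. -/
theorem IsIteratedPrimitiveAlong.sub_eq_sub {X Y : Type*} [TopologicalSpace X] [TopologicalSpace Y]
    [PreconnectedSpace Y] {Φ : X → S} {G H K : X → ℝ} (hΦ : Continuous Φ)
    (hH : IsPrimitiveAlongMap β Φ H) (hK : IsIteratedPrimitiveAlong η β θ Φ G K) {a b : Y → X}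
    (ha : Continuous a) (hb : Continuous b) (hab : ∀ y, Φ (b y) = Φ (a y)) {c : ℝ}
    (hc : ∀ y, G (b y) - G (a y) = c) (s t : Y) :
    K (b s) - K (a s) - (K (b t) - K (a t)) = c * (H (a s) - H (a t)) := by
  -- Passing from the lift a to the lift b adds c to G, hence cβ to the integrated form Gβ - θ; so K
  -- ∘ b - K ∘ a - c (H ∘ a) is locally constant.
  have := isPreconnected_univ.eq_of_eventually_eq
    (w := fun y => K (b y) - K (a y) - c * H (a y)) (by
    intro x _
    rw [nhdsWithin_univ]
    obtain ⟨g, h, k, hgk, hh, h1⟩ := hK (a x)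
    obtain ⟨g', h', k', hgk', hh', h1'⟩ := hK (b x)
    rw [hab x] at hgk' hh'
    filter_upwards [ha.continuousAt.eventually h1, hb.continuousAt.eventually h1',
      (hΦ.comp ha).continuousAt.eventually (hgk.sub_eq_sub hgk' hh),
      (hΦ.comp ha).continuousAt.eventually (hh.sub_eq_sub hh'),
      ha.continuousAt.eventually (hH.eventually_sub_eq hΦ hh)] with y e1 e2 e3 e4 e5
    rw [hab y, hab x] at e2
    simp only [Function.comp_apply] at e3 e4
    have e6 := hc x
    rw [show G (b x) = G (a x) + c by linarith] at e2
    linear_combination e2 - e1 + e3 - (G (a x) + c - g' (Φ (a x))) * e4 - c * e5)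
    (Set.mem_univ t) (Set.mem_univ s)
  linarith

variable [CompactSpace S] [T2Space S] [OrientedAtlas S] [ConnectedSpace S]

/-- Near p one has d(gβ - θ) = η ∧ β - dθ = 0, so the Poincaré lemma applies. The local primitive is
first extended to a global C² function, as the Leibniz rule requires. -/
theorem exists_iteratedPrimitive (hη : IsClosedForm η) (hβ : IsClosedForm β)
    (hθ : HasExteriorDeriv θ (wedge η β)) (p : S) :
    ∃ g k, IsIteratedPrimitive η β θ g k p := by
  obtain ⟨g₀, hg₀⟩ := hη p
  have hU := isOpen_setOf_isPrimitiveNear η g₀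
  obtain ⟨g, hg, hgp⟩ := exists_global_extension (n := 2) (isClosed_singleton (x := p)) hU
    (by simpa using hg₀) fun x hx => (Filter.Eventually.self_of_nhds hx).1
  have hgη : IsPrimitiveNear η g p := hg₀.congr (hgp p rfl)
  obtain ⟨k, hk⟩ := ((hβ.hasExteriorDeriv.scale (hg.of_le (by norm_num))).sub
    hθ).exists_isPrimitiveNear (p := p) (by
      filter_upwards [hgη] with x hx
      have e : formAt (dForm g) x = formAt η x := ContinuousLinearMap.ext hx.2
      simp only [Pi.sub_apply, mul_zero, add_zero, wedge, e, sub_self])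
  exact ⟨g, k, hgη, hk⟩

/-- The relation between the periods of two closed forms with `∫ η ∧ β = 0` on a torus swept by a
loop of maps. -/
theorem pathIntegral_mul_eq_of_loop (hη : IsClosedForm η) (hβ : IsClosedForm β)
    (h0 : integralWedge η β = 0) (φ : C(I × S, S)) (hφ0 : ∀ z, φ (0, z) = z)
    (hφ1 : ∀ z, φ (1, z) = z) (z : S) (α : Path z z) :
    pathIntegral η ⟨fun t => φ (t, z), by fun_prop⟩ * pathIntegral β α =
      pathIntegral η α * pathIntegral β ⟨fun t => φ (t, z), by fun_prop⟩ := by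
  obtain ⟨θ, hθ⟩ := (hη.formOfClass.wedge hβ.formOfClass).exists_exteriorDeriv
    (by rwa [← integralWedge_eq])
  -- The torus swept by the loop, cut open into a square: opposite sides have the same image, since
  -- φ is the identity at both ends and α is closed.
  let Φ : C(I × I, S) := ⟨fun x => φ (x.2, α x.1), by fun_prop⟩
  obtain ⟨G, hG, hGτ⟩ := gluesLocalFunctions_square.exists_potential hη Φ
  obtain ⟨H, hH, hHτ⟩ := gluesLocalFunctions_square.exists_potential hβ Φ
  obtain ⟨K, hK⟩ := gluesLocalFunctions_square.exists_iteratedPrimitive hβ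
    (exists_iteratedPrimitive hη hβ hθ) Φ.continuous hG
  let bot : C(I, I × I) := ⟨fun s => (s, 0), by fun_prop⟩
  let top : C(I, I × I) := ⟨fun s => (s, 1), by fun_prop⟩
  let left : C(I, I × I) := ⟨fun t => (0, t), by fun_prop⟩
  let right : C(I, I × I) := ⟨fun t => (1, t), by fun_prop⟩
  have ebt : ∀ s, Φ (top s) = Φ (bot s) := fun s => (hφ1 _).trans (hφ0 _).symm
  have elr : ∀ t, Φ (right t) = Φ (left t) := fun t => by
    change φ (t, α 1) = φ (t, α 0)
    rw [α.source, α.target]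
  have cbt : ∀ s, G (top s) - G (bot s) = G (0, 1) - G (0, 0) := by
    intro s
    have h1 := hG.comp (τ := top) top.continuous
    rw [show Φ ∘ top = Φ ∘ bot from funext ebt] at h1
    have h2 := h1.sub_eq_sub (Φ.continuous.comp bot.continuous) (hG.comp bot.continuous) s 0
    simp only [Function.comp_apply] at h2
    change G (top s) - G (bot s) = G (top 0) - G (bot 0)
    linarith
  have clr : ∀ t, G (right t) - G (left t) = G (1, 0) - G (0, 0) := by
    intro t
    have h1 := hG.comp (τ := right) right.continuous
    rw [show Φ ∘ right = Φ ∘ left from funext elr] at h1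
    have h2 := h1.sub_eq_sub (Φ.continuous.comp left.continuous) (hG.comp left.continuous) t 0
    simp only [Function.comp_apply] at h2
    change G (right t) - G (left t) = G (right 0) - G (left 0)
    linarith
  -- The alternating sum of K over the four corners is computed in two ways. Comparing bottom and
  -- top gives ∫_traj η · ∫_α β; comparing left and right gives ∫_α η · ∫_traj β.
  have k1 := hK.sub_eq_sub Φ.continuous hH bot.continuous top.continuous ebt cbt 1 0
  have k2 := hK.sub_eq_sub Φ.continuous hH left.continuous right.continuous elr clr 1 0
  have p1 : Φ.comp bot = α.toContinuousMap := by
    ext s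
    exact hφ0 _
  have p2 : Φ.comp left = ⟨fun t => φ (t, z), by fun_prop⟩ := by
    ext t
    change φ (t, α 0) = φ (t, z)
    rw [α.source]
  have i1 := hGτ bot
  have i2 := hGτ left
  have j1 := hHτ bot
  have j2 := hHτ left
  rw [p1] at i1 j1
  rw [p2] at i2 j2
  change pathIntegral η _ * pathIntegral β α.toContinuousMap =
    pathIntegral η α.toContinuousMap * pathIntegral β _
  rw [i1, i2, j1, j2]
  change K (1, 1) - K (1, 0) - (K (0, 1) - K (0, 0)) = _ at k1
  change K (1, 1) - K (0, 1) - (K (1, 0) - K (0, 0)) = _ at k2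
  have : K (1, 1) - K (1, 0) - (K (0, 1) - K (0, 0)) =
    K (1, 1) - K (0, 1) - (K (1, 0) - K (0, 0)) := by ring
  rw [k1, k2] at this
  exact this

/-- On a surface of genus at least two, the trajectories of a loop of maps based at the identity
are homologically trivial. -/
theorem pathIntegral_eq_zero_of_loop (hdim : 2 < Module.finrank ℝ (H1 S)) (hη : IsClosedForm η)
    (φ : C(I × S, S)) (hφ0 : ∀ z, φ (0, z) = z) (hφ1 : ∀ z, φ (1, z) = z) (z : S) :
    pathIntegral η ⟨fun t => φ (t, z), by fun_prop⟩ = 0 := by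
  by_contra hne
  have : FiniteDimensional ℝ (H1 S) := FiniteDimensional.of_finrank_pos (by omega)
  let c : closedForms S →ₗ[ℝ] ℝ :=
    { toFun := fun β => pathIntegral β.1 ⟨fun t => φ (t, z), by fun_prop⟩
      map_add' := fun β β' => pathIntegral_add β.2 β'.2 _
      map_smul' := fun a β => pathIntegral_const_smul β.2 a _ }
  let w : closedForms S →ₗ[ℝ] ℝ := (wedgePairing S).flip ⟨η, hη⟩
  -- With a nonzero η-period on the trajectory, the torus relation forces every period of β based at
  -- z to vanish; conjugating by paths extends this to all loops, so β is exact.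
  have hker : ∀ β, (w.prod c) β = 0 → pairing S β = 0 := by
    intro β hβ
    have hβw : integralWedge η β.1 = 0 := congrArg Prod.fst hβ
    have hβc : c β = 0 := congrArg Prod.snd hβ
    have hz : ∀ α : Path z z, pathIntegral β.1 α = 0 := by
      intro α
      have := pathIntegral_mul_eq_of_loop hη β.2 hβw φ hφ0 hφ1 z α
      rw [show pathIntegral β.1 _ = 0 from hβc, mul_zero] at this
      exact (mul_eq_zero.1 this).resolve_left hne
    have := locallyPathConnectedSpace_of_surface (S := S)
    have : PathConnectedSpace S := pathConnectedSpace_iff_connectedSpace.2 inferInstance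
    obtain ⟨G, hG⟩ := exists_primitive_of_loops β.2 fun x γ => by
      let τ := PathConnectedSpace.somePath z x
      have := hz ((τ.trans γ).trans τ.symm)
      rw [pathIntegral_trans β.2, pathIntegral_trans β.2, pathIntegral_symm β.2] at this
      linarith
    exact pairing_eq_zero_of_exact β hG
  -- The periods realise the whole dual of H₁, while two linear conditions already make all periods
  -- vanish; hence the dimension would be at most two.
  have h2 := finrank_le_two_of_surjective pairing_surjective (w.prod c) hker
  rw [show Module.finrank ℝ (H1 S →ₗ[ℝ] ℝ) = Module.finrank ℝ (H1 S) from
    Subspace.dual_finrank_eq] at h2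
  omega

end LoopsOfMaps

end

/-! ### From the mean of path integrals to rotation vectors -/

noncomputable section

/-- A linear form that vanishes on the kernel of a surjection onto a dual space is an evaluation. -/
theorem exists_eq_eval_of_ker {V W : Type*} [AddCommMonoid V] [Module ℝ V] [AddCommGroup W]
    [Module ℝ W] [FiniteDimensional ℝ W] {P : V →ₗ[ℝ] Module.Dual ℝ W} (hP : Function.Surjective P)
    (l : V →ₗ[ℝ] ℝ) (hl : ∀ v, P v = 0 → l v = 0) : ∃ r, ∀ v, l v = P v r := by
  let _ : AddCommGroup V := Module.addCommMonoidToAddCommGroup ℝ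
  -- A linear section carries l to a form on the dual of W, which is evaluation at a vector by
  -- finite dimension; the section is irrelevant because l vanishes on ker P.
  obtain ⟨s, hs⟩ := P.exists_rightInverse_of_surjective (LinearMap.range_eq_top.2 hP)
  refine ⟨(Module.evalEquiv ℝ W).symm (l.comp s), fun v => ?_⟩
  rw [Module.apply_evalEquiv_symm_apply]
  have h : l (v - s (P v)) = 0 := hl _ (by
    rw [map_sub, show P (s (P v)) = P v from LinearMap.congr_fun hs (P v), sub_self])
  rw [map_sub] at h
  exact sub_eq_zero.1 h

/-! ### Concatenation of homotopies -/

section Homotopies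

variable {X Y : Type*} [TopologicalSpace X] [TopologicalSpace Y] {f₀ f₁ f₂ : C(X, Y)}

theorem ContinuousMap.Homotopy.evalAt_trans (F : f₀.Homotopy f₁) (G : f₁.Homotopy f₂) (x : X) :
    (F.trans G).evalAt x = (F.evalAt x).trans (G.evalAt x) := by
  ext t
  change (F.trans G) (t, x) = _
  rw [ContinuousMap.Homotopy.trans_apply, Path.trans_apply]
  rfl

theorem ContinuousMap.Homotopy.evalAt_symm (F : f₀.Homotopy f₁) (x : X) :
    F.symm.evalAt x = (F.evalAt x).symm := by
  ext t
  rfl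

end Homotopies

section Isotopies

variable {S : Type u} [TopologicalSpace S] {k : S → S}

theorem IsotopyFromId.continuous (J : IsotopyFromId k) : Continuous k := by
  have : k = fun z => J.toMap (1, z) := funext fun z => (J.map_one z).symm
  rw [this]
  fun_prop

/-- An isotopy as a homotopy. -/
def IsotopyFromId.toHomotopy (J : IsotopyFromId k) (hk : Continuous k) :
    (ContinuousMap.id S).Homotopy ⟨k, hk⟩ where
  toContinuousMap := J.toMap
  map_zero_left := J.map_zero
  map_one_left := J.map_one

/-- An isotopy from the identity followed by a path of homeomorphisms. -/
theorem IsotopyFromId.isotopicToId_of_homotopy (J : IsotopyFromId k) (hk : Continuous k)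
    {k' : C(S, S)} (H : (⟨k, hk⟩ : C(S, S)).Homotopy k')
    (hH : ∀ t, IsHomeomorph fun z => H (t, z)) : IsotopicToId k' := by
  refine ⟨⟨((J.toHomotopy hk).trans H).toContinuousMap, fun t => ?_,
    ((J.toHomotopy hk).trans H).map_zero_left, ((J.toHomotopy hk).trans H).map_one_left⟩⟩
  have e : (fun z => ((J.toHomotopy hk).trans H) (t, z)) = fun z =>
      if h : (t : ℝ) ≤ 1 / 2 then
        J.toMap (⟨2 * t, (unitInterval.mul_pos_mem_iff zero_lt_two).2 ⟨t.2.1, h⟩⟩, z)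
      else H (⟨2 * t - 1, unitInterval.two_mul_sub_one_mem_iff.2 ⟨(not_le.1 h).le, t.2.2⟩⟩, z) :=
    funext fun z => ContinuousMap.Homotopy.trans_apply _ _ _
  change IsHomeomorph fun z => ((J.toHomotopy hk).trans H) (t, z)
  rw [e]
  split_ifs
  · exact J.isHomeomorph _
  · exact hH _

end Isotopies

/-! ### Rotation vectors -/

section RotationVectors

open MeasureTheory

variable {S : Type u} [TopologicalSpace S] [ChartedSpace Plane S] [IsManifold (𝓡 2) ∞ S]
  {η β : OneForm S}

/-- The adjunction between push-forward of classes and pull-back of forms; the increment of G has no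
effect on cycles. -/
theorem formPairing_homologyMap {F : C(S, S)} {G : S → ℝ} (hη : IsClosedForm η)
    (hβ : IsClosedForm β) (h : ∀ γ : C(I, S),
      pathIntegral β (F.comp γ) = pathIntegral η γ + (G (γ 1) - G (γ 0))) (ρ : H1 S) :
    formPairing β (homologyMap F ρ) = formPairing η ρ := by
  rw [formPairing_eq_eval hβ, IsPathCocycle.eval_homologyMap,
    formPairing_eq_of_increment hη ((isPathCocycle_pathIntegral hβ).comp F) G h]

theorem continuous_pathIntegral_evalAt (hη : IsClosedForm η) {f₀ f₁ : C(S, S)}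
    (H : f₀.Homotopy f₁) : Continuous fun z => pathIntegral η (H.evalAt z) :=
  continuous_pathIntegral hη H.toContinuousMap (fun z => H.evalAt z) fun _ _ => rfl

variable [CompactSpace S]

theorem continuous_integrable [MeasurableSpace S] [BorelSpace S] {μ : Measure S}
    [IsProbabilityMeasure μ] {w : S → ℝ} (hw : Continuous w) : Integrable w μ :=
  hw.integrable_of_hasCompactSupport (HasCompactSupport.of_compactSpace w)

theorem integral_comp_measurePreserving [MeasurableSpace S] [BorelSpace S] {μ : Measure S}
    {k : S → S} (hk : MeasurePreserving k μ μ) {w : S → ℝ} (hw : Continuous w) :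
    ∫ z, w (k z) ∂μ = ∫ z, w z ∂μ := by
  have := integral_map (μ := μ) hk.measurable.aemeasurable (f := w) hw.aestronglyMeasurable
  rw [hk.map_eq] at this
  exact this.symm

theorem integral_coboundary [MeasurableSpace S] [BorelSpace S] {μ : Measure S}
    [IsProbabilityMeasure μ] {k : S → S} (hkc : Continuous k) (hk : MeasurePreserving k μ μ)
    {w : S → ℝ} (hw : Continuous w) : ∫ z, (w (k z) - w z) ∂μ = 0 := by
  have h : Integrable (fun z => w (k z)) μ := continuous_integrable (hw.comp hkc)
  rw [integral_sub h (continuous_integrable hw), integral_comp_measurePreserving hk hw, sub_self]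

variable [T2Space S] [ConnectedSpace S]

/-- Mean rotation along a homotopy from the identity is given by a homology class. -/
theorem exists_rotation_class [FiniteDimensional ℝ (H1 S)] [MeasurableSpace S] [BorelSpace S]
    {μ : Measure S} [IsProbabilityMeasure μ] {k : C(S, S)} (hk : MeasurePreserving k μ μ)
    (H : (ContinuousMap.id S).Homotopy k) :
    ∃ r : H1 S, ∀ η, IsClosedForm η →
      ∫ z, pathIntegral η (H.evalAt z) ∂μ = formPairing η r := by
  let l : closedForms S →ₗ[ℝ] ℝ :=
    { toFun := fun η => ∫ z, pathIntegral η.1 (H.evalAt z) ∂μ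
      map_add' := fun η β => by
        rw [← integral_add (continuous_integrable (continuous_pathIntegral_evalAt η.2 H))
          (continuous_integrable (continuous_pathIntegral_evalAt β.2 H))]
        exact integral_congr_ae (Filter.Eventually.of_forall fun z =>
          pathIntegral_add η.2 β.2 _)
      map_smul' := fun c η => by
        rw [RingHom.id_apply, smul_eq_mul, ← integral_const_mul]
        exact integral_congr_ae (Filter.Eventually.of_forall fun z =>
          pathIntegral_const_smul η.2 c _) }
  -- A form with zero pairing is some dG, and its mean integral is ∫ (G ∘ k - G) dμ = 0 by
  -- invariance of μ. The mean therefore depends only on the periods.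
  obtain ⟨r, hr⟩ := exists_eq_eval_of_ker pairing_surjective l (fun η hη => by
    obtain ⟨G, hG⟩ := exists_primitive_of_pairing_eq_zero η hη
    have hGc : Continuous G := continuous_iff_continuousAt.2 fun p => (hG p).continuousAt
    rw [← integral_coboundary k.continuous hk hGc]
    refine integral_congr_ae (Filter.Eventually.of_forall fun z => ?_)
    refine (pathIntegral_of_isPrimitiveNear fun t => hG _).trans ?_
    change G (H.evalAt z 1) - G (H.evalAt z 0) = G (k z) - G z
    rw [(H.evalAt z).source, (H.evalAt z).target]
    rfl)
  exact ⟨r, fun η hη => (hr ⟨η, hη⟩).trans (pairing_apply ⟨η, hη⟩ r)⟩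

variable [OrientedAtlas S]

/-- On a surface of genus at least two, path integrals along the trajectories of a homotopy from
the identity do not depend on the homotopy. -/
theorem pathIntegral_evalAt_eq (hdim : 2 < Module.finrank ℝ (H1 S)) (hη : IsClosedForm η)
    {k : C(S, S)} (H H' : (ContinuousMap.id S).Homotopy k) (z : S) :
    pathIntegral η (H.evalAt z) = pathIntegral η (H'.evalAt z) := by
  -- One homotopy followed by the reverse of the other is a loop of maps based at the identity.
  have h := pathIntegral_eq_zero_of_loop hdim hη (H.trans H'.symm).toContinuousMap
    (H.trans H'.symm).map_zero_left (H.trans H'.symm).map_one_left z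
  have e : pathIntegral η ((H.trans H'.symm).evalAt z) = 0 := h
  rw [ContinuousMap.Homotopy.evalAt_trans, pathIntegral_trans hη,
    ContinuousMap.Homotopy.evalAt_symm, pathIntegral_symm hη] at e
  linarith

variable [MeasurableSpace S] [BorelSpace S] {μ : Measure S} [IsProbabilityMeasure μ]

/-- Existence comes from the mean along one isotopy; the bound on the Betti number makes the answer
the same for every isotopy. -/
theorem isRotationVector_rotationVector (hdim : 2 < Module.finrank ℝ (H1 S)) {k : S → S}
    (hk : IsotopicToId k) (hkμ : MeasurePreserving k μ μ) :
    IsRotationVector k μ (rotationVector k μ) := by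
  have : FiniteDimensional ℝ (H1 S) := FiniteDimensional.of_finrank_pos (by omega)
  refine Classical.epsilon_spec (p := IsRotationVector k μ) ?_
  obtain ⟨J⟩ := id hk
  obtain ⟨r, hr⟩ := exists_rotation_class (k := ⟨k, J.continuous⟩) hkμ (J.toHomotopy J.continuous)
  refine ⟨r, hk, fun J' η hη => ?_⟩
  rw [← hr η hη]
  exact integral_congr_ae (Filter.Eventually.of_forall fun z =>
    pathIntegral_evalAt_eq hdim hη (J'.toHomotopy J.continuous) (J.toHomotopy J.continuous) z)

theorem IsRotationVector.integral_evalAt (hdim : 2 < Module.finrank ℝ (H1 S)) {k : C(S, S)}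
    {r : H1 S} (hr : IsRotationVector k μ r) (H : (ContinuousMap.id S).Homotopy k)
    (hη : IsClosedForm η) : ∫ z, pathIntegral η (H.evalAt z) ∂μ = formPairing η r := by
  obtain ⟨J⟩ := hr.1
  rw [← hr.2 J η hη]
  exact integral_congr_ae (Filter.Eventually.of_forall fun z =>
    pathIntegral_evalAt_eq hdim hη H (J.toHomotopy k.continuous) z)

/-- The mean rotation of the image of a homotopy under a continuous map. -/
theorem IsRotationVector.integral_comp (hdim : 2 < Module.finrank ℝ (H1 S)) {k : C(S, S)}
    {r : H1 S} (hr : IsRotationVector k μ r) (hk : MeasurePreserving k μ μ)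
    (H : (ContinuousMap.id S).Homotopy k) (F : C(S, S)) (hβ : IsClosedForm β) :
    ∫ z, pathIntegral β (F.comp (H.evalAt z : C(I, S))) ∂μ =
      formPairing β (homologyMap F r) := by
  -- The pull-back of β is η up to dG, and the increments of G between z and k(z) have zero mean by
  -- invariance of μ.
  obtain ⟨η, G, hη, hG, hGγ, -⟩ := exists_pullback F hβ
  rw [formPairing_homologyMap hη hβ hGγ, ← hr.integral_evalAt hdim H hη, ← sub_eq_zero,
    ← integral_sub, ← integral_coboundary k.continuous hk hG]
  · refine integral_congr_ae (Filter.Eventually.of_forall fun z => ?_)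
    have e := hGγ (H.evalAt z : C(I, S))
    have e1 : (H.evalAt z : C(I, S)) 1 = k z := (H.evalAt z).target
    have e0 : (H.evalAt z : C(I, S)) 0 = z := (H.evalAt z).source
    rw [e1, e0] at e
    simp only
    rw [e]
    ring
  · refine continuous_integrable (continuous_pathIntegral hβ (F.comp H.toContinuousMap) _ ?_)
    exact fun _ _ => rfl
  · exact continuous_integrable (continuous_pathIntegral_evalAt hη H)

/-- The rotation vector is invariant under conjugation by a measure preserving homeomorphism that
commutes with the map. -/
theorem IsRotationVector.homologyMap_symm (hdim : 2 < Module.finrank ℝ (H1 S)) {k : C(S, S)}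
    {r : H1 S} (hr : IsRotationVector k μ r) (hk : MeasurePreserving k μ μ) (f : S ≃ₜ S)
    (hf : MeasurePreserving f μ μ) (hfk : ∀ z, k (f z) = f (k z)) (hβ : IsClosedForm β) :
    formPairing β (homologyMap (f.symm : C(S, S)) r) = formPairing β r := by
  obtain ⟨J⟩ := hr.1
  let H := J.toHomotopy k.continuous
  -- The conjugate f⁻¹ ∘ H_t ∘ f still ends at k because k and f commute. Independence of the
  -- homotopy identifies its mean with that of H, and invariance of μ under f removes the inner f.
  let H' : (ContinuousMap.id S).Homotopy k :=
    { toContinuousMap := ⟨fun x => f.symm (H (x.1, f x.2)), by fun_prop⟩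
      map_zero_left := fun z => by
        change f.symm (J.toMap (0, f z)) = z
        rw [J.map_zero, f.symm_apply_apply]
      map_one_left := fun z => by
        change f.symm (J.toMap (1, f z)) = k z
        rw [J.map_one, hfk, f.symm_apply_apply] }
  rw [← hr.integral_comp hdim hk H _ hβ, ← hr.integral_evalAt hdim H' hβ]
  refine (integral_comp_measurePreserving hf ?_).symm
  exact continuous_pathIntegral hβ ((f.symm : C(S, S)).comp H.toContinuousMap) _ fun _ _ => rfl

end RotationVectors

end

noncomputable section

/-! ### Invariance of the intersection form -/

section Invariance

variable {S : Type u} [TopologicalSpace S] [ChartedSpace Plane S]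

/-- The pullback of a one-form by a differentiable map. -/
def pullbackForm (f : S → S) (η : OneForm S) : OneForm S :=
  fun x => show Plane →L[ℝ] ℝ from (formAt η (f x)).comp (tangentMapAt f x)

theorem wedge_pullbackForm (f : S → S) (η β : OneForm S) :
    wedge (pullbackForm f η) (pullbackForm f β) = pullbackTwoForm f (wedge η β) :=
  funext fun x => wedgeAt_comp (formAt η (f x)) (formAt β (f x)) (tangentMapAt f x)

theorem pullbackForm_pullbackForm {f g : S → S} {x : S} (hf : MDifferentiableAt (𝓡 2) (𝓡 2) f x)
    (hg : MDifferentiableAt (𝓡 2) (𝓡 2) g (f x)) (hgf : ∀ z, g (f z) = z) (β : OneForm S) :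
    pullbackForm f (pullbackForm g β) x = β x := by
  have h1 : (tangentMapAt g (f x)).comp (tangentMapAt f x) = ContinuousLinearMap.id ℝ Plane := by
    have e := (hg.hasMFDerivAt.comp x hf.hasMFDerivAt).mfderiv
    rw [show g ∘ f = id from funext hgf] at e
    exact e.symm.trans mfderiv_id
  have h2 : (formAt β (g (f x))).comp ((tangentMapAt g (f x)).comp (tangentMapAt f x)) =
      formAt β x := by
    rw [h1, ContinuousLinearMap.comp_id, hgf]
  exact h2

variable [IsManifold (𝓡 2) ∞ S] [CompactSpace S] [T2Space S]

/-- The pullback of a closed form by a map of class `C¹`. -/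
theorem exists_pullbackForm_eq {f : S → S} (hf : ContMDiff (𝓡 2) (𝓡 2) 1 f) {β : OneForm S}
    (hβ : IsClosedForm β) : ∃ (η : OneForm S) (G : S → ℝ), IsClosedForm η ∧
      ContMDiff (𝓡 2) 𝓘(ℝ, ℝ) 1 G ∧ pullbackForm f β = η + dForm G ∧
      ∀ γ : C(I, S), pathIntegral β ((⟨f, hf.continuous⟩ : C(S, S)).comp γ) =
        pathIntegral η γ + (G (γ 1) - G (γ 0)) := by
  obtain ⟨η, G, hη, -, hγ, hreg⟩ := exists_pullback ⟨f, hf.continuous⟩ hβ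
  obtain ⟨hG, hd⟩ := hreg hf
  exact ⟨η, G, hη, hG, funext fun x => ContinuousLinearMap.ext fun v => hd x v, hγ⟩

variable [OrientedAtlas S]

theorem formOfClass_zero_dForm {G : S → ℝ} (hG : ContMDiff (𝓡 2) 𝓘(ℝ, ℝ) 1 G) :
    FormOfClass 0 (dForm G) :=
  formOfClass_dForm (n := 0) (by simpa using hG)

/-- A Poincaré dual of the image of a class under an orientation-preserving diffeomorphism. -/
theorem exists_isPoincareDual_homologyMap (f : S ≃ₘ^1⟮𝓡 2, 𝓡 2⟯ S)
    (hfo : OrientationPreserving f) {ρ : H1 S} {β : OneForm S} (hβ : IsPoincareDual ρ β) :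
    ∃ (ζ : OneForm S) (G : S → ℝ), IsPoincareDual (homologyMap ⟨f, f.continuous⟩ ρ) ζ ∧
      ∀ γ : C(I, S), pathIntegral β ((f.toHomeomorph.symm : C(S, S)).comp γ) =
        pathIntegral ζ γ + (G (γ 1) - G (γ 0)) := by
  -- The candidate dual is (f⁻¹)^*β, corrected by an exact form to be of class C¹. The verification
  -- is ⟨η, f_*ρ⟩ = ⟨f^*η, ρ⟩ = ∫ f^*η ∧ β = ∫ f^*(η ∧ (f⁻¹)^*β) = ∫ η ∧ (f⁻¹)^*β; exact corrections
  -- do not contribute, by Stokes.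
  obtain ⟨ζ, G, hζ, hG, hζβ, hζγ⟩ := exists_pullbackForm_eq (f := f.symm) f.symm.contMDiff hβ.1
  refine ⟨ζ, G, ⟨hζ, fun η hη => ?_⟩, hζγ⟩
  obtain ⟨η', G', hη', hG', hη'η, hη'γ⟩ := exists_pullbackForm_eq f.contMDiff hη
  have hfd : ∀ x, MDifferentiableAt (𝓡 2) (𝓡 2) f x := fun x =>
    f.contMDiff.contMDiffAt.mdifferentiableAt (by simp)
  have hfd' : ∀ x, MDifferentiableAt (𝓡 2) (𝓡 2) f.symm x := fun x =>
    f.symm.contMDiff.contMDiffAt.mdifferentiableAt (by simp)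
  have hc : ∀ {τ : OneForm S}, IsClosedForm τ → FormOfClass 0 τ := fun h =>
    h.formOfClass.of_le zero_le_one
  have e1 : formPairing η (homologyMap ⟨f, f.continuous⟩ ρ) = integralWedge η' β := by
    rw [formPairing_homologyMap hη' hη hη'γ, hβ.2 η' hη']
  have e2 : integralWedge (pullbackForm f η) β = integralWedge η' β := by
    rw [hη'η, integralWedge_add_left (hc hη') (formOfClass_zero_dForm hG') (hc hβ.1),
      integralWedge_dForm_left hG' hβ.1, add_zero]
  have e3 : integralWedge η (pullbackForm f.symm β) = integralWedge η ζ := by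
    rw [hζβ, integralWedge_add_right (hc hη) (hc hζ) (formOfClass_zero_dForm hG),
      integralWedge_swap (dForm G) η, integralWedge_dForm_left hG hη, neg_zero, add_zero]
  have e4 : pullbackForm f (pullbackForm f.symm β) = β := funext fun x =>
    pullbackForm_pullbackForm (hfd x) (hfd' _) f.symm_apply_apply β
  have e5 : wedge (pullbackForm f η) β =
      pullbackTwoForm f (wedge η (pullbackForm f.symm β)) := by
    rw [← wedge_pullbackForm, e4]
  have c1 : TwoFormOfClass 0 (wedge η (pullbackForm f.symm β)) := by
    rw [hζβ]
    exact (hc hη).wedge ((hc hζ).add (formOfClass_zero_dForm hG))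
  have c2 : TwoFormOfClass 0 (wedge (pullbackForm f η) β) := by
    rw [hη'η]
    exact ((hc hη').add (formOfClass_zero_dForm hG')).wedge (hc hβ.1)
  rw [e1, ← e2, ← e3, integralWedge_eq, integralWedge_eq, e5]
  rw [e5] at c2
  exact integralTwoForm_pullback f.toHomeomorph.isHomeomorph hfd
    (fun x => hfo.det_pos (hfd x)) c1 c2

end Invariance

/-! ### Isotopies through compositions -/

section Compositions

open MeasureTheory

variable {S : Type u} [TopologicalSpace S]

/-- The path of maps `t ↦ (h_t ∘ f)^n` associated with a homotopy from the identity. -/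
def iterateHomotopy {f h : C(S, S)} (H : (ContinuousMap.id S).Homotopy h) (n : ℕ) :
    (⟨f^[n], f.continuous.iterate n⟩ : C(S, S)).Homotopy
      ⟨(h ∘ f)^[n], (h.continuous.comp f.continuous).iterate n⟩ where
  toFun x := (fun z => H (x.1, f z))^[n] x.2
  continuous_toFun := by
    -- Carrying the parameter along turns the family of iterates into the iterates of a single
    -- continuous map of I × S.
    have : ∀ x : I × S, (fun z => H (x.1, f z))^[n] x.2 =
        ((fun x : I × S => (x.1, H (x.1, f x.2)))^[n] x).2 := by
      intro x
      have e : ∀ m, (fun x : I × S => (x.1, H (x.1, f x.2)))^[m] x =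
          (x.1, (fun z => H (x.1, f z))^[m] x.2) := by
        intro m
        induction m with
        | zero => rfl
        | succ m ih => rw [Function.iterate_succ_apply', ih, Function.iterate_succ_apply']
      rw [e n]
    simp only [this]
    exact continuous_snd.comp (Continuous.iterate (by fun_prop) n)
  map_zero_left z := by
    have : (fun z => H (0, f z)) = f := funext fun z => H.apply_zero _
    simp only [this]
    rfl
  map_one_left z := by
    have : (fun z => H (1, f z)) = h ∘ f := funext fun z => H.apply_one _
    simp only [this]
    rfl

theorem IsHomeomorph.iterate {f : S → S} (hf : IsHomeomorph f) (n : ℕ) : IsHomeomorph f^[n] := by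
  induction n with
  | zero => exact IsHomeomorph.id
  | succ n ih => exact ih.comp hf

variable [ChartedSpace Plane S] [IsManifold (𝓡 2) ∞ S] [CompactSpace S] [T2Space S]
  [ConnectedSpace S] [OrientedAtlas S] [MeasurableSpace S] [BorelSpace S] {μ : Measure S}
  [IsProbabilityMeasure μ]

theorem homologyMap_iterate (f : C(S, S)) (n : ℕ) (ρ : H1 S) :
    homologyMap ⟨f^[n], f.continuous.iterate n⟩ ρ = (homologyMap f)^[n] ρ := by
  induction n generalizing ρ with
  | zero => exact LinearMap.congr_fun homologyMap_id ρ
  | succ n ih =>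
    have e : (⟨f^[n + 1], f.continuous.iterate (n + 1)⟩ : C(S, S)) =
      (⟨f^[n], f.continuous.iterate n⟩ : C(S, S)).comp f := rfl
    rw [e, homologyMap_comp, Function.iterate_succ_apply, ← ih]
    rfl

/-- The mean rotation of the path of maps `t ↦ (h_t ∘ f)^n`. -/
theorem integral_iterateHomotopy (hdim : 2 < Module.finrank ℝ (H1 S)) {f h : C(S, S)}
    (hf : MeasurePreserving f μ μ) (hh : MeasurePreserving h μ μ)
    (H : (ContinuousMap.id S).Homotopy h) {r : H1 S} (hr : IsRotationVector h μ r) {η : OneForm S}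
    (hη : IsClosedForm η) (n : ℕ) :
    ∫ z, pathIntegral η ((iterateHomotopy (f := f) H n).evalAt z) ∂μ =
      ∑ j ∈ Finset.range n, formPairing η ((homologyMap f)^[j] r) := by
  induction n with
  | zero =>
    rw [Finset.sum_range_zero]
    refine integral_eq_zero_of_ae (Filter.Eventually.of_forall fun z => ?_)
    exact (isPathCocycle_pathIntegral hη).const z
  | succ n ih =>
    let fn : C(S, S) := ⟨f^[n], f.continuous.iterate n⟩
    have key : ∀ z, pathIntegral η ((iterateHomotopy (f := f) H (n + 1)).evalAt z) =
        pathIntegral η (fn.comp (H.evalAt (f z) : C(I, S))) +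
          pathIntegral η ((iterateHomotopy (f := f) H n).evalAt (h (f z))) := by
      intro z
      -- The diagonal of this square is the trajectory for n + 1. It is homologous to the side s =
      -- 0, the image under f^n of a trajectory of H, followed by the side t = 1, the trajectory for
      -- n issued from h(f(z)). Invariance of μ then removes the shifts of base point.
      let Ψ : C(I × I, S) :=
        ⟨fun x => iterateHomotopy (f := f) H n (x.1, H (x.2, f z)), by fun_prop⟩
      obtain ⟨F, -, hF⟩ := gluesLocalFunctions_square.exists_potential hη Ψ
      have d := hF ⟨fun t => (t, t), by fun_prop⟩
      have a := hF ⟨fun t => (0, t), by fun_prop⟩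
      have b := hF ⟨fun t => (t, 1), by fun_prop⟩
      have ed : Ψ.comp ⟨fun t => (t, t), by fun_prop⟩ =
          ((iterateHomotopy (f := f) H (n + 1)).evalAt z : C(I, S)) := rfl
      have ea : Ψ.comp ⟨fun t => (0, t), by fun_prop⟩ = fn.comp (H.evalAt (f z) : C(I, S)) := by
        ext t
        exact (iterateHomotopy (f := f) H n).apply_zero _
      have eb : Ψ.comp ⟨fun t => (t, 1), by fun_prop⟩ =
          ((iterateHomotopy (f := f) H n).evalAt (h (f z)) : C(I, S)) := by
        ext t
        change iterateHomotopy (f := f) H n (t, H (1, f z)) =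
          iterateHomotopy (f := f) H n (t, h (f z))
        rw [H.apply_one]
      rw [ed] at d
      rw [ea] at a
      rw [eb] at b
      rw [d, a, b]
      change F (1, 1) - F (0, 0) = F (0, 1) - F (0, 0) + (F (1, 1) - F (0, 1))
      ring
    have c1 : Continuous fun z => pathIntegral η (fn.comp (H.evalAt z : C(I, S))) :=
      continuous_pathIntegral hη (fn.comp H.toContinuousMap) _ fun _ _ => rfl
    have c2 := continuous_pathIntegral_evalAt hη (iterateHomotopy (f := f) H n)
    have i1 := integral_comp_measurePreserving hf c1
    have i2 := integral_comp_measurePreserving (hh.comp hf) c2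
    simp only [key]
    have n1 : Integrable (fun z => pathIntegral η (fn.comp (H.evalAt (f z) : C(I, S)))) μ :=
      continuous_integrable (c1.comp f.continuous)
    have n2 : Integrable
        (fun z => pathIntegral η ((iterateHomotopy (f := f) H n).evalAt (h (f z)))) μ :=
      continuous_integrable (c2.comp (h.continuous.comp f.continuous))
    rw [integral_add n1 n2]
    rw [Finset.sum_range_succ, ← ih, ← homologyMap_iterate, ← hr.integral_comp hdim hh H fn hη,
      i1, add_comm]
    exact congrArg (· + _) i2

end Compositions

end

/-! ### The main theorem -/

theorem mainTheorem12 {S : Type u} [TopologicalSpace S] [ChartedSpace Plane S]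
    [IsManifold (𝓡 2) ∞ S] [CompactSpace S] [ConnectedSpace S] [T2Space S] [OrientedAtlas S]
    [MeasurableSpace S] [BorelSpace S] (g : ℕ) (hg : 2 ≤ g) (hS : HasGenus S g)
    (f : S ≃ₘ^1⟮𝓡 2, 𝓡 2⟯ S) (hfo : OrientationPreserving f)
    (μ : MeasureTheory.Measure S) [MeasureTheory.IsProbabilityMeasure μ]
    (hfμ : MeasureTheory.MeasurePreserving f μ μ)
    (q : ℕ) (hq : 1 ≤ q) (hfq : IsotopicToId f^[q]) :
    IsRotationVector f^[q] μ (rotationVector f^[q] μ) ∧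
    (∀ ρ : H1 S,
      intersectionForm (homologyMap ⟨f, f.continuous⟩ ρ) (rotationVector f^[q] μ) =
        intersectionForm ρ (rotationVector f^[q] μ)) ∧
    ∀ h : S ≃ₘ^1⟮𝓡 2, 𝓡 2⟯ S, IsotopicToId h → MeasureTheory.MeasurePreserving h μ μ →
      IsRotationVector h μ (rotationVector h μ) ∧
      IsRotationVector (h ∘ f)^[q] μ (rotationVector (h ∘ f)^[q] μ) ∧
      intersectionForm (rotationVector (h ∘ f)^[q] μ) (rotationVector f^[q] μ) =
        q * intersectionForm (rotationVector h μ) (rotationVector f^[q] μ) := by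
  have hdim : 2 < Module.finrank ℝ (H1 S) := by
    have : Module.finrank ℝ (H1 S) = 2 * g := hS
    omega
  have : FiniteDimensional ℝ (H1 S) := FiniteDimensional.of_finrank_pos (by omega)
  have hfqμ : MeasureTheory.MeasurePreserving f^[q] μ μ := hfμ.iterate q
  have hr := isRotationVector_rotationVector hdim hfq hfqμ
  set r := rotationVector f^[q] μ with hrdef
  have claim : ∀ ρ : H1 S,
      intersectionForm (homologyMap ⟨f, f.continuous⟩ ρ) r = intersectionForm ρ r := by
    intro ρ
    have hβ := isPoincareDual_poincareDual ρ
    obtain ⟨ζ, G, hζ, hζγ⟩ := exists_isPoincareDual_homologyMap f hfo hβ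
    -- With ζ dual to f_*ρ and cohomologous to (f⁻¹)^*β, the claim becomes ⟨β, (f⁻¹)_* r⟩ = ⟨β, r⟩,
    -- that is, the invariance of r.
    rw [hζ.intersectionForm_eq, hβ.intersectionForm_eq, ← formPairing_homologyMap hζ.1 hβ.1 hζγ]
    exact IsRotationVector.homologyMap_symm hdim
      (k := ⟨f^[q], f.continuous.iterate q⟩) hr hfqμ f.toHomeomorph hfμ
      (fun z => (Function.Commute.iterate_self f q).eq z) hβ.1
  refine ⟨hr, claim, fun h hh hhμ => ?_⟩
  have hrh := isRotationVector_rotationVector hdim hh hhμ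
  obtain ⟨J⟩ := hfq
  obtain ⟨K⟩ := hh
  let fc : C(S, S) := ⟨f, f.continuous⟩
  let hc : C(S, S) := ⟨h, h.continuous⟩
  let H : (ContinuousMap.id S).Homotopy hc := K.toHomotopy h.continuous
  let L := iterateHomotopy (f := fc) H q
  -- An isotopy from the identity to f^q, followed by the path of homeomorphisms t ↦ (h_t ∘ f)^q.
  have hiso : IsotopicToId (h ∘ f)^[q] :=
    J.isotopicToId_of_homotopy (fc.continuous.iterate q) L fun t =>
      ((K.isHomeomorph t).comp f.toHomeomorph.isHomeomorph).iterate q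
  have hr' := isRotationVector_rotationVector hdim hiso ((hhμ.comp hfμ).iterate q)
  refine ⟨hrh, hr', ?_⟩
  set r' := rotationVector (h ∘ f)^[q] μ
  set s := rotationVector h μ
  -- Additivity of the mean integrals along this concatenation: the first part contributes r, the
  -- second the sum of the f_*^j s.
  have hsum : ∀ η, IsClosedForm η → formPairing η r' = formPairing η r +
      ∑ j ∈ Finset.range q, formPairing η ((homologyMap fc)^[j] s) := by
    intro η hη
    let M := J.toHomotopy (fc.continuous.iterate q)
    have e1 := hr'.integral_evalAt hdim
      (k := ⟨(h ∘ f)^[q], (h.continuous.comp f.continuous).iterate q⟩) (M.trans L) hη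
    have e2 := hr.integral_evalAt hdim (k := ⟨f^[q], f.continuous.iterate q⟩) M hη
    rw [← e1, ← e2, ← integral_iterateHomotopy hdim hfμ hhμ H hrh hη q,
      ← MeasureTheory.integral_add (continuous_integrable (continuous_pathIntegral_evalAt hη M))
        (continuous_integrable (continuous_pathIntegral_evalAt hη L))]
    simp only [ContinuousMap.Homotopy.evalAt_trans, pathIntegral_trans hη]
  have hiter : ∀ j, intersectionForm ((homologyMap fc)^[j] s) r = intersectionForm s r := by
    intro j
    induction j with
    | zero => rfl
    | succ j ih => rw [Function.iterate_succ_apply', claim, ih]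
  have hd := isPoincareDual_poincareDual r
  have hself : intersectionForm r r = 0 := by
    have := intersectionForm_swap r r
    linarith
  -- Additivity is known only for pairings with closed forms, so the intersection is rewritten as
  -- the pairing with the dual of r and translated back term by term; the term r ∧ r vanishes.
  rw [intersectionForm_swap, hd.intersectionForm_eq, hsum _ hd.1, ← hd.intersectionForm_eq, hself]
  simp only [← hd.intersectionForm_eq]
  simp only [intersectionForm_swap r, hiter]
  simp
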